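/- All digraphs are finite and may contain loops and multiple arcs. A dicycle is a directed cycle of a digraph $D$ (a loop is a dicycle of length $1$), and a cycle is a cycle of the underlying undirected multigraph $\mathrm{UG}(D)$, which has the same vertices as $D$ and one edge for each arc of $D$ (a loop is a cycle of length $1$, and two distinct arcs between the same two vertices form a cycle of length $2$). A set $T\subseteq V(D)$ is a dicycle transversal of $D$ if $D-T$ contains no dicycle; $\tau(D)$ is the minimum size of a dicycle transversal of $D$, and a vertex $v$ is a dicycle transversal vertex if $\{v\}$ is a dicycle transversal. **Theorem.** For each fixed $k$ there is an algorithm, with running time bounded by a polynomial (which may depend on $k$) in $|V(D)|+|A(D)|$, that, given a digraph $D$ with $\tau(D)=1$ and at most $k$ dicycle transversal vertices, decides whether there are a dicycle $B$ in $D$ and a cycle $C$ in $\mathrm{UG}(D)$ with $V(B)\cap V(C)=\emptyset$, and finds such cycles $B$ and $C$ if they exist. -/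

import Mathlib

/-! ## Finite directed multigraphs, dicycles, cycles, and dicycle transversals -/

/-- A digraph with vertex set `V` and arc set `A`; loops and multiple arcs are allowed.
The arc `a` goes from `tail a` to `head a`. -/
structure Multidigraph (V A : Type*) where
  tail : A → V
  head : A → V

namespace Multidigraph

/-- The underlying undirected multigraph `UG(D)`: same vertices and same arcs (as edges), where `e`
has the ends `tail e` and `head e`. -/
def underlying {V A : Type*} (D : Multidigraph V A) : Graph V A where
  vertexSet := Set.univ
  IsLink e x y := (D.tail e = x ∧ D.head e = y) ∨ (D.tail e = y ∧ D.head e = x)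
  isLink_symm := fun _ _ => ⟨fun _ _ h => h.symm⟩
  eq_or_eq_of_isLink_of_isLink := by
    rintro e x y v w (⟨h1, h2⟩ | ⟨h1, h2⟩) (⟨h3, h4⟩ | ⟨h3, h4⟩)
    · exact Or.inl (h1.symm.trans h3)
    · exact Or.inr (h1.symm.trans h3)
    · exact Or.inr (h2.symm.trans h4)
    · exact Or.inl (h2.symm.trans h4)
  left_mem_of_isLink := fun _ _ _ _ => Set.mem_univ _

/-- `B = [e₀, …, e_{l-1}]`, `l ≥ 1`, lists the arcs of a dicycle of `D` in cyclic order: the head of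
each arc is the tail of the (cyclically) next one, and the vertices `tail e₀, …, tail e_{l-1}` are
distinct. A loop is a dicycle of length `1`. -/
def IsDicycle {V A : Type*} (D : Multidigraph V A) (B : List A) : Prop :=
  B ≠ [] ∧ (B.map D.tail).Nodup ∧ B.map D.head = (B.map D.tail).rotate 1

/-- The vertex set of the dicycle with arc list `B`. -/
def dicycleVerts {V A : Type*} (D : Multidigraph V A) (B : List A) : Set V :=
  {v | v ∈ B.map D.tail}

/-- `C = [(v₀, e₀), …, (v_{l-1}, e_{l-1})]`, `l ≥ 1`, lists the vertices and edges of a cycle of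
`UG(D)` in cyclic order: the `vᵢ` are distinct, the `eᵢ` are distinct, and `eᵢ` joins `vᵢ` to
`v_{i+1}` (indices modulo `l`). A loop is a cycle of length `1`, and two distinct arcs
between the same two vertices (parallel or opposite) form a cycle of length `2`. -/
def IsCycle {V A : Type*} (D : Multidigraph V A) (C : List (V × A)) : Prop :=
  C ≠ [] ∧ (C.map Prod.fst).Nodup ∧ (C.map Prod.snd).Nodup ∧
    List.Forall₂ (fun p w => D.underlying.IsLink p.2 p.1 w) C ((C.map Prod.fst).rotate 1)

/-- The vertex set of the cycle `C`. -/
def cycleVerts {V A : Type*} (C : List (V × A)) : Set V :=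
  {v | v ∈ C.map Prod.fst}

/-- `B` is a dicycle in `D`, `C` is a cycle in `UG(D)`, and they have no common vertex. -/
def IsDisjointPair {V A : Type*} (D : Multidigraph V A) (B : List A) (C : List (V × A)) : Prop :=
  D.IsDicycle B ∧ D.IsCycle C ∧ Disjoint (D.dicycleVerts B) (cycleVerts C)

/-- A digraph is acyclic if it has no dicycle. -/
def IsAcyclic {V A : Type*} (D : Multidigraph V A) : Prop :=
  ∀ B : List A, ¬ D.IsDicycle B

/-- The digraph `D - T`: the vertices of `T` and all arcs with an end in `T` are deleted. -/
def deleteVerts {V A : Type*} (D : Multidigraph V A) (T : Set V) :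
    Multidigraph {v : V // v ∉ T} {a : A // D.tail a ∉ T ∧ D.head a ∉ T} where
  tail a := ⟨D.tail a.1, a.2.1⟩
  head a := ⟨D.head a.1, a.2.2⟩

/-- `T` is a dicycle transversal of `D`. -/
def IsDicycleTransversal {V A : Type*} (D : Multidigraph V A) (T : Set V) : Prop :=
  (D.deleteVerts T).IsAcyclic

/-- The dicycle transversal number of `D` (for finite `D` the set below contains the number of
vertices, so it is not empty). -/
noncomputable def transversalNumber {V A : Type*} (D : Multidigraph V A) : ℕ :=
  sInf {t | ∃ T : Finset V, D.IsDicycleTransversal (T : Set V) ∧ T.card = t}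

/-- The transversal vertices of `D`: those vertices `v` for which `D - v` is acyclic. -/
def transversalVertices {V A : Type*} (D : Multidigraph V A) : Set V :=
  {v | D.IsDicycleTransversal {v}}

end Multidigraph

/-! ## A random access machine with a step count

Programs use finitely many variables and finitely many one-dimensional arrays, all holding natural
numbers. The arithmetic operations are addition and truncated subtraction, each of unit cost;
there is no multiplication. -/

namespace RAM

/-- Memory contents: `var x` is the variable number `x`, and `arr a i` is the entry number `i` of
the array number `a`. -/
structure State where
  var : ℕ → ℕ
  arr : ℕ → ℕ → ℕ

/-- Expressions: constants, variables, array entries `a[e]`, sums, truncated differences. -/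
inductive Exp : Type
  | const (c : ℕ) : Exp
  | var (x : ℕ) : Exp
  | read (a : ℕ) (e : Exp) : Exp
  | add (e f : Exp) : Exp
  | sub (e f : Exp) : Exp

/-- The value of an expression. -/
def Exp.eval (s : State) : Exp → ℕ
  | .const c => c
  | .var x => s.var x
  | .read a e => s.arr a (e.eval s)
  | .add e f => e.eval s + f.eval s
  | .sub e f => e.eval s - f.eval s

/-- The number of steps for evaluating an expression: one for each operation in it. -/
def Exp.cost : Exp → ℕ
  | .const _ => 1
  | .var _ => 1
  | .read _ e => e.cost + 1
  | .add e f => e.cost + f.cost + 1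
  | .sub e f => e.cost + f.cost + 1

/-- Programs. `set x e` is the assignment `x := e`, `write a i e` is `a[i] := e`,
`ite e p q` runs `p` if `e ≠ 0` and `q` if `e = 0`, and `loop e p` runs `p` while `e ≠ 0`. -/
inductive Prog : Type
  | skip : Prog
  | set (x : ℕ) (e : Exp) : Prog
  | write (a : ℕ) (i e : Exp) : Prog
  | seq (p q : Prog) : Prog
  | ite (e : Exp) (p q : Prog) : Prog
  | loop (e : Exp) (p : Prog) : Prog

/-- `Exec p s s' t`: started in the state `s`, the program `p` halts in the state `s'` after exactly
`t` steps. -/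
inductive Exec : Prog → State → State → ℕ → Prop
  | skip (s : State) : Exec .skip s s 1
  | set (x : ℕ) (e : Exp) (s : State) :
      Exec (.set x e) s ⟨Function.update s.var x (e.eval s), s.arr⟩ (e.cost + 1)
  | write (a : ℕ) (i e : Exp) (s : State) :
      Exec (.write a i e) s
        ⟨s.var, Function.update s.arr a (Function.update (s.arr a) (i.eval s) (e.eval s))⟩
        (i.cost + e.cost + 1)
  | seq {p q : Prog} {s s' s'' : State} {t t' : ℕ} :
      Exec p s s' t → Exec q s' s'' t' → Exec (.seq p q) s s'' (t + t')
  | ite_pos {e : Exp} {p q : Prog} {s s' : State} {t : ℕ} :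
      e.eval s ≠ 0 → Exec p s s' t → Exec (.ite e p q) s s' (e.cost + 1 + t)
  | ite_zero {e : Exp} {p q : Prog} {s s' : State} {t : ℕ} :
      e.eval s = 0 → Exec q s s' t → Exec (.ite e p q) s s' (e.cost + 1 + t)
  | loop_pos {e : Exp} {p : Prog} {s s' s'' : State} {t t' : ℕ} :
      e.eval s ≠ 0 → Exec p s s' t → Exec (.loop e p) s' s'' t' →
        Exec (.loop e p) s s'' (e.cost + 1 + t + t')
  | loop_zero {e : Exp} {p : Prog} {s : State} :
      e.eval s = 0 → Exec (.loop e p) s s (e.cost + 1)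

/-- Execution is deterministic: final state and number of steps are determined by the program
and the initial state. -/
theorem Exec.deterministic {p : Prog} {s s₁ s₂ : State} {t₁ t₂ : ℕ}
    (h₁ : Exec p s s₁ t₁) (h₂ : Exec p s s₂ t₂) : s₁ = s₂ ∧ t₁ = t₂ := by
  induction h₁ generalizing s₂ t₂ with
  | skip => cases h₂; exact ⟨rfl, rfl⟩
  | set => cases h₂; exact ⟨rfl, rfl⟩
  | write => cases h₂; exact ⟨rfl, rfl⟩
  | seq _ _ ih ih' =>
    cases h₂ with
    | seq a b =>
      obtain ⟨rfl, rfl⟩ := ih a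
      obtain ⟨rfl, rfl⟩ := ih' b
      exact ⟨rfl, rfl⟩
  | ite_pos h _ ih =>
    cases h₂ with
    | ite_pos _ a => obtain ⟨rfl, rfl⟩ := ih a; exact ⟨rfl, rfl⟩
    | ite_zero h' => exact absurd h' h
  | ite_zero h _ ih =>
    cases h₂ with
    | ite_pos h' => exact absurd h h'
    | ite_zero _ a => obtain ⟨rfl, rfl⟩ := ih a; exact ⟨rfl, rfl⟩
  | loop_pos h _ _ ih ih' =>
    cases h₂ with
    | loop_pos _ a b =>
      obtain ⟨rfl, rfl⟩ := ih a
      obtain ⟨rfl, rfl⟩ := ih' b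
      exact ⟨rfl, rfl⟩
    | loop_zero h' => exact absurd h' h
  | loop_zero h =>
    cases h₂ with
    | loop_pos h' => exact absurd h h'
    | loop_zero => exact ⟨rfl, rfl⟩

/-- The initial state on the input list `l`: the variable `0` holds the length of `l`, the array `0`
holds the entries of `l`, and everything else is `0`. -/
def init (l : List ℕ) : State where
  var x := if x = 0 then l.length else 0
  arr a i := if a = 0 then l.getD i 0 else 0

/-- The output list in a state: its length is in the variable `0`, its entries are in the
array `0`. -/
def output (s : State) : List ℕ :=
  (List.range (s.var 0)).map (s.arr 0)

/-- On the input `l` the program `p` halts after at most `T` steps with the output `l'`. -/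
def OutputsWithin (p : Prog) (l l' : List ℕ) (T : ℕ) : Prop :=
  ∃ s t, Exec p (init l) s t ∧ output s = l' ∧ t ≤ T

end RAM

/-! ## The problem: input, answers, and their encodings -/

namespace Multidigraph

/-- The input list of a digraph with vertices `0, …, n - 1` and arcs `0, …, m - 1`:
`n, m, tail 0, head 0, tail 1, head 1, …, tail (m - 1), head (m - 1)`. -/
def encode {n m : ℕ} (D : Multidigraph (Fin n) (Fin m)) : List ℕ :=
  n :: m :: (List.finRange m).flatMap fun a => [(D.tail a : ℕ), (D.head a : ℕ)]

/-- An answer is either "no" (`none`) or a pair consisting of a dicycle of the digraph, given by its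
arcs, and a cycle of its underlying graph, given by its vertices and edges. -/
abbrev Answer (n m : ℕ) : Type := Option (List (Fin m) × List (Fin n × Fin m))

/-- "No" is written as the list `0`; the pair `[e₀, …, e_{r-1}]`, `[(v₀, f₀), …, (v_{l-1}, f_{l-1})]`
is written as the list `1, r, e₀, …, e_{r-1}, l, v₀, f₀, …, v_{l-1}, f_{l-1}`. -/
def encodeAnswer {n m : ℕ} : Answer n m → List ℕ
  | none => [0]
  | some (B, C) =>
      1 :: B.length :: (B.map fun e => (e : ℕ)) ++
        C.length :: C.flatMap fun p => [(p.1 : ℕ), (p.2 : ℕ)]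

/-- "No" is correct if there are no disjoint dicycle of `D` and cycle of `UG(D)`; a pair is correct
if it consists of such a dicycle and such a cycle. -/
def IsCorrectAnswer {n m : ℕ} (D : Multidigraph (Fin n) (Fin m)) : Answer n m → Prop
  | none => ¬ ∃ B C, D.IsDisjointPair B C
  | some (B, C) => D.IsDisjointPair B C

end Multidigraph

/-! # Disjoint dicycles and cycles in digraphs with a transversal vertex

If `τ(D) = 1`, then all dicycles pass through all transversal vertices of `D`, in the same cyclic
order. Call a set `F` of arcs *good* if it contains a dicycle and, for each vertex `v` that is not a
transversal vertex, a dicycle that avoids `v`. Let `F` be a minimal good set. By Menger's theorem,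
applied after doubling the transversal vertices, `F` consists of two dicycles that meet only in
transversal vertices (`Multidigraph.IsGood.eq_two_dicycles`).

Call a dicycle `B` a *solution* if the underlying graph of `D - V(B)` has a cycle, and let `B` be a
solution with the fewest arcs outside `F`. Between two consecutive transversal vertices, `B` leaves
the two dicycles of `F` at most twice at inner vertices
(`Multidigraph.IsExtremal.countP_isStart_le`). Otherwise `B` runs along pieces of the two dicycles
on alternating sides, and there are three pieces of `F` opposite to them, such that the replacement
of a part of `B` by any one of them leaves fewer arcs outside `F`. By the choice of `B`, each of
these pieces meets all cycles of `D - V(B)`. But then the replacement in the middle leaves a cycle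
that is formed with the help of the part of `B` that is set free
(`Multidigraph.hasCyc_of_three_pieces`), a contradiction. So `B` has at most `3 * k` *exits*, that
is, arcs that start at a transversal vertex or leave the vertices of `F` by an arc outside `F`.

If the underlying graph outside the vertices of `F` has a cycle, then a dicycle of `F` is a
solution, and `B` has no arc outside `F`. If it is a forest, then the way of `B` from an exit to
the next vertex of `F` is determined by its first and its last arc
(`Multidigraph.IsReference.mem_connector_iff`). Hence some guess of `3 * k` pairs of arcs determines
all arcs of `B`, except those that `F` forces, and each dicycle that follows the guess, and `F`
where the guess says nothing, runs inside `V(B)`, so it is a solution, too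
(`Multidigraph.exists_guess`). The algorithm computes `F` by greedy deletion of arcs and tests all
guesses, the number of which is polynomial for fixed `k`. Each test searches for a dicycle among the
allowed arcs, and then for a cycle that is disjoint from it.

The algorithm is written in a language `RAM.Cmd` of programs with bounded loops. All loop bounds are
in the variables `1, …, 5`, which are never changed after the setup, so that the number of steps of
the compiled program is at most a polynomial in these bounds (`RAM.Cmd.exists_exec`), while loop
invariants (`RAM.Cmd.loop_rule`) give correctness (`RAM.Base.tryGuess_spec`,
`RAM.Base.tryAll_spec`, `RAM.solve_spec`). The memory is used as follows.

* The variables `1, …, 5` hold `n`, `m`, `2 * m`, `3 * k`, `n + 1`. The arrays `1` and `2` hold the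
  tails and the heads of the arcs (numbers less than `m`) and of the reverse arcs (from `m` on).
* A search uses the edges marked in the array `3`, except the numbers `var 7` and `var 8`, and has
  the target `var 6`. It fills the arrays `4` (distances plus one) and `5` (next edges).
* A cycle that has been found (`var 13`) is listed in the array `16`, with length `var 12`.
* The arrays `6`, `7`, `8` mark the transversal vertices, the arcs of `F`, and the vertices of `F`.
* The arrays `9` and `10` hold the guess, and the arrays `17` and `18` mark the arcs that it
  prescribes and their tails. Later, the array `18` marks the vertices of the first cycle.
* `var 25` is `1` after a solution has been written to the output. -/

/-! ### Directed walks and dicycles -/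

namespace Multidigraph

variable {V A : Type*} (D : Multidigraph V A)

/-- `D.IsWalk u l v`: the arcs of the list `l` form, in this order, a directed walk from `u` to
`v`. -/
def IsWalk : V → List A → V → Prop
  | u, [], v => u = v
  | u, a :: l, v => D.tail a = u ∧ IsWalk (D.head a) l v

variable {D}

@[simp] theorem isWalk_nil {u v : V} : D.IsWalk u [] v ↔ u = v := Iff.rfl

@[simp] theorem isWalk_cons {u v : V} {a : A} {l : List A} :
    D.IsWalk u (a :: l) v ↔ D.tail a = u ∧ D.IsWalk (D.head a) l v := Iff.rfl

theorem isWalk_append {u v : V} {l l' : List A} :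
    D.IsWalk u (l ++ l') v ↔ ∃ w, D.IsWalk u l w ∧ D.IsWalk w l' v := by
  induction l generalizing u with
  | nil => simp
  | cons a l ih => simp [ih, and_assoc]

theorem IsWalk.append {u v w : V} {l l' : List A} (h : D.IsWalk u l w) (h' : D.IsWalk w l' v) :
    D.IsWalk u (l ++ l') v := isWalk_append.2 ⟨w, h, h'⟩

/-- A walk can be cut at every arc. -/
theorem isWalk_append_cons {u v : V} {l l' : List A} {a : A} :
    D.IsWalk u (l ++ a :: l') v ↔ D.IsWalk u l (D.tail a) ∧ D.IsWalk (D.tail a) (a :: l') v := by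
  rw [isWalk_append]
  constructor
  · rintro ⟨w, h, h'⟩
    obtain rfl := (isWalk_cons.1 h').1
    exact ⟨h, h'⟩
  · rintro ⟨h, h'⟩
    exact ⟨_, h, h'⟩

theorem IsWalk.end_unique {u v w : V} {l : List A} (h : D.IsWalk u l v) (h' : D.IsWalk u l w) :
    v = w := by
  induction l generalizing u with
  | nil => exact (isWalk_nil.1 h).symm.trans (isWalk_nil.1 h')
  | cons a l ih => exact ih (isWalk_cons.1 h).2 (isWalk_cons.1 h').2

theorem IsWalk.start_unique {u v w : V} {l : List A} (h : D.IsWalk u l v) (h' : D.IsWalk w l v) :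
    u = w := by
  cases l with
  | nil => exact (isWalk_nil.1 h).trans (isWalk_nil.1 h').symm
  | cons a l => exact (isWalk_cons.1 h).1.symm.trans (isWalk_cons.1 h').1

theorem IsWalk.head_last {u v : V} {l : List A} {a : A} (h : D.IsWalk u (l ++ [a]) v) :
    D.head a = v := by
  obtain ⟨w, -, h⟩ := isWalk_append.1 h
  exact h.2

/-- The heads of the arcs of a walk are the tails of the later arcs, and the end of the walk. -/
theorem IsWalk.head_mem {u v : V} {l : List A} (h : D.IsWalk u l v) {a : A} (ha : a ∈ l) :
    D.head a = v ∨ D.head a ∈ l.tail.map D.tail := by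
  obtain ⟨l₁, l₂, rfl⟩ := List.append_of_mem ha
  have h2 := (isWalk_append_cons.1 h).2.2
  cases l₂ with
  | nil => exact Or.inl h2
  | cons b l₂ =>
    refine Or.inr ?_
    rw [← h2.1]
    refine List.mem_map_of_mem ?_
    cases l₁ <;> simp

theorem IsWalk.head_mem' {u v : V} {l : List A} (h : D.IsWalk u l v) {a : A} (ha : a ∈ l) :
    D.head a = v ∨ D.head a ∈ l.map D.tail := by
  rcases h.head_mem ha with h | h
  · exact Or.inl h
  · exact Or.inr (List.map_subset _ (List.tail_subset l) h)

theorem IsWalk.map_head_eq {u v : V} {l : List A} (h : D.IsWalk u l v) :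
    u :: l.map D.head = l.map D.tail ++ [v] := by
  induction l generalizing u with
  | nil => simpa using h
  | cons a l ih =>
    obtain ⟨rfl, h⟩ := h
    simp [← ih h]

theorem isWalk_of_map_head_eq {u v : V} {l : List A}
    (h : u :: l.map D.head = l.map D.tail ++ [v]) : D.IsWalk u l v := by
  induction l generalizing u with
  | nil => simpa using h
  | cons a l ih =>
    simp only [List.map_cons, List.cons_append, List.cons.injEq] at h
    exact ⟨h.1.symm, ih h.2⟩

/-- A dicycle is a nonempty closed walk without repeated tails. -/
theorem isDicycle_cons_iff {a : A} {l : List A} :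
    D.IsDicycle (a :: l) ↔
      ((a :: l).map D.tail).Nodup ∧ D.IsWalk (D.tail a) (a :: l) (D.tail a) := by
  unfold IsDicycle
  have : D.IsWalk (D.tail a) (a :: l) (D.tail a) ↔
      (a :: l).map D.head = ((a :: l).map D.tail).rotate 1 := by
    constructor
    · intro h
      have := h.map_head_eq
      simpa using this
    · intro h
      apply isWalk_of_map_head_eq
      simpa using h
  rw [this]
  simp

theorem IsDicycle.exists_isWalk {B : List A} (h : D.IsDicycle B) :
    B ≠ [] ∧ (B.map D.tail).Nodup ∧ ∃ u, D.IsWalk u B u := by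
  cases B with
  | nil => exact absurd rfl h.1
  | cons a l =>
    have := isDicycle_cons_iff.1 h
    exact ⟨by simp, this.1, _, this.2⟩

theorem IsWalk.isDicycle {u : V} {B : List A} (h : D.IsWalk u B u) (h0 : B ≠ [])
    (hn : (B.map D.tail).Nodup) : D.IsDicycle B := by
  cases B with
  | nil => exact absurd rfl h0
  | cons a l =>
    obtain rfl := h.1
    exact isDicycle_cons_iff.2 ⟨hn, h⟩

/-- A dicycle can be rotated so that it starts at any of its arcs. -/
theorem IsDicycle.rotate_append {l l' : List A} (h : D.IsDicycle (l ++ l')) :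
    D.IsDicycle (l' ++ l) := by
  obtain ⟨h0, hn, u, hu⟩ := h.exists_isWalk
  obtain ⟨w, h1, h2⟩ := isWalk_append.1 hu
  refine (h2.append h1).isDicycle ?_ ?_
  · simpa [and_comm] using h0
  · rw [List.map_append] at hn ⊢
    exact List.nodup_append_comm.1 hn

/-- A repetition in a mapped list, as a decomposition of the list. -/
theorem _root_.List.exists_eq_of_not_nodup_map {α β : Type*} {f : α → β} {l : List α}
    (h : ¬ (l.map f).Nodup) :
    ∃ l₁ a l₂ b l₃, l = l₁ ++ a :: (l₂ ++ b :: l₃) ∧ f a = f b := by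
  induction l with
  | nil => simp at h
  | cons a l ih =>
    by_cases hn : (l.map f).Nodup
    · have : f a ∈ l.map f := by
        by_contra hc
        exact h (by simpa using And.intro (by simpa using hc) hn)
      obtain ⟨b, hb, hab⟩ := List.mem_map.1 this
      obtain ⟨l₂, l₃, rfl⟩ := List.append_of_mem hb
      exact ⟨[], a, l₂, b, l₃, rfl, hab.symm⟩
    · obtain ⟨l₁, a', l₂, b, l₃, rfl, hab⟩ := ih hn
      exact ⟨a :: l₁, a', l₂, b, l₃, rfl, hab⟩

/-- Every closed walk that is not trivial contains a dicycle. -/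
theorem IsWalk.exists_isDicycle {u : V} {l : List A} (h : D.IsWalk u l u) (h0 : l ≠ []) :
    ∃ B, D.IsDicycle B ∧ B ⊆ l := by
  induction hl : l.length using Nat.strong_induction_on generalizing u l with
  | _ n ih =>
    by_cases hn : (l.map D.tail).Nodup
    · exact ⟨l, h.isDicycle h0 hn, List.Subset.refl _⟩
    · obtain ⟨l₁, a, l₂, b, l₃, rfl, hab⟩ := List.exists_eq_of_not_nodup_map hn
      have h2 := (isWalk_append_cons.1 h).2
      rw [← List.cons_append, isWalk_append_cons, ← hab] at h2
      obtain ⟨B, hB, hsub⟩ := ih (a :: l₂).length (by simp at hl ⊢; omega) h2.1 (by simp) rfl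
      refine ⟨B, hB, fun c hc => ?_⟩
      replace hc := hsub hc
      simp only [List.mem_append, List.mem_cons] at hc ⊢
      tauto

/-- Every walk contains a walk without repeated vertices and with the same ends. -/
theorem IsWalk.exists_nodup {u v : V} {l : List A} (h : D.IsWalk u l v) :
    ∃ l', D.IsWalk u l' v ∧ l' ⊆ l ∧ (l'.map D.tail).Nodup := by
  induction hl : l.length using Nat.strong_induction_on generalizing u l with
  | _ n ih =>
    by_cases hn : (l.map D.tail).Nodup
    · exact ⟨l, h, List.Subset.refl _, hn⟩
    · obtain ⟨l₁, a, l₂, b, l₃, rfl, hab⟩ := List.exists_eq_of_not_nodup_map hn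
      obtain ⟨h1, h2⟩ := isWalk_append_cons.1 h
      rw [← List.cons_append, isWalk_append_cons, ← hab] at h2
      obtain ⟨l', hl', hsub, hn'⟩ := ih (l₁ ++ b :: l₃).length (by simp at hl ⊢; omega)
        (h1.append h2.2) rfl
      refine ⟨l', hl', fun c hc => ?_, hn'⟩
      replace hc := hsub hc
      simp only [List.mem_append, List.mem_cons] at hc ⊢
      tauto

/-! ### Transversal vertices -/

theorem isDicycle_map_val {T : Set V} {B : List {a : A // D.tail a ∉ T ∧ D.head a ∉ T}} :
    (D.deleteVerts T).IsDicycle B ↔ D.IsDicycle (B.map Subtype.val) := by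
  have ht : (B.map Subtype.val).map D.tail =
      (B.map (D.deleteVerts T).tail).map Subtype.val := by
    simp [deleteVerts]
  have hh : (B.map Subtype.val).map D.head =
      (B.map (D.deleteVerts T).head).map Subtype.val := by
    simp [deleteVerts]
  unfold IsDicycle
  rw [ht, hh, List.nodup_map_iff Subtype.val_injective, ← List.map_rotate (f := Subtype.val),
    (List.map_injective_iff.2 Subtype.val_injective).eq_iff]
  simp only [ne_eq, List.map_eq_nil_iff]

theorem isDicycleTransversal_iff {T : Set V} :
    D.IsDicycleTransversal T ↔ ∀ B, D.IsDicycle B → ∃ v ∈ T, v ∈ B.map D.tail := by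
  unfold IsDicycleTransversal IsAcyclic
  constructor
  · intro h B hB
    by_contra! hc
    have hmem : ∀ a ∈ B, D.tail a ∉ T ∧ D.head a ∉ T := by
      intro a ha
      refine ⟨fun h' => hc _ h' (List.mem_map_of_mem ha), fun h' => hc _ h' ?_⟩
      have : D.head a ∈ (B.map D.tail).rotate 1 := hB.2.2 ▸ List.mem_map_of_mem ha
      simpa using this
    refine h (B.attach.map fun a => ⟨a.1, hmem a.1 a.2⟩) ?_
    rw [isDicycle_map_val]
    simpa [Function.comp_def] using hB
  · intro h B hB
    obtain ⟨v, hv, hvB⟩ := h _ (isDicycle_map_val.1 hB)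
    obtain ⟨a, ha, rfl⟩ := List.mem_map.1 hvB
    obtain ⟨b, -, rfl⟩ := List.mem_map.1 ha
    exact b.2.1 hv

theorem mem_transversalVertices_iff {v : V} :
    v ∈ D.transversalVertices ↔ ∀ B, D.IsDicycle B → v ∈ B.map D.tail := by
  unfold transversalVertices
  rw [Set.mem_ofPred_eq, isDicycleTransversal_iff]
  simp

theorem exists_transversal_of_transversalNumber_eq_one (h : D.transversalNumber = 1) :
    (∃ v, v ∈ D.transversalVertices) ∧ ∃ B, D.IsDicycle B := by
  unfold transversalNumber at h
  have hne : {t | ∃ T : Finset V, D.IsDicycleTransversal (T : Set V) ∧ T.card = t}.Nonempty := by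
    by_contra hc
    rw [Set.not_nonempty_iff_eq_empty] at hc
    simp [hc] at h
  constructor
  · have := Nat.sInf_mem hne
    rw [h] at this
    obtain ⟨T, hT, hc⟩ := this
    obtain ⟨v, rfl⟩ := Finset.card_eq_one.1 hc
    exact ⟨v, by simpa [transversalVertices] using hT⟩
  · by_contra! hc
    have : (0 : ℕ) ∈ {t | ∃ T : Finset V, D.IsDicycleTransversal (T : Set V) ∧ T.card = t} :=
      ⟨∅, isDicycleTransversal_iff.2 fun B hB => absurd hB (hc B), rfl⟩
    have := Nat.sInf_le this
    omega

/-- A closed walk passes through every transversal vertex. -/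
theorem IsWalk.mem_of_closed {x u : V} (hx : x ∈ D.transversalVertices) {l : List A}
    (h : D.IsWalk u l u) (h0 : l ≠ []) : x ∈ l.map D.tail := by
  obtain ⟨B, hB, hsub⟩ := h.exists_isDicycle h0
  exact List.map_subset _ hsub (mem_transversalVertices_iff.1 hx B hB)

/-- A closed walk that passes exactly once through a transversal vertex is a dicycle. -/
theorem IsWalk.isDicycle_of_once {x : V} (hx : x ∈ D.transversalVertices) {a : A} {l : List A}
    (h : D.IsWalk x (a :: l) x) (hl : x ∉ l.map D.tail) : D.IsDicycle (a :: l) := by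
  refine h.isDicycle (by simp) ?_
  by_contra hn
  obtain ⟨l₁, b, l₂, c, l₃, heq, hbc⟩ := List.exists_eq_of_not_nodup_map hn
  rw [heq] at h
  have h2 := (isWalk_append_cons.1 h).2
  rw [← List.cons_append, isWalk_append_cons, ← hbc] at h2
  have h3 := h2.1.mem_of_closed hx (by simp)
  cases l₁ with
  | nil =>
    obtain ⟨rfl, rfl⟩ := List.cons_eq_cons.1 heq
    apply hl
    rw [← h.1, hbc]
    simp
  | cons d l₁ =>
    rw [List.cons_append] at heq
    obtain ⟨rfl, rfl⟩ := List.cons_eq_cons.1 heq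
    apply hl
    refine List.map_subset _ ?_ h3
    intro e he
    simp only [List.mem_append, List.mem_cons] at he ⊢
    tauto

end Multidigraph

/-! ### Cycles of the underlying graph -/

namespace Multidigraph

variable {V A : Type*} (D : Multidigraph V A)

/-- The digraph in which every arc of `D` can be used in both directions: `Sum.inl a` is the arc
`a`, and `Sum.inr a` is its reverse. -/
def sym : Multidigraph V (A ⊕ A) where
  tail := Sum.elim D.tail D.head
  head := Sum.elim D.head D.tail

/-- The arc of `D` that underlies an arc of `D.sym`. -/
def arc : A ⊕ A → A := Sum.elim id id

@[simp] theorem sym_tail_inl (a : A) : D.sym.tail (Sum.inl a) = D.tail a := rfl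
@[simp] theorem sym_tail_inr (a : A) : D.sym.tail (Sum.inr a) = D.head a := rfl
@[simp] theorem sym_head_inl (a : A) : D.sym.head (Sum.inl a) = D.head a := rfl
@[simp] theorem sym_head_inr (a : A) : D.sym.head (Sum.inr a) = D.tail a := rfl
@[simp] theorem arc_inl (a : A) : arc (Sum.inl a) = a := rfl
@[simp] theorem arc_inr (a : A) : arc (Sum.inr a) = a := rfl

/-- `x` and `y` are joined by an edge of `E` inside the vertex set `S`. -/
def ULink (S : Set V) (E : Set A) (x y : V) : Prop :=
  x ∈ S ∧ y ∈ S ∧ ∃ j : A ⊕ A, arc j ∈ E ∧ D.sym.tail j = x ∧ D.sym.head j = y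

/-- `x` and `y` are connected by edges of `E` in the underlying graph of `D` induced on `S`
(which always holds if `x = y`). -/
def UConn (S : Set V) (E : Set A) : V → V → Prop :=
  Relation.ReflTransGen (D.ULink S E)

/-- The underlying graph of `D` induced on `S` has a cycle. The cycle is given as an edge `e` and
a path from the head to the tail of `e` that does not use `e`. -/
def HasCyc (S : Set V) : Prop :=
  ∃ e l, D.tail e ∈ S ∧ D.sym.IsWalk (D.head e) l (D.tail e) ∧ (∀ j ∈ l, arc j ≠ e) ∧
    (∀ j ∈ l, D.sym.tail j ∈ S) ∧ (l.map D.sym.tail).Nodup ∧ D.tail e ∉ l.map D.sym.tail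

/-- Every two vertices of `S` are connected inside `S`. -/
def ConnOn (S : Set V) : Prop := ∀ x ∈ S, ∀ y ∈ S, D.UConn S Set.univ x y

variable {D}

theorem isLink_iff {a : A} {x y : V} :
    D.underlying.IsLink a x y ↔ ∃ j : A ⊕ A, arc j = a ∧ D.sym.tail j = x ∧ D.sym.head j = y := by
  change (D.tail a = x ∧ D.head a = y) ∨ (D.tail a = y ∧ D.head a = x) ↔ _
  constructor
  · rintro (h | h)
    · exact ⟨Sum.inl a, rfl, h⟩
    · exact ⟨Sum.inr a, rfl, h.2, h.1⟩
  · rintro ⟨j | j, rfl, h⟩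
    · exact Or.inl h
    · exact Or.inr ⟨h.2, h.1⟩

theorem ULink.symm {S : Set V} {E : Set A} {x y : V} (h : D.ULink S E x y) : D.ULink S E y x := by
  obtain ⟨hx, hy, j | j, hj, h1, h2⟩ := h
  · exact ⟨hy, hx, Sum.inr j, hj, h2, h1⟩
  · exact ⟨hy, hx, Sum.inl j, hj, h2, h1⟩

theorem UConn.symm {S : Set V} {E : Set A} {x y : V} (h : D.UConn S E x y) : D.UConn S E y x := by
  induction h with
  | refl => exact Relation.ReflTransGen.refl
  | tail _ h ih => exact Relation.ReflTransGen.head h.symm ih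

theorem UConn.trans {S : Set V} {E : Set A} {x y z : V} (h : D.UConn S E x y)
    (h' : D.UConn S E y z) : D.UConn S E x z := Relation.ReflTransGen.trans h h'

theorem UConn.mono {S S' : Set V} {E E' : Set A} (hS : S ⊆ S') (hE : E ⊆ E') {x y : V}
    (h : D.UConn S E x y) : D.UConn S' E' x y :=
  Relation.ReflTransGen.mono
    (fun _ _ ⟨h1, h2, j, h3, h4⟩ => ⟨hS h1, hS h2, j, hE h3, h4⟩) _ _ h

/-- Connections inside `S` do not use an edge with an end outside `S`. -/
theorem UConn.avoid {S : Set V} {x y : V} (h : D.UConn S Set.univ x y) {e : A}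
    (he : D.tail e ∉ S ∨ D.head e ∉ S) : D.UConn S {e}ᶜ x y := by
  refine Relation.ReflTransGen.mono ?_ _ _ h
  rintro a b ⟨h1, h2, j, -, rfl, rfl⟩
  refine ⟨h1, h2, j, ?_, rfl, rfl⟩
  rintro rfl
  rcases j with j | j
  · exact he.elim (· h1) (· h2)
  · exact he.elim (· h2) (· h1)

theorem UConn.exists_isWalk {S : Set V} {E : Set A} {x y : V} (h : D.UConn S E x y) :
    ∃ l, D.sym.IsWalk x l y ∧ ∀ j ∈ l, arc j ∈ E ∧ D.sym.tail j ∈ S ∧ D.sym.head j ∈ S := by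
  induction h with
  | refl => exact ⟨[], rfl, by simp⟩
  | tail _ h ih =>
    obtain ⟨l, hl, hl'⟩ := ih
    obtain ⟨h1, h2, j, h3, rfl, rfl⟩ := h
    refine ⟨l ++ [j], hl.append ⟨rfl, rfl⟩, ?_⟩
    intro i hi
    rcases List.mem_append.1 hi with hi | hi
    · exact hl' i hi
    · obtain rfl := List.mem_singleton.1 hi
      exact ⟨h3, h1, h2⟩

theorem IsWalk.uconn_sym {S : Set V} {E : Set A} {u v : V} {l : List (A ⊕ A)}
    (h : D.sym.IsWalk u l v) (hE : ∀ j ∈ l, arc j ∈ E) (hS : ∀ j ∈ l, D.sym.tail j ∈ S)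
    (hv : v ∈ S) : D.UConn S E u v := by
  induction l generalizing u with
  | nil => obtain rfl := h; exact Relation.ReflTransGen.refl
  | cons j l ih =>
    obtain ⟨rfl, h⟩ := h
    refine Relation.ReflTransGen.head ⟨hS j (by simp), ?_, j, hE j (by simp), rfl, rfl⟩
      (ih h (fun i hi => hE i (by simp [hi])) fun i hi => hS i (by simp [hi]))
    cases l with
    | nil => obtain rfl := h; exact hv
    | cons i l => rw [← h.1]; exact hS i (by simp)

theorem IsWalk.uconn {S : Set V} {E : Set A} {u v : V} {l : List A}
    (h : D.IsWalk u l v) (hE : ∀ a ∈ l, a ∈ E) (hS : ∀ a ∈ l, D.tail a ∈ S)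
    (hv : v ∈ S) : D.UConn S E u v := by
  refine IsWalk.uconn_sym (l := l.map Sum.inl) ?_ (by simpa using hE) (by simpa using hS) hv
  clear hE hS
  induction l generalizing u with
  | nil => exact h
  | cons a l ih => exact ⟨h.1, ih h.2⟩

/-- The tails of the arcs of a walk are connected. -/
theorem IsWalk.connOn {u v : V} {l : List A} (h : D.IsWalk u l v) :
    D.ConnOn {x | x ∈ l.map D.tail} := by
  have key : ∀ x ∈ l.map D.tail, D.UConn {x | x ∈ l.map D.tail} Set.univ u x := by
    intro x hx
    obtain ⟨a, ha, rfl⟩ := List.mem_map.1 hx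
    obtain ⟨l₁, l₂, rfl⟩ := List.append_of_mem ha
    refine (isWalk_append_cons.1 h).1.uconn (by simp) ?_ hx
    intro b hb
    exact List.mem_map_of_mem (by simp [hb])
  exact fun x hx y hy => (key x hx).symm.trans (key y hy)

theorem hasCyc_of_uconn {S : Set V} {e : A} (h1 : D.tail e ∈ S)
    (h : D.UConn S {e}ᶜ (D.head e) (D.tail e)) : D.HasCyc S := by
  obtain ⟨l, hl, hl'⟩ := h.exists_isWalk
  obtain ⟨l, hw, hsub, hn⟩ := hl.exists_nodup
  replace hl' := fun j hj => hl' j (hsub hj)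
  by_cases ht : D.tail e ∈ l.map D.sym.tail
  -- the path is cut at its first visit to the tail of `e`
  · obtain ⟨j, hj, hje⟩ := List.mem_map.1 ht
    obtain ⟨l₁, l₂, rfl⟩ := List.append_of_mem hj
    refine ⟨e, l₁, h1, hje ▸ (isWalk_append_cons.1 hw).1, fun i hi => (hl' i (by simp [hi])).1,
      fun i hi => (hl' i (by simp [hi])).2.1, ?_, ?_⟩
    · rw [List.map_append] at hn
      exact (List.nodup_append.1 hn).1
    · rw [List.map_append] at hn
      intro hc
      exact (List.nodup_append.1 hn).2.2 _ hc _ (by simp) hje.symm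
  · exact ⟨e, l, h1, hw, fun i hi => (hl' i hi).1, fun i hi => (hl' i hi).2.1, hn, ht⟩

theorem HasCyc.mono {S S' : Set V} (hS : S ⊆ S') (h : D.HasCyc S) : D.HasCyc S' := by
  obtain ⟨e, l, h1, h2, h3, h4, h5⟩ := h
  exact ⟨e, l, hS h1, h2, h3, fun j hj => hS (h4 j hj), h5⟩

theorem HasCyc.exists_uconn {S : Set V} (h : D.HasCyc S) :
    ∃ e, D.tail e ∈ S ∧ D.head e ∈ S ∧ D.UConn S {e}ᶜ (D.head e) (D.tail e) := by
  obtain ⟨e, l, h1, h2, h3, h4, -⟩ := h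
  refine ⟨e, h1, ?_, h2.uconn_sym h3 h4 h1⟩
  cases l with
  | nil => obtain h2 := isWalk_nil.1 h2; rwa [h2]
  | cons j l => rw [← h2.1]; exact h4 j (by simp)

/-- On a path, an arc and its reverse do not both occur. -/
theorem nodup_map_arc {u v : V} {l : List (A ⊕ A)} (h : D.sym.IsWalk u l v)
    (hn : (l.map D.sym.tail).Nodup) (hv : v ∉ l.map D.sym.tail) : (l.map arc).Nodup := by
  by_contra hc
  obtain ⟨l₁, i, l₂, j, l₃, rfl, hij⟩ := List.exists_eq_of_not_nodup_map hc
  have hw := (isWalk_append_cons.1 h).2.2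
  have hjw := isWalk_append_cons.1 hw
  rw [List.map_append, List.map_cons, List.map_append, List.map_cons] at hn
  have hn2 := (List.nodup_append.1 hn).2.1
  rw [List.nodup_cons, List.nodup_append] at hn2
  have hne : D.sym.tail i ≠ D.sym.tail j := fun h' => hn2.1 (by simp [h'])
  have hrev : D.sym.tail j = D.sym.head i ∧ D.sym.head j = D.sym.tail i := by
    rcases i with i | i <;> rcases j with j | j <;>
      simp only [arc_inl, arc_inr] at hij <;> subst hij <;> simp at hne ⊢
  cases l₂ with
  | cons b l₂ =>
    have h1 : D.sym.tail b = D.sym.head i := hw.1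
    exact hn2.2.2.2 (D.sym.tail b) (by simp) _ (by simp) (h1.trans hrev.1.symm)
  | nil =>
    have h1 := hjw.2.2
    rw [hrev.2] at h1
    cases l₃ with
    | nil => obtain h1 := isWalk_nil.1 h1; exact hv (by simp [← h1])
    | cons b l₃ => exact hn2.1 (by simp [← h1.1])

/-- An edge `e` together with a path from its head to its tail that avoids `e` is a cycle. -/
theorem isCycle_of_path {e : A} {l : List (A ⊕ A)} (h : D.sym.IsWalk (D.head e) l (D.tail e))
    (he : ∀ j ∈ l, arc j ≠ e) (hn : (l.map D.sym.tail).Nodup)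
    (ht : D.tail e ∉ l.map D.sym.tail) :
    D.IsCycle ((Sum.inl e :: l).map fun j => (D.sym.tail j, arc j)) := by
  refine ⟨by simp, ?_, ?_, ?_⟩
  · simpa [Function.comp_def] using And.intro (by simpa using ht) hn
  · have := nodup_map_arc h hn ht
    rw [List.map_map, List.map_cons, List.nodup_cons]
    refine ⟨?_, this⟩
    intro hc
    obtain ⟨j, hj, hj'⟩ := List.mem_map.1 hc
    exact he j hj hj'
  · have h1 : D.sym.IsWalk (D.tail e) (Sum.inl e :: l) (D.tail e) := ⟨rfl, h⟩
    have h2 := h1.map_head_eq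
    have h3 : (Sum.inl e :: l).map D.sym.head =
        (((Sum.inl e :: l).map fun j => (D.sym.tail j, arc j)).map Prod.fst).rotate 1 := by
      simp only [List.map_cons, List.cons_append, List.cons.injEq] at h2
      simpa [Function.comp_def] using h2
    rw [← h3, List.forall₂_map_left_iff, List.forall₂_map_right_iff, List.forall₂_same]
    intro j _
    exact isLink_iff.2 ⟨j, rfl, rfl, rfl⟩

/-- The edges of a cycle other than `e` connect the ends of a path along the cycle. -/
theorem uconn_of_forall₂ {S : Set V} {e : A} {v : V} (hv : v ∈ S) (C : List (V × A)) (x : V) (f : A)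
    (hx : x ∈ S) (hf : f ≠ e) (hS : ∀ p ∈ C, p.1 ∈ S) (he : ∀ p ∈ C, p.2 ≠ e)
    (h : List.Forall₂ (fun p w => D.underlying.IsLink p.2 p.1 w) ((x, f) :: C)
      (C.map Prod.fst ++ [v])) : D.UConn S {e}ᶜ x v := by
  induction C generalizing x f with
  | nil =>
    simp only [List.map_nil, List.nil_append, List.forall₂_cons] at h
    obtain ⟨j, rfl, h1, h2⟩ := isLink_iff.1 h.1
    exact Relation.ReflTransGen.single ⟨hx, hv, j, hf, h1, h2⟩
  | cons q C ih =>
    rw [List.map_cons, List.cons_append, List.forall₂_cons] at h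
    obtain ⟨j, rfl, h1, h2⟩ := isLink_iff.1 h.1
    exact Relation.ReflTransGen.head ⟨hx, hS q (by simp), j, hf, h1, h2⟩
      (ih q.1 q.2 (hS q (by simp)) (he q (by simp)) (fun p hp => hS p (by simp [hp]))
        (fun p hp => he p (by simp [hp])) h.2)

theorem IsCycle.hasCyc {C : List (V × A)} (h : D.IsCycle C) {S : Set V}
    (hS : ∀ p ∈ C, p.1 ∈ S) : D.HasCyc S := by
  obtain ⟨h0, -, hn, h⟩ := h
  cases C with
  | nil => exact absurd rfl h0
  | cons p C =>
    obtain ⟨v, e⟩ := p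
    have hv : v ∈ S := hS _ (List.mem_cons_self ..)
    rw [List.map_cons, List.nodup_cons] at hn
    replace h : List.Forall₂ (fun p w => D.underlying.IsLink p.2 p.1 w) ((v, e) :: C)
      (C.map Prod.fst ++ [v]) := by simpa using h
    have he : ∀ p ∈ C, p.2 ≠ e := fun p hp h' => hn.1 (List.mem_map.2 ⟨p, hp, h'⟩)
    obtain ⟨w, hw, hwS, hconn⟩ :
        ∃ w, D.underlying.IsLink e v w ∧ w ∈ S ∧ D.UConn S {e}ᶜ w v := by
      cases C with
      | nil =>
        simp only [List.map_nil, List.nil_append, List.forall₂_cons] at h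
        exact ⟨v, h.1, hv, Relation.ReflTransGen.refl⟩
      | cons q C =>
        rw [List.map_cons, List.cons_append, List.forall₂_cons] at h
        exact ⟨q.1, h.1, hS _ (by simp), uconn_of_forall₂ hv C q.1 q.2 (hS _ (by simp))
          (he _ (by simp)) (fun p hp => hS p (by simp [hp])) (fun p hp => he p (by simp [hp])) h.2⟩
    rcases hw with ⟨rfl, rfl⟩ | ⟨rfl, rfl⟩
    · exact hasCyc_of_uconn hv hconn
    · exact hasCyc_of_uconn hwS hconn.symm

/-! ### A cycle that meets three pieces -/

/-- The first edge of a walk that enters `φ`. -/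
theorem IsWalk.exists_entry {S φ : Set V} {z v : V} {l : List (A ⊕ A)} (h : D.sym.IsWalk z l v)
    (hzS : z ∈ S) (hz : z ∉ φ) (hS : ∀ j ∈ l, D.sym.tail j ∈ S)
    (hφ : ∃ j ∈ l, D.sym.tail j ∈ φ) :
    ∃ j ∈ l, D.sym.tail j ∉ φ ∧ D.sym.head j ∈ φ ∧ D.sym.head j ∈ S ∧
      D.UConn (S \ φ) Set.univ z (D.sym.tail j) := by
  induction l generalizing z with
  | nil => simp at hφ
  | cons i l ih =>
    obtain ⟨rfl, h⟩ := h
    have hφ' : ∃ j ∈ l, D.sym.tail j ∈ φ := by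
      obtain ⟨j, hj, hjφ⟩ := hφ
      rcases List.mem_cons.1 hj with rfl | hj
      · exact absurd hjφ hz
      · exact ⟨j, hj, hjφ⟩
    have hhS : D.sym.head i ∈ S := by
      cases l with
      | nil => simp at hφ'
      | cons b l => rw [← h.1]; exact hS b (by simp)
    by_cases hi : D.sym.head i ∈ φ
    · exact ⟨i, by simp, hz, hi, hhS, Relation.ReflTransGen.refl⟩
    · obtain ⟨j, hj, h1, h2, h3, h4⟩ :=
        ih h hhS hi (fun j hj => hS j (by simp [hj])) hφ'
      exact ⟨j, by simp [hj], h1, h2, h3,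
        Relation.ReflTransGen.head ⟨⟨hzS, hz⟩, ⟨hhS, hi⟩, i, trivial, rfl, rfl⟩ h4⟩

/-- The last edge of a walk that leaves `φ`. -/
theorem IsWalk.exists_exit {S φ : Set V} {u z : V} {l : List (A ⊕ A)} (h : D.sym.IsWalk u l z)
    (hzS : z ∈ S) (hz : z ∉ φ) (hS : ∀ j ∈ l, D.sym.tail j ∈ S)
    (hφ : ∃ j ∈ l, D.sym.tail j ∈ φ) :
    ∃ j ∈ l, D.sym.tail j ∈ φ ∧ D.sym.head j ∉ φ ∧
      D.UConn (S \ φ) Set.univ (D.sym.head j) z := by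
  induction l generalizing u with
  | nil => simp at hφ
  | cons i l ih =>
    obtain ⟨rfl, h⟩ := h
    by_cases hφ' : ∃ j ∈ l, D.sym.tail j ∈ φ
    · obtain ⟨j, hj, h1⟩ := ih h (fun j hj => hS j (by simp [hj])) hφ'
      exact ⟨j, by simp [hj], h1⟩
    · have hi : D.sym.tail i ∈ φ := by
        obtain ⟨j, hj, hjφ⟩ := hφ
        rcases List.mem_cons.1 hj with rfl | hj
        · exact hjφ
        · exact absurd ⟨j, hj, hjφ⟩ hφ'
      push Not at hφ'
      refine ⟨i, by simp, hi, ?_, h.uconn_sym (fun _ _ => trivial)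
        (fun j hj => ⟨hS j (by simp [hj]), hφ' j hj⟩) ⟨hzS, hz⟩⟩
      cases l with
      | nil => rw [isWalk_nil.1 h]; exact hz
      | cons b l => rw [← h.1]; exact hφ' b (by simp)

/-- If every cycle in `S` meets `φ`, and there is a cycle that does not lie in `φ`, then two
different edges that leave `φ` have outer ends that are connected in `S \ φ`. -/
theorem exists_two_crossing {S φ ψ : Set V} (h : D.HasCyc S) (hφ : ¬ D.HasCyc (S \ φ))
    (hψ : ¬ D.HasCyc (S \ ψ)) (hd : Disjoint φ ψ) :
    ∃ i j : A ⊕ A, arc i ≠ arc j ∧ D.sym.tail i ∉ φ ∧ D.sym.head i ∈ φ ∧ D.sym.head i ∈ S ∧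
      D.sym.tail j ∈ φ ∧ D.sym.tail j ∈ S ∧ D.sym.head j ∉ φ ∧ D.sym.tail i ∈ S ∧
      D.sym.head j ∈ S ∧ D.UConn (S \ φ) Set.univ (D.sym.head j) (D.sym.tail i) := by
  obtain ⟨e, l, h1, h2, h3, h4, h5, h6⟩ := h
  -- the closed walk along the cycle
  have hw : D.sym.IsWalk (D.tail e) (Sum.inl e :: l) (D.tail e) := ⟨rfl, h2⟩
  have hn : ((Sum.inl e :: l).map arc).Nodup := by
    rw [List.map_cons, List.nodup_cons]
    refine ⟨?_, nodup_map_arc h2 h5 h6⟩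
    intro hc
    obtain ⟨j, hj, hj'⟩ := List.mem_map.1 hc
    exact h3 j hj hj'
  have hS : ∀ j ∈ Sum.inl e :: l, D.sym.tail j ∈ S := by
    intro j hj
    rcases List.mem_cons.1 hj with rfl | hj
    exacts [h1, h4 j hj]
  have hmeet : ∀ T : Set V, ¬ D.HasCyc (S \ T) → ∃ j ∈ Sum.inl e :: l, D.sym.tail j ∈ T := by
    intro T hT
    by_contra! hc
    exact hT ⟨e, l, ⟨h1, hc _ (List.mem_cons_self ..)⟩, h2, h3,
      fun j hj => ⟨h4 j hj, hc j (List.mem_cons_of_mem _ hj)⟩, h5, h6⟩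
  obtain ⟨c, hc, hcψ⟩ := hmeet ψ hψ
  have hcφ : D.sym.tail c ∉ φ := fun h => Set.disjoint_left.1 hd h hcψ
  have hmφ := hmeet φ hφ
  generalize Sum.inl e :: l = L at *
  obtain ⟨l₁, l₂, rfl⟩ := List.append_of_mem hc
  obtain ⟨hw1, hw2⟩ := isWalk_append_cons.1 hw
  replace hw := hw2.append hw1
  have hSt : ∀ j ∈ c :: l₂ ++ l₁, D.sym.tail j ∈ S := fun j hj => hS j (by simp at hj ⊢; tauto)
  have hmt : ∃ j ∈ c :: l₂ ++ l₁, D.sym.tail j ∈ φ := by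
    obtain ⟨j, hj, hj'⟩ := hmφ
    exact ⟨j, by simp at hj ⊢; tauto, hj'⟩
  have hnt : ((c :: l₂ ++ l₁).map arc).Nodup := by
    rw [List.map_append] at hn ⊢
    exact List.nodup_append_comm.1 hn
  obtain ⟨i, hi, hi1, hi2, hi3, hi4⟩ := hw.exists_entry (hS c hc) hcφ hSt hmt
  obtain ⟨j, hj, hj1, hj2, hj3⟩ := hw.exists_exit (hS c hc) hcφ hSt hmt
  refine ⟨i, j, fun hij => ?_, hi1, hi2, hi3, hj1, hSt j hj, hj2, hSt i hi, ?_, hj3.trans hi4⟩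
  · have := List.inj_on_of_nodup_map hnt hi hj hij
    subst this
    exact hi1 hj1
  · rcases hw.head_mem' hj with h | h
    · rw [h]; exact hS c hc
    · obtain ⟨b, hb, hb'⟩ := List.mem_map.1 h
      rw [← hb']; exact hSt b hb

/-- A connection in `S` either avoids `ψ` or leads to `ψ`. -/
theorem UConn.avoid_or_exists {S ψ : Set V} {x y : V} (h : D.UConn S Set.univ x y)
    (hx : x ∈ S) :
    (D.UConn (S \ ψ) Set.univ x y ∧ (x ∉ ψ)) ∨ ∃ p ∈ ψ, p ∈ S ∧ D.UConn S Set.univ x p := by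
  by_cases hxψ : x ∈ ψ
  · exact Or.inr ⟨x, hxψ, hx, Relation.ReflTransGen.refl⟩
  · induction h with
    | refl => exact Or.inl ⟨Relation.ReflTransGen.refl, hxψ⟩
    | @tail b c hb hbc ih =>
      rcases ih with ih | ih
      · by_cases hc : c ∈ ψ
        · exact Or.inr ⟨c, hc, hbc.2.1, hb.tail hbc⟩
        · by_cases hbψ : b ∈ ψ
          · exact Or.inr ⟨b, hbψ, hbc.1, hb⟩
          · exact Or.inl ⟨ih.1.tail ⟨⟨hbc.1, hbψ⟩, ⟨hbc.2.1, hc⟩, hbc.2.2⟩, hxψ⟩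
      · exact Or.inr ih

/-- Let `S` contain a cycle, and suppose that the deletion of any one of the disjoint pieces
`φ₁`, `φ₂`, `φ₃` of `S` destroys all cycles, where `φ₂` is connected. If a set `Z` outside `S` is
joined to the connected set `φ₁` by an edge, and `φ₃ ∪ Z` is connected, then the deletion of `φ₂`
and the addition of `Z` leave a cycle. -/
theorem hasCyc_of_three_pieces {S Z φ₁ φ₂ φ₃ : Set V} (h : D.HasCyc S)
    (h1 : ¬ D.HasCyc (S \ φ₁)) (h2 : ¬ D.HasCyc (S \ φ₂)) (h3 : ¬ D.HasCyc (S \ φ₃))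
    (hφ₁ : φ₁ ⊆ S) (hφ₂ : φ₂ ⊆ S) (hφ₃ : φ₃ ⊆ S) (h12 : Disjoint φ₂ φ₁) (h23 : Disjoint φ₂ φ₃)
    (h13 : Disjoint φ₁ φ₃) (hZ : Disjoint Z S)
    (hc1 : D.ConnOn φ₁) (hc2 : D.ConnOn φ₂) (hc3 : D.ConnOn (φ₃ ∪ Z))
    {e : A} (het : D.tail e ∈ φ₁) (heh : D.head e ∈ Z) :
    D.HasCyc (S \ φ₂ ∪ Z) := by
  -- the outer ends of two edges at `φ₂` are connected, and this connection meets `φ₁` and `φ₃`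
  obtain ⟨i, j, hij, hit, hih, hihS, hjt, hjtS, hjh, hitS, hjhS, hconn⟩ :=
    exists_two_crossing h h2 h1 h12
  have key : ∀ ψ : Set V, Disjoint φ₂ ψ → ¬ D.HasCyc (S \ ψ) →
      ∃ p ∈ ψ, D.UConn (S \ φ₂) Set.univ (D.sym.head j) p := by
    intro ψ hd hψ
    rcases hconn.avoid_or_exists (ψ := ψ) ⟨hjhS, hjh⟩ with ⟨hav, hjψ⟩ | ⟨p, hp, -, hp'⟩
    · exfalso
      apply hψ
      have hsub : (S ∩ φ₂) ⊆ S \ ψ := fun x hx => ⟨hx.1, fun hx' => Set.disjoint_left.1 hd hx.2 hx'⟩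
      by_cases hiψ : D.sym.tail i ∈ ψ
      · exact absurd (hav.symm) (by
          intro hc
          rcases Relation.ReflTransGen.cases_head hc with h | ⟨b, hb, -⟩
          · exact hjψ (h ▸ hiψ)
          · exact hb.1.2 hiψ)
      have hconn2 : ∀ f : A, f = arc j →
          D.UConn (S \ ψ) {f}ᶜ (D.sym.head j) (D.sym.tail j) := by
        rintro f rfl
        have a1 : D.UConn (S \ ψ) {arc j}ᶜ (D.sym.head j) (D.sym.tail i) := by
          refine UConn.mono ?_ (le_refl _) (hav.avoid (e := arc j) ?_)
          · exact fun x hx => ⟨hx.1.1, hx.2⟩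
          · rcases j with j | j
            · exact Or.inl fun h => h.1.2 hjt
            · exact Or.inr fun h => h.1.2 hjt
        have a2 : D.UConn (S \ ψ) {arc j}ᶜ (D.sym.tail i) (D.sym.head i) :=
          Relation.ReflTransGen.single
            ⟨⟨hitS, hiψ⟩, hsub ⟨hihS, hih⟩, i, hij, rfl, rfl⟩
        have a3 : D.UConn (S \ ψ) {arc j}ᶜ (D.sym.head i) (D.sym.tail j) := by
          have hav2 := (hc2 _ hih _ hjt).avoid (e := arc j) (by
            rcases j with j | j
            · exact Or.inr hjh
            · exact Or.inl hjh)
          exact hav2.mono (fun x hx => hsub ⟨hφ₂ hx, hx⟩) (le_refl _)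
        exact (a1.trans a2).trans a3
      rcases j with j | j
      · exact hasCyc_of_uconn (hsub ⟨hjtS, hjt⟩) (hconn2 j rfl)
      · exact hasCyc_of_uconn ⟨hjhS, hjψ⟩ (hconn2 j rfl).symm
    · exact ⟨p, hp, hp'⟩
  obtain ⟨p₁, hp₁, hp₁'⟩ := key φ₁ h12 h1
  obtain ⟨p₃, hp₃, hp₃'⟩ := key φ₃ h23 h3
  have s1 : φ₁ ⊆ S \ φ₂ ∪ Z := fun x hx => Or.inl ⟨hφ₁ hx, fun h => Set.disjoint_left.1 h12 h hx⟩
  have s3 : φ₃ ∪ Z ⊆ S \ φ₂ ∪ Z := Set.union_subset_union_left _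
    fun x hx => ⟨hφ₃ hx, fun h => Set.disjoint_left.1 h23 h hx⟩
  have hheS : D.head e ∉ S := fun h => Set.disjoint_left.1 hZ heh h
  -- the edge `e` closes a cycle with this connection
  refine hasCyc_of_uconn (e := e) (s1 het) ?_
  have b1 : D.UConn (S \ φ₂ ∪ Z) {e}ᶜ (D.head e) p₃ := by
    refine UConn.mono s3 (le_refl _) ((hc3 _ (Or.inr heh) _ (Or.inl hp₃)).avoid (Or.inl ?_))
    rintro (h | h)
    · exact Set.disjoint_left.1 h13 het h
    · exact Set.disjoint_left.1 hZ h (hφ₁ het)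
  have b2 : D.UConn (S \ φ₂ ∪ Z) {e}ᶜ p₃ p₁ :=
    UConn.mono Set.subset_union_left (le_refl _)
      ((UConn.trans hp₃'.symm hp₁').avoid (Or.inr fun h => hheS h.1))
  have b3 : D.UConn (S \ φ₂ ∪ Z) {e}ᶜ p₁ (D.tail e) :=
    UConn.mono s1 (le_refl _)
      ((hc1 _ hp₁ _ het).avoid (Or.inr fun h => hheS (hφ₁ h)))
  exact (b1.trans b2).trans b3

end Multidigraph

/-! ### Two disjoint walks -/

namespace Multidigraph

variable {V A : Type*} {D : Multidigraph V A}

theorem IsWalk.exists_split {u v y : V} {l : List A} (h : D.IsWalk u l v)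
    (hy : y ∈ u :: l.map D.head) :
    ∃ l₁ l₂, l = l₁ ++ l₂ ∧ D.IsWalk u l₁ y ∧ D.IsWalk y l₂ v := by
  induction l generalizing u with
  | nil =>
    obtain rfl : y = u := by simpa using hy
    exact ⟨[], [], rfl, rfl, h⟩
  | cons a l ih =>
    rcases List.mem_cons.1 hy with rfl | hy
    · exact ⟨[], a :: l, rfl, rfl, h⟩
    · obtain ⟨l₁, l₂, rfl, h1, h2⟩ := ih h.2 (by simpa using hy)
      exact ⟨a :: l₁, l₂, rfl, ⟨h.1, h1⟩, h2⟩

/-- A walk that meets `X`, cut at its first vertex in `X`. -/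
theorem IsWalk.exists_first {u v : V} {l : List A} (h : D.IsWalk u l v) (X : Set V)
    (hX : ∃ y ∈ u :: l.map D.head, y ∈ X) :
    ∃ l₁ l₂ y, l = l₁ ++ l₂ ∧ D.IsWalk u l₁ y ∧ y ∈ X ∧ ∀ a ∈ l₁, D.tail a ∉ X := by
  induction l generalizing u with
  | nil =>
    obtain ⟨y, hy, hyX⟩ := hX
    obtain rfl : y = u := by simpa using hy
    exact ⟨[], [], y, rfl, rfl, hyX, by simp⟩
  | cons a l ih =>
    by_cases hu : u ∈ X
    · exact ⟨[], a :: l, u, rfl, rfl, hu, by simp⟩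
    · obtain ⟨l₁, l₂, y, rfl, h1, h2, h3⟩ := ih h.2 (by
        obtain ⟨y, hy, hyX⟩ := hX
        rcases List.mem_cons.1 hy with rfl | hy
        · exact absurd hyX hu
        · exact ⟨y, by simpa using hy, hyX⟩)
      refine ⟨a :: l₁, l₂, y, rfl, ⟨h.1, h1⟩, h2, ?_⟩
      intro b hb
      rcases List.mem_cons.1 hb with rfl | hb
      · rw [h.1]; exact hu
      · exact h3 b hb

/-- A walk that meets `X`, cut at its last vertex in `X`. -/
theorem IsWalk.exists_last {u v : V} {l : List A} (h : D.IsWalk u l v) (X : Set V)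
    (hX : ∃ y ∈ u :: l.map D.head, y ∈ X) :
    ∃ l₁ l₂ y, l = l₁ ++ l₂ ∧ D.IsWalk y l₂ v ∧ y ∈ X ∧ ∀ a ∈ l₂, D.head a ∉ X := by
  induction l generalizing u with
  | nil =>
    obtain ⟨y, hy, hyX⟩ := hX
    obtain rfl : y = u := by simpa using hy
    exact ⟨[], [], y, rfl, h, hyX, by simp⟩
  | cons a l ih =>
    by_cases hl : ∃ y ∈ D.head a :: l.map D.head, y ∈ X
    · obtain ⟨l₁, l₂, y, rfl, h1⟩ := ih h.2 hl
      exact ⟨a :: l₁, l₂, y, rfl, h1⟩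
    · push Not at hl
      obtain ⟨y, hy, hyX⟩ := hX
      rcases List.mem_cons.1 hy with rfl | hy
      · refine ⟨[], a :: l, y, rfl, h, hyX, ?_⟩
        intro b hb
        exact hl _ (by simpa using List.mem_map_of_mem (f := D.head) hb)
      · exact absurd hyX (hl y (by simpa using hy))

/-- Menger's theorem for two walks: if no vertex meets all walks from `S` to `T` with arcs in `F`,
then there are two such walks without a common vertex. The proof is the induction on the number of
arcs: if the deletion of the arc `e` creates a separating vertex `z`, then there are two disjoint
walks from `S` to `z` and the tail of `e`, and two disjoint walks from `z` and the head of `e` to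
`T`. -/
theorem exists_two_disjoint_walks [Nonempty V] [DecidableEq A] (F : Finset A) (S T : Set V)
    (h : ∀ z, ∃ u ∈ S, ∃ v ∈ T, ∃ l, D.IsWalk u l v ∧ (∀ a ∈ l, a ∈ F) ∧
      z ∉ u :: l.map D.head) :
    ∃ u₁ ∈ S, ∃ v₁ ∈ T, ∃ u₂ ∈ S, ∃ v₂ ∈ T, ∃ l₁ l₂, D.IsWalk u₁ l₁ v₁ ∧ D.IsWalk u₂ l₂ v₂ ∧
      (∀ a ∈ l₁, a ∈ F) ∧ (∀ a ∈ l₂, a ∈ F) ∧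
      ∀ y ∈ u₁ :: l₁.map D.head, y ∉ u₂ :: l₂.map D.head := by
  induction F using Finset.induction_on generalizing S T with
  | empty =>
    have key : ∀ z, ∃ u ∈ S, u ∈ T ∧ z ≠ u := by
      intro z
      obtain ⟨u, hu, v, hv, l, hl, hlF, hz⟩ := h z
      obtain rfl : l = [] := List.eq_nil_iff_forall_not_mem.2 fun a ha => by simpa using hlF a ha
      obtain rfl := isWalk_nil.1 hl
      exact ⟨u, hu, hv, by simpa using hz⟩
    obtain ⟨u₁, h1, h1', -⟩ := key (Classical.arbitrary V)
    obtain ⟨u₂, h2, h2', h12⟩ := key u₁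
    exact ⟨u₁, h1, u₁, h1', u₂, h2, u₂, h2', [], [], rfl, rfl, by simp, by simp, by simpa using h12⟩
  | insert e F heF ih =>
    by_cases h' : ∀ z, ∃ u ∈ S, ∃ v ∈ T, ∃ l, D.IsWalk u l v ∧ (∀ a ∈ l, a ∈ F) ∧
      z ∉ u :: l.map D.head
    · obtain ⟨u₁, hu₁, v₁, hv₁, u₂, hu₂, v₂, hv₂, l₁, l₂, h1, h2, h3, h4, h5⟩ := ih S T h'
      exact ⟨u₁, hu₁, v₁, hv₁, u₂, hu₂, v₂, hv₂, l₁, l₂, h1, h2,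
        fun a ha => Finset.mem_insert_of_mem (h3 a ha),
        fun a ha => Finset.mem_insert_of_mem (h4 a ha), h5⟩
    · push Not at h'
      obtain ⟨z, hz⟩ := h'
      have side1 := ih S {z, D.tail e} (by
        intro z'
        obtain ⟨u, hu, v, hv, l, hl, hlF, hz'⟩ := h z'
        have hX : ∃ y ∈ u :: l.map D.head, y ∈ ({z, D.tail e} : Set V) := by
          by_contra! hc
          refine hc z (hz u hu v hv l hl fun a ha => ?_) (by simp)
          rcases Finset.mem_insert.1 (hlF a ha) with rfl | h
          · exfalso
            refine hc (D.tail a) ?_ (by simp)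
            rw [hl.map_head_eq]
            simp only [List.mem_append]
            exact Or.inl (List.mem_map_of_mem ha)
          · exact h
        obtain ⟨l₁, l₂, y, rfl, h1, h2, h3⟩ := hl.exists_first _ hX
        refine ⟨u, hu, y, h2, l₁, h1, fun a ha => ?_, fun hc => hz' ?_⟩
        · rcases Finset.mem_insert.1 (hlF a (by simp [ha])) with rfl | h
          · exact absurd (by simp) (h3 a ha)
          · exact h
        · simp only [List.mem_cons, List.map_append, List.mem_append] at hc ⊢
          tauto)
      have side2 := ih {z, D.head e} T (by
        intro z'
        obtain ⟨u, hu, v, hv, l, hl, hlF, hz'⟩ := h z'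
        have hX : ∃ y ∈ u :: l.map D.head, y ∈ ({z, D.head e} : Set V) := by
          by_contra! hc
          refine hc z (hz u hu v hv l hl fun a ha => ?_) (by simp)
          rcases Finset.mem_insert.1 (hlF a ha) with rfl | h
          · exact absurd (by simp) (hc (D.head a) (List.mem_cons_of_mem _ (List.mem_map_of_mem ha)))
          · exact h
        obtain ⟨l₁, l₂, y, rfl, h1, h2, h3⟩ := hl.exists_last _ hX
        refine ⟨y, h2, v, hv, l₂, h1, fun a ha => ?_, fun hc => hz' ?_⟩
        · rcases Finset.mem_insert.1 (hlF a (by simp [ha])) with rfl | h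
          · exact absurd (by simp) (h3 a ha)
          · exact h
        · obtain ⟨w, hw1, hw2⟩ := isWalk_append.1 hl
          obtain rfl := hw2.start_unique h1
          have hyw : w ∈ u :: l₁.map D.head := by rw [hw1.map_head_eq]; simp
          simp only [List.mem_cons, List.map_append, List.mem_append] at hc hyw ⊢
          rcases hc with rfl | hc
          · tauto
          · tauto)
      -- on each side one walk ends at `z`, and meets `z` only there
      obtain ⟨u₁, hu₁, u₂, hu₂, p₁, p₂, hp₁, hp₂, hp₁F, hp₂F, hp₁z, hp⟩ :
          ∃ u₁ ∈ S, ∃ u₂ ∈ S, ∃ p₁ p₂, D.IsWalk u₁ p₁ z ∧ D.IsWalk u₂ p₂ (D.tail e) ∧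
            (∀ a ∈ p₁, a ∈ F) ∧ (∀ a ∈ p₂, a ∈ F) ∧ (∀ a ∈ p₁, D.tail a ≠ z) ∧
            ∀ y ∈ u₁ :: p₁.map D.head, y ∉ u₂ :: p₂.map D.head := by
        have aux : ∃ u₁ ∈ S, ∃ u₂ ∈ S, ∃ p₁ p₂, D.IsWalk u₁ p₁ z ∧ D.IsWalk u₂ p₂ (D.tail e) ∧
            (∀ a ∈ p₁, a ∈ F) ∧ (∀ a ∈ p₂, a ∈ F) ∧
            ∀ y ∈ u₁ :: p₁.map D.head, y ∉ u₂ :: p₂.map D.head := by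
          obtain ⟨u₁, hu₁, v₁, hv₁, u₂, hu₂, v₂, hv₂, l₁, l₂, h1, h2, h3, h4, h5⟩ := side1
          have hne : v₁ ≠ v₂ := by
            rintro rfl
            refine h5 v₁ ?_ ?_
            · rw [h1.map_head_eq]; simp
            · rw [h2.map_head_eq]; simp
          rcases hv₁ with rfl | rfl <;> rcases hv₂ with rfl | rfl
          · exact absurd rfl hne
          · exact ⟨u₁, hu₁, u₂, hu₂, l₁, l₂, h1, h2, h3, h4, h5⟩
          · exact ⟨u₂, hu₂, u₁, hu₁, l₂, l₁, h2, h1, h4, h3, fun y hy hy' => h5 y hy' hy⟩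
          · exact absurd rfl hne
        obtain ⟨u₁, hu₁, u₂, hu₂, p₁, p₂, h1, h2, h3, h4, h5⟩ := aux
        obtain ⟨l₁, l₂, y, rfl, h6, rfl, h7⟩ := h1.exists_first {z}
          ⟨z, by rw [h1.map_head_eq]; simp, rfl⟩
        refine ⟨u₁, hu₁, u₂, hu₂, l₁, p₂, h6, h2, fun a ha => h3 a (by simp [ha]), h4, h7, ?_⟩
        intro y hy
        refine h5 y ?_
        simp only [List.mem_cons, List.map_append, List.mem_append] at hy ⊢
        tauto
      obtain ⟨v₁, hv₁, v₂, hv₂, q₁, q₂, hq₁, hq₂, hq₁F, hq₂F, hq₁z, hq⟩ :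
          ∃ v₁ ∈ T, ∃ v₂ ∈ T, ∃ q₁ q₂, D.IsWalk z q₁ v₁ ∧ D.IsWalk (D.head e) q₂ v₂ ∧
            (∀ a ∈ q₁, a ∈ F) ∧ (∀ a ∈ q₂, a ∈ F) ∧ (∀ a ∈ q₁, D.head a ≠ z) ∧
            ∀ y ∈ z :: q₁.map D.head, y ∉ D.head e :: q₂.map D.head := by
        have aux : ∃ v₁ ∈ T, ∃ v₂ ∈ T, ∃ q₁ q₂, D.IsWalk z q₁ v₁ ∧ D.IsWalk (D.head e) q₂ v₂ ∧
            (∀ a ∈ q₁, a ∈ F) ∧ (∀ a ∈ q₂, a ∈ F) ∧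
            ∀ y ∈ z :: q₁.map D.head, y ∉ D.head e :: q₂.map D.head := by
          obtain ⟨u₁, hu₁, v₁, hv₁, u₂, hu₂, v₂, hv₂, l₁, l₂, h1, h2, h3, h4, h5⟩ := side2
          have hne : u₁ ≠ u₂ := by
            rintro rfl
            exact h5 u₁ (by simp) (by simp)
          rcases hu₁ with rfl | rfl <;> rcases hu₂ with rfl | rfl
          · exact absurd rfl hne
          · exact ⟨v₁, hv₁, v₂, hv₂, l₁, l₂, h1, h2, h3, h4, h5⟩
          · exact ⟨v₂, hv₂, v₁, hv₁, l₂, l₁, h2, h1, h4, h3, fun y hy hy' => h5 y hy' hy⟩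
          · exact absurd rfl hne
        obtain ⟨v₁, hv₁, v₂, hv₂, q₁, q₂, h1, h2, h3, h4, h5⟩ := aux
        obtain ⟨l₁, l₂, y, rfl, h6, rfl, h7⟩ := h1.exists_last {z} ⟨z, by simp, rfl⟩
        refine ⟨v₁, hv₁, v₂, hv₂, l₂, q₂, h6, h2, fun a ha => h3 a (by simp [ha]), h4, h7, ?_⟩
        intro y' hy
        refine h5 y' ?_
        simp only [List.mem_cons, List.map_append, List.mem_append] at hy ⊢
        tauto
      have hz₂ : z ∉ u₂ :: p₂.map D.head := hp z (by rw [hp₁.map_head_eq]; simp)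
      have hz₂' : z ∉ D.head e :: q₂.map D.head := hq z (by simp)
      -- a common vertex of the two sides gives a walk from `S` to `T` without `e`
      have cross : ∀ {u s v t : V} {p q : List A}, u ∈ S → v ∈ T → D.IsWalk u p s →
          D.IsWalk t q v → (∀ a ∈ p, a ∈ F) → (∀ a ∈ q, a ∈ F) → ∀ y ∈ u :: p.map D.head,
          y ∈ t :: q.map D.head → y = z ∨ (∃ a ∈ p, D.tail a = z) ∨ ∃ a ∈ q, D.head a = z := by
        intro u s v t p q hu hv hp hq hpF hqF y hy hy'
        obtain ⟨p, p', rfl, hp, -⟩ := hp.exists_split hy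
        obtain ⟨q', q, rfl, -, hq⟩ := hq.exists_split hy'
        have := hz u hu v hv (p ++ q) (hp.append hq) (by
          intro a ha
          rcases List.mem_append.1 ha with ha | ha
          · exact hpF a (by simp [ha])
          · exact hqF a (by simp [ha]))
        rw [List.map_append, ← List.cons_append, hp.map_head_eq] at this
        simp only [List.mem_append, List.mem_map, List.mem_singleton] at this
        rcases this with (⟨a, ha, h⟩ | h) | ⟨a, ha, h⟩
        · exact Or.inr (Or.inl ⟨a, Or.inl ha |> List.mem_append.2, h⟩)
        · exact Or.inl h.symm
        · exact Or.inr (Or.inr ⟨a, Or.inr ha |> List.mem_append.2, h⟩)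
      have htail : ∀ a ∈ p₂, D.tail a ≠ z := by
        rintro a ha rfl
        apply hz₂
        rw [hp₂.map_head_eq]
        simp only [List.mem_append]
        exact Or.inl (List.mem_map_of_mem ha)
      have hhead : ∀ a ∈ q₂, D.head a ≠ z := by
        rintro a ha rfl
        exact hz₂' (List.mem_cons_of_mem _ (List.mem_map_of_mem ha))
      refine ⟨u₁, hu₁, v₁, hv₁, u₂, hu₂, v₂, hv₂, p₁ ++ q₁, p₂ ++ e :: q₂, hp₁.append hq₁,
        hp₂.append ⟨rfl, hq₂⟩, ?_, ?_, ?_⟩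
      · intro a ha
        rcases List.mem_append.1 ha with ha | ha
        exacts [Finset.mem_insert_of_mem (hp₁F a ha), Finset.mem_insert_of_mem (hq₁F a ha)]
      · intro a ha
        rcases List.mem_append.1 ha with ha | ha
        · exact Finset.mem_insert_of_mem (hp₂F a ha)
        · rcases List.mem_cons.1 ha with rfl | ha
          exacts [Finset.mem_insert_self .., Finset.mem_insert_of_mem (hq₂F a ha)]
      · intro y hy hy'
        rw [List.map_append, ← List.cons_append, List.mem_append] at hy
        rw [List.map_append, ← List.cons_append, List.mem_append, List.map_cons] at hy'
        rcases hy with hy | hy <;> rcases hy' with hy' | hy'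
        · exact hp y hy hy'
        · rcases cross hu₁ hv₂ hp₁ hq₂ hp₁F hq₂F y hy hy' with rfl | ⟨a, ha, h⟩ | ⟨a, ha, h⟩
          · exact hz₂' hy'
          · exact hp₁z a ha h
          · exact hhead a ha h
        · rcases cross hu₂ hv₁ hp₂ hq₁ hp₂F hq₁F y hy' (List.mem_cons_of_mem _ hy) with
            rfl | ⟨a, ha, h⟩ | ⟨a, ha, h⟩
          · exact hz₂ hy'
          · exact htail a ha h
          · exact hq₁z a ha h
        · exact hq y (List.mem_cons_of_mem _ hy) hy'

end Multidigraph

/-! ### Two dicycles that meet only in transversal vertices -/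

namespace Multidigraph

variable {V A : Type*} {D : Multidigraph V A}

variable (D) in
/-- The arc set `F` contains a dicycle, and for each vertex that is not a transversal vertex
of `D` it contains a dicycle that avoids this vertex. -/
def IsGood (F : Set A) : Prop :=
  (∃ B, D.IsDicycle B ∧ ∀ a ∈ B, a ∈ F) ∧
    ∀ v, v ∉ D.transversalVertices → ∃ B, D.IsDicycle B ∧ (∀ a ∈ B, a ∈ F) ∧ v ∉ B.map D.tail

theorem IsGood.mono {F F' : Set A} (h : D.IsGood F) (hF : F ⊆ F') : D.IsGood F' := by
  obtain ⟨⟨B, h1, h2⟩, h3⟩ := h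
  refine ⟨⟨B, h1, fun a ha => hF (h2 a ha)⟩, fun v hv => ?_⟩
  obtain ⟨B, h1, h2, h4⟩ := h3 v hv
  exact ⟨B, h1, fun a ha => hF (h2 a ha), h4⟩

theorem isGood_univ (h : ∃ B, D.IsDicycle B) : D.IsGood Set.univ := by
  refine ⟨h.imp fun B hB => ⟨hB, fun _ _ => trivial⟩, fun v hv => ?_⟩
  rw [mem_transversalVertices_iff] at hv
  push Not at hv
  obtain ⟨B, hB, hv⟩ := hv
  exact ⟨B, hB, fun _ _ => trivial, hv⟩

/-- A dicycle starts at any of its vertices after a rotation. -/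
theorem IsDicycle.exists_rotate {B : List A} (h : D.IsDicycle B) {x : V} (hx : x ∈ B.map D.tail) :
    ∃ a l l', B = l' ++ a :: l ∧ D.tail a = x ∧ D.IsDicycle (a :: (l ++ l')) ∧
      D.IsWalk x (a :: (l ++ l')) x := by
  obtain ⟨a, ha, rfl⟩ := List.mem_map.1 hx
  obtain ⟨l', l, rfl⟩ := List.append_of_mem ha
  have := h.rotate_append
  rw [List.cons_append] at this
  exact ⟨a, l, l', rfl, rfl, this, (isDicycle_cons_iff.1 this).2⟩

open Classical in
/-- The copy number `i` of a vertex: only the transversal vertices have two different copies. -/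
noncomputable def copy (D : Multidigraph V A) (v : V) (i : Bool) : V × Bool :=
  (v, if v ∈ D.transversalVertices then i else false)

/-- The digraph obtained from `D` by doubling the transversal vertices. -/
noncomputable def double (D : Multidigraph V A) : Multidigraph (V × Bool) (A × Bool × Bool) where
  tail a := D.copy (D.tail a.1) a.2.1
  head a := D.copy (D.head a.1) a.2.2

theorem IsWalk.lift {u v : V} {l : List A} (h : D.IsWalk u l v) (i : Bool) :
    D.double.IsWalk (D.copy u i) (l.map fun a => (a, i, i)) (D.copy v i) := by
  induction l generalizing u with
  | nil => obtain rfl := h; rfl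
  | cons a l ih => exact ⟨by rw [← h.1]; rfl, ih h.2⟩

theorem IsWalk.project {u v : V × Bool} {l : List (A × Bool × Bool)} (h : D.double.IsWalk u l v) :
    D.IsWalk u.1 (l.map Prod.fst) v.1 := by
  induction l generalizing u with
  | nil => obtain rfl := h; rfl
  | cons a l ih => exact ⟨by rw [← h.1]; rfl, ih h.2⟩

/-- A good arc set contains two dicycles that have only transversal vertices in common. -/
theorem IsGood.exists_two_dicycles [Finite A] {F : Set A} (hF : D.IsGood F) {r : V}
    (hr : r ∈ D.transversalVertices) :
    ∃ Q₁ Q₂, D.IsDicycle Q₁ ∧ D.IsDicycle Q₂ ∧ (∀ a ∈ Q₁, a ∈ F) ∧ (∀ a ∈ Q₂, a ∈ F) ∧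
      ∀ v ∈ Q₁.map D.tail, v ∈ Q₂.map D.tail → v ∈ D.transversalVertices := by
  classical
  have hfin : {a : A × Bool × Bool | a.1 ∈ F ∧ D.head a.1 ≠ r}.Finite := Set.toFinite _
  have : Nonempty (V × Bool) := ⟨(r, true)⟩
  -- dicycles are walks from a copy of `r` to a copy of a vertex with an arc to `r`
  have hlift : ∀ B, D.IsDicycle B → (∀ a ∈ B, a ∈ F) → ∀ i z, (∀ v ∈ B.map D.tail, D.copy v i ≠ z) →
      ∃ u ∈ {w | ∃ i, w = D.copy r i}, ∃ v ∈ {w | ∃ b i, b ∈ F ∧ D.head b = r ∧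
        w = D.copy (D.tail b) i}, ∃ l, D.double.IsWalk u l v ∧ (∀ a ∈ l, a ∈ hfin.toFinset) ∧
      z ∉ u :: l.map D.double.head := by
    intro B hB hBF i z hz
    obtain ⟨a, l, l', rfl, ha, hdi, hw⟩ := hB.exists_rotate (mem_transversalVertices_iff.1 hr B hB)
    replace hBF : ∀ c ∈ a :: (l ++ l'), c ∈ F := fun c hc => hBF c (by simp at hc ⊢; tauto)
    replace hz : ∀ v ∈ (a :: (l ++ l')).map D.tail, D.copy v i ≠ z := by
      intro v hv
      obtain ⟨c, hc, rfl⟩ := List.mem_map.1 hv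
      exact hz _ (List.mem_map_of_mem (by simp at hc ⊢; tauto))
    have hn := hdi.exists_isWalk.2.1
    rw [List.map_cons, ha, List.nodup_cons] at hn
    obtain ⟨p, b, hpb⟩ : ∃ p b, a :: (l ++ l') = p ++ [b] :=
      ⟨_, _, (List.dropLast_append_getLast (by simp)).symm⟩
    have htail : (l ++ l').map D.tail = ((p ++ [b]).map D.tail).tail := by rw [← hpb]; simp
    rw [hpb] at hw hBF hz
    obtain ⟨h1, h2⟩ := isWalk_append_cons.1 hw
    have hheads : p.map D.head = (l ++ l').map D.tail := by
      have := h1.map_head_eq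
      rw [htail, List.map_append, List.map_singleton, ← this, List.tail_cons]
    refine ⟨_, ⟨i, rfl⟩, _, ⟨b, i, hBF b (by simp), h2.2, rfl⟩, _, h1.lift i, ?_, ?_⟩
    · intro c' hc'
      obtain ⟨c, hc, rfl⟩ := List.mem_map.1 hc'
      rw [Set.Finite.mem_toFinset]
      refine ⟨hBF c (by simp [hc]), fun h => hn.1 ?_⟩
      rw [← hheads, ← h]
      exact List.mem_map_of_mem hc
    · have hv : ∀ v ∈ r :: p.map D.head, D.copy v i ≠ z := by
        intro v hv
        refine hz v ?_
        rw [h1.map_head_eq] at hv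
        simpa using hv
      intro hc
      rcases List.mem_cons.1 hc with h | hc
      · exact hv r (by simp) h.symm
      · rw [List.map_map] at hc
        obtain ⟨c, hcp, rfl⟩ := List.mem_map.1 hc
        exact hv (D.head c) (List.mem_cons_of_mem _ (List.mem_map_of_mem hcp)) rfl
  obtain ⟨u₁, ⟨i₁, rfl⟩, v₁, ⟨b₁, j₁, hb₁F, hb₁, rfl⟩, u₂, ⟨i₂, rfl⟩, v₂, ⟨b₂, j₂, hb₂F, hb₂, rfl⟩,
      l₁, l₂, h1, h2, h3, h4, h5⟩ :=
    exists_two_disjoint_walks (D := D.double) hfin.toFinset {w | ∃ i, w = D.copy r i}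
      {w | ∃ b i, b ∈ F ∧ D.head b = r ∧ w = D.copy (D.tail b) i} (by
        rintro ⟨v, i⟩
        by_cases hv : v ∈ D.transversalVertices
        · obtain ⟨B, hB, hBF⟩ := hF.1
          refine hlift B hB hBF (!i) (v, i) fun w _ h => ?_
          simp only [copy, Prod.mk.injEq] at h
          obtain ⟨rfl, h⟩ := h
          simp [hv] at h
        · obtain ⟨B, hB, hBF, hvB⟩ := hF.2 v hv
          refine hlift B hB hBF i (v, i) fun w hw h => ?_
          simp only [copy, Prod.mk.injEq] at h
          exact hvB (h.1 ▸ hw))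
  have hproj : ∀ {i j : Bool} {b : A} {l : List (A × Bool × Bool)},
      D.double.IsWalk (D.copy r i) l (D.copy (D.tail b) j) → (∀ a ∈ l, a ∈ hfin.toFinset) →
      b ∈ F → D.head b = r → D.IsDicycle (l.map Prod.fst ++ [b]) ∧
        (∀ a ∈ l.map Prod.fst ++ [b], a ∈ F) ∧
        ∀ v ∈ (l.map Prod.fst ++ [b]).map D.tail, v ∉ D.transversalVertices →
          (v, false) ∈ D.copy r i :: l.map D.double.head := by
    intro i j b l hl hlF hbF hb
    have hlF' : ∀ a ∈ l, a.1 ∈ F ∧ D.head a.1 ≠ r := fun a ha => by simpa using hlF a ha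
    have hp : D.IsWalk r (l.map Prod.fst) (D.tail b) := hl.project
    have hw : D.IsWalk r (l.map Prod.fst ++ [b]) r := hp.append ⟨rfl, hb⟩
    have htl : (l.map Prod.fst ++ [b]).map D.tail = r :: (l.map Prod.fst).map D.head := by
      rw [hp.map_head_eq, List.map_append]; rfl
    refine ⟨?_, ?_, ?_⟩
    · obtain ⟨c, q, hcq⟩ : ∃ c q, l.map Prod.fst ++ [b] = c :: q :=
        List.exists_cons_of_ne_nil (by simp)
      rw [hcq] at hw htl ⊢
      refine hw.isDicycle_of_once hr fun hc => ?_
      rw [List.map_cons, List.cons.injEq] at htl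
      rw [htl.2, List.map_map] at hc
      obtain ⟨a, ha, har⟩ := List.mem_map.1 hc
      exact (hlF' a ha).2 har
    · intro a ha
      rcases List.mem_append.1 ha with ha | ha
      · obtain ⟨c, hc, rfl⟩ := List.mem_map.1 ha
        exact (hlF' c hc).1
      · obtain rfl := List.mem_singleton.1 ha
        exact hbF
    · intro v hv hvT
      rw [htl, List.map_map] at hv
      rcases List.mem_cons.1 hv with rfl | hv
      · exact absurd hr hvT
      · obtain ⟨a, ha, rfl⟩ := List.mem_map.1 hv
        refine List.mem_cons_of_mem _ (List.mem_map.2 ⟨a, ha, ?_⟩)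
        simp only [Function.comp_apply] at hvT
        simp [double, copy, hvT]
  obtain ⟨g1, g2, g3⟩ := hproj h1 h3 hb₁F hb₁
  obtain ⟨k1, k2, k3⟩ := hproj h2 h4 hb₂F hb₂
  refine ⟨_, _, g1, k1, g2, k2, fun v hv hv' => ?_⟩
  by_contra hvT
  exact h5 _ (g3 v hv hvT) (k3 v hv' hvT)

/-- A minimal good arc set is the union of two dicycles that have only transversal vertices in
common. -/
theorem IsGood.eq_two_dicycles [Finite A] {F : Set A} (hF : D.IsGood F)
    (hmin : ∀ a ∈ F, ¬ D.IsGood (F \ {a})) {r : V} (hr : r ∈ D.transversalVertices) :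
    ∃ Q₁ Q₂, D.IsDicycle Q₁ ∧ D.IsDicycle Q₂ ∧ (∀ a, a ∈ F ↔ a ∈ Q₁ ∨ a ∈ Q₂) ∧
      ∀ v ∈ Q₁.map D.tail, v ∈ Q₂.map D.tail → v ∈ D.transversalVertices := by
  obtain ⟨Q₁, Q₂, h1, h2, h3, h4, h5⟩ := hF.exists_two_dicycles hr
  refine ⟨Q₁, Q₂, h1, h2, fun a => ⟨fun ha => ?_, fun h => h.elim (h3 a) (h4 a)⟩, h5⟩
  by_contra! hc
  have m1 : ∀ b ∈ Q₁, b ∈ F \ {a} := fun b hb => ⟨h3 b hb, fun h => hc.1 (h ▸ hb)⟩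
  have m2 : ∀ b ∈ Q₂, b ∈ F \ {a} := fun b hb => ⟨h4 b hb, fun h => hc.2 (h ▸ hb)⟩
  refine hmin a ha ⟨⟨Q₁, h1, m1⟩, fun v hv => ?_⟩
  by_cases hv1 : v ∈ Q₁.map D.tail
  · exact ⟨Q₂, h2, m2, fun hv2 => hv (h5 v hv1 hv2)⟩
  · exact ⟨Q₁, h1, m1, hv1⟩

end Multidigraph

/-! ### Segments and the exchange argument -/

namespace Multidigraph

variable {V A : Type*} {D : Multidigraph V A}

variable (D) in
/-- There is a walk from `p` to `q` in which no arc has its tail in `N`. -/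
def Off (N : Set V) (p q : V) : Prop := ∃ l, D.IsWalk p l q ∧ ∀ a ∈ l, D.tail a ∉ N

variable (D) in
/-- There is a nonempty walk from `p` to `q` in which no arc has its tail in `N`. -/
def OffPos (N : Set V) (p q : V) : Prop :=
  ∃ l, l ≠ [] ∧ D.IsWalk p l q ∧ ∀ a ∈ l, D.tail a ∉ N

theorem Off.refl (N : Set V) (p : V) : D.Off N p p := ⟨[], rfl, by simp⟩

theorem OffPos.off {N : Set V} {p q : V} (h : D.OffPos N p q) : D.Off N p q := by
  obtain ⟨l, -, h⟩ := h
  exact ⟨l, h⟩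

theorem Off.trans {N : Set V} {p q r : V} (h : D.Off N p q) (h' : D.Off N q r) : D.Off N p r := by
  obtain ⟨l, hl, hN⟩ := h
  obtain ⟨l', hl', hN'⟩ := h'
  refine ⟨l ++ l', hl.append hl', fun a ha => ?_⟩
  rcases List.mem_append.1 ha with ha | ha
  exacts [hN a ha, hN' a ha]

theorem OffPos.trans_off {N : Set V} {p q r : V} (h : D.OffPos N p q) (h' : D.Off N q r) :
    D.OffPos N p r := by
  obtain ⟨l, h0, hl, hN⟩ := h
  obtain ⟨l', hl', hN'⟩ := h'
  refine ⟨l ++ l', by simp [h0], hl.append hl', fun a ha => ?_⟩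
  rcases List.mem_append.1 ha with ha | ha
  exacts [hN a ha, hN' a ha]

theorem Off.trans_pos {N : Set V} {p q r : V} (h : D.Off N p q) (h' : D.OffPos N q r) :
    D.OffPos N p r := by
  obtain ⟨l, hl, hN⟩ := h
  obtain ⟨l', h0, hl', hN'⟩ := h'
  refine ⟨l ++ l', by simp [h0], hl.append hl', fun a ha => ?_⟩
  rcases List.mem_append.1 ha with ha | ha
  exacts [hN a ha, hN' a ha]

theorem IsWalk.off_of_mem {N : Set V} {p q : V} {l : List A} (h : D.IsWalk p l q)
    (hN : ∀ a ∈ l, D.tail a ∉ N) {v : V} (hv : v ∈ l.map D.tail) :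
    D.Off N p v ∧ D.OffPos N v q := by
  obtain ⟨a, ha, rfl⟩ := List.mem_map.1 hv
  obtain ⟨l₁, l₂, rfl⟩ := List.append_of_mem ha
  obtain ⟨h1, h2⟩ := isWalk_append_cons.1 h
  exact ⟨⟨l₁, h1, fun b hb => hN b (by simp [hb])⟩,
    ⟨a :: l₂, by simp, h2, fun b hb => hN b (List.mem_append_right _ hb)⟩⟩

theorem IsWalk.offPos_of_mem_tail {N : Set V} {p q : V} {l : List A} (h : D.IsWalk p l q)
    (hN : ∀ a ∈ l, D.tail a ∉ N) {v : V} (hv : v ∈ l.tail.map D.tail) : D.OffPos N p v := by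
  cases l with
  | nil => simp at hv
  | cons a l =>
    obtain ⟨l', hl', hN'⟩ := (h.2.off_of_mem (fun b hb => hN b (List.mem_cons_of_mem _ hb)) hv).1
    refine ⟨a :: l', by simp, ⟨h.1, hl'⟩, fun b hb => ?_⟩
    rcases List.mem_cons.1 hb with rfl | hb
    exacts [hN _ (by simp), hN' b hb]

variable (D) in
/-- The inner vertices of the walk with the arc list `P`. -/
def inner (P : List A) : Set V := {v | v ∈ P.tail.map D.tail}

variable (D) in
/-- `P` is a nonempty walk from `x` to `y` without inner vertices in `N`. -/
structure IsSeg (N : Set V) (x y : V) (P : List A) : Prop where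
  ne_nil : P ≠ []
  isWalk : D.IsWalk x P y
  inner_notMem : ∀ a ∈ P.tail, D.tail a ∉ N

theorem IsSeg.notMem {N : Set V} {x y : V} {P : List A} (h : D.IsSeg N x y P) {v : V}
    (hv : v ∈ D.inner P) : v ∉ N := by
  obtain ⟨a, ha, rfl⟩ := List.mem_map.1 hv
  exact h.inner_notMem a ha

/-- A segment can be cut at an inner vertex. -/
theorem IsSeg.exists_split {N : Set V} {x y : V} {P : List A} (h : D.IsSeg N x y P) {u : V}
    (hu : u ∈ D.inner P) :
    ∃ p q, P = p ++ q ∧ p ≠ [] ∧ q ≠ [] ∧ D.IsWalk x p u ∧ D.IsWalk u q y := by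
  obtain ⟨b, hb, rfl⟩ := List.mem_map.1 hu
  obtain ⟨h0, hw, -⟩ := h
  cases P with
  | nil => exact absurd rfl h0
  | cons a P =>
    obtain ⟨l₁, l₂, h12⟩ := List.append_of_mem hb
    rw [List.tail_cons] at h12
    subst h12
    obtain ⟨h1, h2⟩ := isWalk_append_cons.1 hw.2
    exact ⟨a :: l₁, b :: l₂, rfl, by simp, by simp, ⟨hw.1, h1⟩, h2⟩

open Classical in
/-- The number of arcs of the list `P` that are not in `F`. -/
noncomputable def excess (F : Set A) (P : List A) : ℕ := P.countP fun a => a ∉ F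

theorem excess_append (F : Set A) (P Q : List A) : excess F (P ++ Q) = excess F P + excess F Q := by
  classical
  simp [excess, List.countP_append]

open Classical in
theorem excess_cons (F : Set A) (a : A) (P : List A) :
    excess F (a :: P) = excess F P + if a ∈ F then 0 else 1 := by
  by_cases ha : a ∈ F <;> simp [excess, ha]

theorem excess_eq_zero {F : Set A} {P : List A} (h : ∀ a ∈ P, a ∈ F) : excess F P = 0 := by
  classical
  simpa [excess, List.countP_eq_zero] using h

theorem excess_pos {F : Set A} {P : List A} {a : A} (h : a ∈ P) (ha : a ∉ F) : 0 < excess F P := by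
  classical
  simp only [excess, List.countP_pos_iff]
  exact ⟨a, h, by simpa using ha⟩

variable (D) in
/-- The situation of the exchange argument. `x` and `y` are consecutive transversal vertices (the
set of which is `N`), `Q false` and `Q true` are the parts from `x` to `y` of the two reference
dicycles with arc set `F`, and `P` is the part of a dicycle `B` whose removal leaves a cycle. `S`
consists of the vertices that are not on the part of `B` from `y` to `x`. Among the segments `P`
for which there is a cycle, the given one has the fewest arcs outside `F`. -/
structure IsExtremal (N : Set V) (F : Set A) (S : Set V) (x y : V) (Q : Bool → List A)
    (P : List A) : Prop where
  acyclic : ∀ u l, D.IsWalk u l u → l ≠ [] → ∃ a ∈ l, D.tail a ∈ N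
  y_mem : y ∈ N
  segQ : ∀ i, D.IsSeg N x y (Q i)
  segP : D.IsSeg N x y P
  Q_sub : ∀ i, ∀ a ∈ Q i, a ∈ F
  F_sub : ∀ i, ∀ a ∈ F, D.tail a ∈ D.inner (Q i) → a ∈ Q i
  disj : ∀ i j, ∀ v ∈ D.inner (Q i), v ∈ D.inner (Q j) → i = j
  innerQ_sub : ∀ i, D.inner (Q i) ⊆ S
  innerP_sub : D.inner P ⊆ S
  hasCyc : D.HasCyc (S \ D.inner P)
  minimal : ∀ P', D.IsSeg N x y P' → excess F P' < excess F P → ¬ D.HasCyc (S \ D.inner P')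

namespace IsExtremal

variable {N : Set V} {F : Set A} {S : Set V} {x y : V} {Q : Bool → List A} {P : List A}

/-- All closed walks meet `N`, so the relation `Off` is antisymmetric. -/
theorem not_offPos (h : D.IsExtremal N F S x y Q P) {p q : V} (h1 : D.Off N p q)
    (h2 : D.OffPos N q p) : False := by
  obtain ⟨l, h0, hl, hN⟩ := h2.trans_off h1
  obtain ⟨a, ha, haN⟩ := h.acyclic _ l hl h0
  exact hN a ha haN

/-- Two vertices of a reference path that are joined by a walk are in the same order on that
path. -/
theorem exists_between (h : D.IsExtremal N F S x y Q P) (i : Bool) {u w : V}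
    (hu : u ∈ D.inner (Q i)) (hw : w ∈ D.inner (Q i) ∨ w = y) (huw : D.OffPos N u w) :
    ∃ q₀ q₁ q₂, Q i = q₀ ++ (q₁ ++ q₂) ∧ q₀ ≠ [] ∧ q₁ ≠ [] ∧ D.IsWalk u q₁ w := by
  obtain ⟨p, q, hpq, hp0, hq0, hp, hq⟩ := (h.segQ i).exists_split hu
  rcases hw with hw | rfl
  · have hN := (h.segQ i).inner_notMem
    rw [hpq, List.tail_append_of_ne_nil hp0] at hN
    unfold inner at hw
    rw [hpq, List.tail_append_of_ne_nil hp0, List.map_append, Set.mem_ofPred_eq,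
      List.mem_append] at hw
    rcases hw with hw | hw
    · exfalso
      cases p with
      | nil => exact hp0 rfl
      | cons a p =>
        exact h.not_offPos huw.off
          (hp.2.off_of_mem (fun b hb => hN b (List.mem_append_left _ hb)) hw).2
    · obtain ⟨b, hb, rfl⟩ := List.mem_map.1 hw
      obtain ⟨q₁, q₂, rfl⟩ := List.append_of_mem hb
      have h1 := (isWalk_append_cons.1 hq).1
      refine ⟨p, q₁, b :: q₂, hpq, hp0, ?_, h1⟩
      rintro rfl
      obtain rfl := isWalk_nil.1 h1
      exact h.not_offPos (Off.refl _ _) huw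
  · exact ⟨p, q, [], by simpa using hpq, hp0, hq0, hq⟩

/-- An arc of `P` at which `P` leaves the reference paths at an inner vertex. -/
def IsStart (D : Multidigraph V A) (F : Set A) (Q : Bool → List A) (a : A) : Prop :=
  a ∉ F ∧ ∃ i, D.tail a ∈ D.inner (Q i)

/-- A walk without starts that ends on the reference path `Q i` consists of a part off the
reference paths and a part along `Q i`. -/
theorem exists_connector (h : D.IsExtremal N F S x y Q P) (i : Bool) {z v : V} {k : List A}
    (hk : D.IsWalk z k v) (hv : v ∈ D.inner (Q i)) (hs : ∀ a ∈ k, ¬ IsStart D F Q a)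
    (hN : ∀ a ∈ k, D.tail a ∉ N) :
    ∃ c m w, k = c ++ m ∧ D.IsWalk z c w ∧ D.IsWalk w m v ∧ w ∈ D.inner (Q i) ∧
      (∀ a ∈ c, ∀ j, D.tail a ∉ D.inner (Q j)) ∧ ∀ a ∈ m, D.tail a ∈ D.inner (Q i) := by
  induction k generalizing z with
  | nil =>
    obtain rfl := isWalk_nil.1 hk
    exact ⟨[], [], z, rfl, rfl, rfl, hv, by simp, by simp⟩
  | cons a k ih =>
    obtain ⟨rfl, hk⟩ := hk
    obtain ⟨c, m, w, rfl, h1, h2, h3, h4, h5⟩ := ih hk (fun b hb => hs b (by simp [hb]))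
      (fun b hb => hN b (by simp [hb]))
    by_cases ha : ∃ j, D.tail a ∈ D.inner (Q j)
    · obtain ⟨j, hj⟩ := ha
      have haF : a ∈ F := by
        by_contra hc
        exact hs a (by simp) ⟨hc, j, hj⟩
      have hhN : D.head a ∉ N := by
        cases hcm : c ++ m with
        | nil =>
          rw [hcm] at hk
          rw [isWalk_nil.1 hk]
          exact (h.segQ i).notMem hv
        | cons b l =>
          rw [hcm] at hk
          rw [← hk.1]
          exact hN b (by rw [hcm]; simp)
      have hhj : D.head a ∈ D.inner (Q j) := by
        rcases (h.segQ j).isWalk.head_mem (h.F_sub j a haF hj) with h' | h'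
        · exact absurd (h' ▸ h.y_mem) hhN
        · exact h'
      cases c with
      | cons b c => exact absurd (h1.1 ▸ hhj) (h4 b (by simp) j)
      | nil =>
        obtain rfl := isWalk_nil.1 h1
        obtain rfl := h.disj i j _ h3 hhj
        refine ⟨[], a :: m, D.tail a, rfl, rfl, ⟨rfl, h2⟩, hj, by simp, ?_⟩
        intro b hb
        rcases List.mem_cons.1 hb with rfl | hb
        exacts [hj, h5 b hb]
    · refine ⟨a :: c, m, w, rfl, ⟨rfl, h1⟩, h2, h3, ?_, h5⟩
      intro b hb j
      rcases List.mem_cons.1 hb with rfl | hb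
      exacts [fun hj => ha ⟨j, hj⟩, h4 b hb j]

/-- A part of `P` off the reference paths leads from one reference path to the other one: otherwise
it would form a cycle together with a part of that path, and the other path could take the role
of `P`. -/
theorem side_ne (h : D.IsExtremal N F S x y Q P) {i j : Bool} {s : A} {c : List A} {w : V}
    (hP : ∀ a ∈ s :: c, a ∈ P.tail) (hsF : s ∉ F) (hs : D.tail s ∈ D.inner (Q i))
    (hc : D.IsWalk (D.head s) c w) (hw : w ∈ D.inner (Q j))
    (hcQ : ∀ a ∈ c, ∀ j, D.tail a ∉ D.inner (Q j)) : i ≠ j := by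
  rintro rfl
  have hN : ∀ a ∈ s :: c, D.tail a ∉ N := fun a ha => h.segP.inner_notMem a (hP a ha)
  obtain ⟨q₀, q₁, q₂, hq, hq0, -, hq₁⟩ := h.exists_between i hs (Or.inl hw)
    ⟨s :: c, by simp, ⟨rfl, hc⟩, hN⟩
  have hne : ∀ v ∈ D.inner (Q i), v ∉ D.inner (Q (!i)) := by
    intro v hv hv'
    have := h.disj _ _ v hv hv'
    simp at this
  refine h.minimal (Q (!i)) (h.segQ _) ?_ (hasCyc_of_uconn (e := s)
    ⟨h.innerQ_sub i hs, hne _ hs⟩ ?_)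
  · rw [excess_eq_zero (h.Q_sub _)]
    exact excess_pos (List.mem_of_mem_tail (hP s (by simp))) hsF
  · have hwS : w ∈ S \ D.inner (Q (!i)) := ⟨h.innerQ_sub i hw, hne _ hw⟩
    refine UConn.trans (y := w) (hc.uconn ?_ ?_ hwS) (UConn.symm (hq₁.uconn ?_ ?_ hwS))
    · rintro a ha rfl
      exact hcQ a ha i hs
    · intro a ha
      exact ⟨h.innerP_sub (List.mem_map_of_mem (hP a (by simp [ha]))), hcQ a ha _⟩
    · rintro a ha rfl
      exact hsF (h.Q_sub i a (by rw [hq]; simp [ha]))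
    · intro a ha
      have : D.tail a ∈ D.inner (Q i) := by
        unfold inner
        rw [hq, List.tail_append_of_ne_nil hq0]
        exact List.mem_map_of_mem (by simp [ha])
      exact ⟨h.innerQ_sub i this, hne _ this⟩

end IsExtremal

end Multidigraph

namespace Multidigraph

variable {V A : Type*} {D : Multidigraph V A}

theorem _root_.List.exists_first_of_countP {α : Type*} {p : α → Bool} {n : ℕ} {l : List α}
    (h : n + 1 ≤ l.countP p) :
    ∃ l₀ s l₁, l = l₀ ++ s :: l₁ ∧ (∀ a ∈ l₀, ¬ p a) ∧ p s ∧ n ≤ l₁.countP p := by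
  induction l with
  | nil => simp at h
  | cons a l ih =>
    by_cases ha : p a
    · exact ⟨[], a, l, rfl, by simp, ha, by simpa [ha] using h⟩
    · obtain ⟨l₀, s, l₁, rfl, h1, h2, h3⟩ := ih (by simpa [ha] using h)
      refine ⟨a :: l₀, s, l₁, rfl, ?_, h2, h3⟩
      intro b hb
      rcases List.mem_cons.1 hb with rfl | hb
      exacts [ha, h1 b hb]

theorem mem_inner_cons {a : A} {l : List A} {v : V} :
    v ∈ D.inner (a :: l) ↔ v ∈ l.map D.tail := Iff.rfl

namespace IsExtremal

variable {N : Set V} {F : Set A} {S : Set V} {x y : V} {Q : Bool → List A} {P : List A}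

set_option maxHeartbeats 1000000 in
open Classical in
/-- The segment `P` leaves the reference paths at most twice at inner vertices. Otherwise, `P` runs
along three pieces of the reference paths, on alternating sides. Replacing one of them by the
opposite piece `φ₁`, `φ₂`, `φ₃` leaves fewer arcs outside `F`. So each of the three pieces meets all
the cycles, and then the replacement in the middle leaves a cycle. -/
theorem countP_isStart_le (h : D.IsExtremal N F S x y Q P) :
    P.tail.countP (fun a => decide (IsStart D F Q a)) ≤ 2 := by
  have hbool : ∀ i j l : Bool, i ≠ j → j ≠ l → l = i := by decide
  by_contra! hcount
  obtain ⟨k₀, s₁, t₁, hPt, hk₀, hs₁, hcount⟩ := List.exists_first_of_countP hcount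
  obtain ⟨k₁, s₂, t₂, rfl, hk₁, hs₂, hcount⟩ := List.exists_first_of_countP hcount
  obtain ⟨k₂, s₃, k₃, rfl, hk₂, hs₃, -⟩ :=
    List.exists_first_of_countP (n := 0) (by omega : 0 + 1 ≤ _)
  simp only [decide_eq_true_eq] at hk₀ hs₁ hk₁ hs₂ hk₂ hs₃
  obtain ⟨a₀, P, rfl⟩ := List.exists_cons_of_ne_nil h.segP.ne_nil
  rw [List.tail_cons] at hPt
  subst hPt
  have hN := h.segP.inner_notMem
  rw [List.tail_cons] at hN
  have hinP : ∀ v, v ∈ D.inner (a₀ :: (k₀ ++ s₁ :: (k₁ ++ s₂ :: (k₂ ++ s₃ :: k₃)))) ↔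
      v ∈ k₀.map D.tail ∨ v = D.tail s₁ ∨ v ∈ k₁.map D.tail ∨ v = D.tail s₂ ∨
        v ∈ k₂.map D.tail ∨ v = D.tail s₃ ∨ v ∈ k₃.map D.tail := by
    intro v
    rw [mem_inner_cons]
    simp only [List.map_append, List.map_cons, List.mem_append, List.mem_cons]
  obtain ⟨ha₀, hw⟩ := h.segP.isWalk
  obtain ⟨hw₀, hw1⟩ := isWalk_append_cons.1 hw
  obtain ⟨hw₁, hw2⟩ := isWalk_append_cons.1 hw1.2
  obtain ⟨hw₂, hw3⟩ := isWalk_append_cons.1 hw2.2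
  have hw₃ := hw3.2
  have hN₀ : ∀ a ∈ k₀, D.tail a ∉ N := fun a ha => hN a (by simp [ha])
  have hN₁ : ∀ a ∈ s₁ :: k₁, D.tail a ∉ N := fun a ha => hN a (by
    simp only [List.mem_append, List.mem_cons] at ha ⊢; clear * - ha; tauto)
  have hN₂ : ∀ a ∈ s₂ :: k₂, D.tail a ∉ N := fun a ha => hN a (by
    simp only [List.mem_append, List.mem_cons] at ha ⊢; clear * - ha; tauto)
  have hN₃ : ∀ a ∈ s₃ :: k₃, D.tail a ∉ N := fun a ha => hN a (by
    simp only [List.mem_append, List.mem_cons] at ha ⊢; clear * - ha; tauto)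
  -- the parts between the starts
  obtain ⟨hs₁F, i, hi⟩ := hs₁
  obtain ⟨hs₂F, j, hj⟩ := hs₂
  obtain ⟨hs₃F, l, hl⟩ := hs₃
  obtain ⟨c₀, m₀, w₀, rfl, hc₀, hm₀, -, hc₀Q, hm₀Q⟩ := h.exists_connector i hw₀ hi hk₀ hN₀
  obtain ⟨c₁, m₁, u', rfl, hc₁, hm₁, hu', hc₁Q, hm₁Q⟩ := h.exists_connector j hw₁ hj hk₁
    fun a ha => hN₁ a (List.mem_cons_of_mem _ ha)
  obtain ⟨c₂, m₂, w', rfl, hc₂, hm₂, hw', hc₂Q, hm₂Q⟩ := h.exists_connector l hw₂ hl hk₂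
    fun a ha => hN₂ a (by simp [ha])
  have hij : i ≠ j := h.side_ne (fun a ha => by
    simp only [List.tail_cons, List.mem_append, List.mem_cons] at ha ⊢
    clear * - ha
    tauto) hs₁F hi hc₁ hu' hc₁Q
  have hjl : j ≠ l := h.side_ne (fun a ha => by
    simp only [List.tail_cons, List.mem_append, List.mem_cons] at ha ⊢
    clear * - ha
    tauto) hs₂F hj hc₂ hw' hc₂Q
  obtain rfl : l = i := hbool i j l hij hjl
  have hsep : ∀ v, v ∈ D.inner (Q l) → v ∉ D.inner (Q j) := fun v h1 h2 => hij (h.disj _ _ v h1 h2)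
  -- the next vertex of `P` on the side of the second piece
  obtain ⟨c₃, l₃, w'', rfl, hc₃, hl₃, hw'', hc₃Q⟩ : ∃ c₃ l₃ w'', k₃ = c₃ ++ l₃ ∧
      D.IsWalk (D.head s₃) c₃ w'' ∧ D.IsWalk w'' l₃ y ∧ (w'' ∈ D.inner (Q j) ∨ w'' = y) ∧
      ∀ a ∈ c₃, D.tail a ∉ D.inner (Q j) := by
    by_cases hX : ∃ v ∈ D.head s₃ :: k₃.map D.head, v ∈ {v | ∃ i, v ∈ D.inner (Q i)}
    · obtain ⟨c₃, l₃, w'', rfl, h1, ⟨i', h2⟩, h3⟩ := hw₃.exists_first _ hX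
      obtain ⟨w, h4, h5⟩ := isWalk_append.1 hw₃
      obtain rfl := h1.end_unique h4
      have hc₃Q : ∀ a ∈ c₃, ∀ j, D.tail a ∉ D.inner (Q j) := fun a ha j hj => h3 a ha ⟨j, hj⟩
      have hne : l ≠ i' := h.side_ne (fun a ha => by
        simp only [List.tail_cons, List.mem_append, List.mem_cons] at ha ⊢
        clear * - ha
        tauto) hs₃F hl h1 h2 hc₃Q
      obtain rfl : i' = j := hbool j l i' hij.symm hne
      exact ⟨c₃, l₃, w'', rfl, h1, h5, Or.inl h2, fun a ha => hc₃Q a ha _⟩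
    · push Not at hX
      refine ⟨k₃, [], y, by simp, hw₃, rfl, Or.inr rfl, fun a ha haj => ?_⟩
      refine hX (D.tail a) ?_ ⟨j, haj⟩
      rw [hw₃.map_head_eq]
      simp only [List.mem_append]
      exact Or.inl (List.mem_map_of_mem ha)
  have hN₃' : ∀ a ∈ c₃ ++ l₃, D.tail a ∉ N := fun a ha => hN₃ a (List.mem_cons_of_mem _ ha)
  -- the order of the vertices
  have o_uw : D.OffPos N (D.tail s₁) (D.tail s₂) :=
    ⟨s₁ :: (c₁ ++ m₁), by simp, ⟨rfl, hw₁⟩, hN₁⟩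
  have o_uu' : D.OffPos N (D.tail s₁) u' :=
    ⟨s₁ :: c₁, by simp, ⟨rfl, hc₁⟩, fun a ha => hN₁ a (by
      simp only [List.mem_append, List.mem_cons] at ha ⊢; clear * - ha; tauto)⟩
  have o_u'w : D.Off N u' (D.tail s₂) := ⟨m₁, hm₁, fun a ha => hN₁ a (by simp [ha])⟩
  have o_ww' : D.OffPos N (D.tail s₂) w' :=
    ⟨s₂ :: c₂, by simp, ⟨rfl, hc₂⟩, fun a ha => hN₂ a (by
    simp only [List.mem_append, List.mem_cons] at ha ⊢; clear * - ha; tauto)⟩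
  have o_w'v : D.Off N w' (D.tail s₃) := ⟨m₂, hm₂, fun a ha => hN₂ a (by simp [ha])⟩
  have o_vw'' : D.OffPos N (D.tail s₃) w'' :=
    ⟨s₃ :: c₃, by simp, ⟨rfl, hc₃⟩, fun a ha => hN₃ a (by
    simp only [List.mem_append, List.mem_cons] at ha ⊢; clear * - ha; tauto)⟩
  have o_uw' : D.OffPos N (D.tail s₁) w' := o_uw.trans_off o_ww'.off
  have o_ww'' : D.OffPos N (D.tail s₂) w'' := o_ww'.trans_off (o_w'v.trans o_vw''.off)
  -- the opposite pieces
  obtain ⟨b, b₁, hQb, hb0, -, hbw, hb₁w⟩ := (h.segQ j).exists_split hu'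
  obtain ⟨q₀, q, q', hQq, hq₀, hq0, hqw⟩ := h.exists_between l hi (Or.inl hw') o_uw'
  obtain ⟨r₀, r, r', hQr, hr₀, hr0, hrw⟩ := h.exists_between j hj hw'' o_ww''
  have hbQ : ∀ a ∈ b.tail, D.tail a ∈ D.inner (Q j) := by
    intro a ha
    unfold inner
    rw [hQb, List.tail_append_of_ne_nil hb0]
    exact List.mem_map_of_mem (by simp [ha])
  have hqQ : ∀ a ∈ q, D.tail a ∈ D.inner (Q l) := by
    intro a ha
    unfold inner
    rw [hQq, List.tail_append_of_ne_nil hq₀]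
    exact List.mem_map_of_mem (by simp [ha])
  have hrQ : ∀ a ∈ r, D.tail a ∈ D.inner (Q j) := by
    intro a ha
    unfold inner
    rw [hQr, List.tail_append_of_ne_nil hr₀]
    exact List.mem_map_of_mem (by simp [ha])
  have hbN : ∀ a ∈ b.tail, D.tail a ∉ N := fun a ha => (h.segQ j).notMem (hbQ a ha)
  have hqN : ∀ a ∈ q, D.tail a ∉ N := fun a ha => (h.segQ l).notMem (hqQ a ha)
  have hrN : ∀ a ∈ r, D.tail a ∉ N := fun a ha => (h.segQ j).notMem (hrQ a ha)
  obtain ⟨b₀, b, rfl⟩ := List.exists_cons_of_ne_nil hb0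
  obtain ⟨q₁, q, rfl⟩ := List.exists_cons_of_ne_nil hq0
  obtain ⟨r₁, r, rfl⟩ := List.exists_cons_of_ne_nil hr0
  rw [List.tail_cons] at hbQ hbN
  have hq₁ : D.tail q₁ = D.tail s₁ := hqw.1
  have hr₁ : D.tail r₁ = D.tail s₂ := hrw.1
  have hφ₁ : ∀ v ∈ b.map D.tail, v ∈ D.inner (Q j) ∧ D.OffPos N v u' := by
    intro v hv
    refine ⟨?_, (hbw.2.off_of_mem hbN hv).2⟩
    obtain ⟨a, ha, rfl⟩ := List.mem_map.1 hv
    exact hbQ a ha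
  have hφ₂ : ∀ v ∈ q.map D.tail, v ∈ D.inner (Q l) ∧ D.OffPos N (D.tail s₁) v ∧
      D.OffPos N v w' := by
    intro v hv
    refine ⟨?_, hqw.offPos_of_mem_tail hqN hv, (hqw.off_of_mem hqN ?_).2⟩
    · obtain ⟨a, ha, rfl⟩ := List.mem_map.1 hv
      exact hqQ a (by simp [ha])
    · rw [List.map_cons]
      exact List.mem_cons_of_mem _ hv
  have hφ₃ : ∀ v ∈ r.map D.tail, v ∈ D.inner (Q j) ∧ D.OffPos N (D.tail s₂) v ∧
      D.OffPos N v w'' := by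
    intro v hv
    refine ⟨?_, hrw.offPos_of_mem_tail hrN hv, (hrw.off_of_mem hrN ?_).2⟩
    · obtain ⟨a, ha, rfl⟩ := List.mem_map.1 hv
      exact hrQ a (by simp [ha])
    · rw [List.map_cons]
      exact List.mem_cons_of_mem _ hv
  have hside : ∀ {m : List A} {i' : Bool}, (∀ a ∈ m, D.tail a ∈ D.inner (Q i')) →
      ∀ v ∈ m.map D.tail, v ∈ D.inner (Q i') := by
    intro m i' hm v hv
    obtain ⟨a, ha, rfl⟩ := List.mem_map.1 hv
    exact hm a ha
  have hoff : ∀ {m : List A} {i' : Bool}, (∀ a ∈ m, D.tail a ∉ D.inner (Q i')) →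
      ∀ v ∈ m.map D.tail, v ∉ D.inner (Q i') := by
    intro m i' hm v hv
    obtain ⟨a, ha, rfl⟩ := List.mem_map.1 hv
    exact hm a ha
  set R := a₀ :: (c₀ ++ m₀ ++ s₁ :: (c₁ ++ m₁ ++ s₂ :: (c₂ ++ m₂ ++ s₃ :: (c₃ ++ l₃)))) with hR
  -- the pieces are disjoint from `P`
  have f_m₁ : ∀ v, v ∈ m₁.map D.tail ∨ v = D.tail s₂ → D.Off N u' v := by
    rintro v (hv | rfl)
    · exact (hm₁.off_of_mem (fun a ha => hN₁ a (by simp [ha])) hv).1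
    · exact o_u'w
  have f_w' : ∀ v, v ∈ m₂.map D.tail ∨ v = D.tail s₃ ∨ v ∈ c₃.map D.tail ∨ v ∈ l₃.map D.tail →
      D.Off N w' v := by
    rintro v (hv | rfl | hv | hv)
    · exact (hm₂.off_of_mem (fun a ha => hN₂ a (by simp [ha])) hv).1
    · exact o_w'v
    · exact o_w'v.trans (hw3.off_of_mem hN₃
        (by rw [List.map_cons, List.map_append]; simp [hv])).1
    · exact o_w'v.trans (hw3.off_of_mem hN₃
        (by rw [List.map_cons, List.map_append]; simp [hv])).1
  have f_k₀ : ∀ v, v ∈ c₀.map D.tail ∨ v ∈ m₀.map D.tail → D.OffPos N v (D.tail s₁) := by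
    intro v hv
    refine (hw₀.off_of_mem hN₀ ?_).2
    rw [List.map_append, List.mem_append]
    exact hv
  have f_k₁ : ∀ v, v = D.tail s₁ ∨ v ∈ c₁.map D.tail ∨ v ∈ m₁.map D.tail →
      D.OffPos N v (D.tail s₂) := by
    intro v hv
    refine (IsWalk.off_of_mem (l := s₁ :: (c₁ ++ m₁)) ⟨rfl, hw₁⟩ hN₁ ?_).2
    simpa only [List.map_cons, List.map_append, List.mem_cons, List.mem_append] using hv
  have hinP : ∀ v, v ∈ D.inner R → (v ∈ c₀.map D.tail ∨ v ∈ m₀.map D.tail) ∨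
      (v = D.tail s₁ ∨ v ∈ c₁.map D.tail ∨ v ∈ m₁.map D.tail) ∨ v = D.tail s₂ ∨
      v ∈ c₂.map D.tail ∨ v ∈ m₂.map D.tail ∨ v = D.tail s₃ ∨ v ∈ c₃.map D.tail ∨
      v ∈ l₃.map D.tail := by
    intro v hv
    have := (hinP v).1 hv
    simp only [List.map_append, List.mem_append] at this
    clear * - this
    tauto
  have d₁ : ∀ v ∈ b.map D.tail, v ∉ D.inner R := by
    intro v hv hvP
    obtain ⟨hvj, hvu'⟩ := hφ₁ v hv
    rcases hinP v hvP with (h' | h') | (h' | h' | h') | h' | h' | h'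
    · exact hoff (fun a ha => hc₀Q a ha j) v h' hvj
    · exact hsep v (hside hm₀Q v h') hvj
    · exact hsep v (h' ▸ hi) hvj
    · exact hoff (fun a ha => hc₁Q a ha j) v h' hvj
    · exact h.not_offPos (f_m₁ v (Or.inl h')) hvu'
    · exact h.not_offPos (f_m₁ v (Or.inr h')) hvu'
    · exact hoff (fun a ha => hc₂Q a ha j) v h' hvj
    · exact h.not_offPos (o_u'w.trans (o_ww'.off.trans (f_w' v h'))) hvu'
  have d₂ : ∀ v ∈ q.map D.tail, v ∉ D.inner R := by
    intro v hv hvP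
    obtain ⟨hvl, huv, hvw'⟩ := hφ₂ v hv
    rcases hinP v hvP with h' | (h' | h' | h') | h' | h' | h'
    · exact h.not_offPos huv.off (f_k₀ v h')
    · subst h'
      exact h.not_offPos (Off.refl _ _) huv
    · exact hoff (fun a ha => hc₁Q a ha l) v h' hvl
    · exact hsep v hvl (hside hm₁Q v h')
    · exact hsep v hvl (h' ▸ hj)
    · exact hoff (fun a ha => hc₂Q a ha l) v h' hvl
    · exact h.not_offPos (f_w' v h') hvw'
  have d₃ : ∀ v ∈ r.map D.tail, v ∉ D.inner R := by
    intro v hv hvP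
    obtain ⟨hvj, hwv, hvw''⟩ := hφ₃ v hv
    rcases hinP v hvP with h' | h' | h' | h' | h' | h' | h' | h'
    · exact h.not_offPos hwv.off ((f_k₀ v h').trans_off o_uw.off)
    · exact h.not_offPos hwv.off (f_k₁ v h')
    · subst h'
      exact h.not_offPos (Off.refl _ _) hwv
    · exact hoff (fun a ha => hc₂Q a ha j) v h' hvj
    · exact hsep v (hside hm₂Q v h') hvj
    · exact hsep v (h' ▸ hl) hvj
    · exact hoff hc₃Q v h' hvj
    · exact h.not_offPos (hl₃.off_of_mem (fun a ha => hN₃' a (by simp [ha])) h').1 hvw''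
  -- the three replacements
  have hRinner : ∀ m : List A, (∀ a ∈ m, a ∈ R.tail) → ∀ v ∈ m.map D.tail, v ∈ D.inner R := by
    intro m hm v hv
    obtain ⟨a, ha, rfl⟩ := List.mem_map.1 hv
    exact List.mem_map_of_mem (hm a ha)
  have n₁ : ¬ D.HasCyc ((S \ D.inner R) \ {v | v ∈ b.map D.tail}) := by
    intro hc
    refine h.minimal (b₀ :: b ++ (m₁ ++ s₂ :: (c₂ ++ m₂ ++ s₃ :: (c₃ ++ l₃))))
      ⟨by simp, hbw.append (hm₁.append hw2), ?_⟩ ?_ (hc.mono ?_)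
    · intro a ha
      rw [List.cons_append, List.tail_cons, List.mem_append] at ha
      rcases ha with ha | ha
      · exact hbN a ha
      · exact hN a (by
          simp only [List.mem_append, List.mem_cons] at ha ⊢; clear * - ha; tauto)
    · rw [excess_append, excess_eq_zero fun a ha => h.Q_sub j a (by
        rw [hQb]; simp only [List.mem_append]; exact Or.inl ha)]
      simp only [hR, excess_append, excess_cons, if_neg hs₁F, if_neg hs₂F, if_neg hs₃F]
      omega
    · rintro v ⟨⟨hvS, hvR⟩, hvb⟩
      refine ⟨hvS, fun hv => ?_⟩
      rw [List.cons_append, mem_inner_cons, List.map_append, List.mem_append] at hv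
      rcases hv with hv | hv
      · exact hvb hv
      · exact hvR (hRinner _ (fun a ha => by
          simp only [hR, List.tail_cons, List.mem_append, List.mem_cons] at ha ⊢
          clear * - ha
          tauto) v hv)
  have n₂ : ¬ D.HasCyc ((S \ D.inner R) \ {v | v ∈ q.map D.tail} ∪
      {v | v ∈ (m₁ ++ [s₂]).map D.tail}) := by
    intro hc
    refine h.minimal (a₀ :: (c₀ ++ m₀) ++ (q₁ :: q ++ (m₂ ++ s₃ :: (c₃ ++ l₃))))
      ⟨by simp, ?_, ?_⟩ ?_ (hc.mono ?_)
    · exact IsWalk.append (w := D.tail s₁) ⟨ha₀, hw₀⟩ (hqw.append (hm₂.append hw3))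
    · intro a ha
      rw [List.cons_append, List.tail_cons] at ha
      rcases List.mem_append.1 ha with ha | ha
      · exact hN₀ a ha
      rcases List.mem_append.1 ha with ha | ha
      · exact hqN a ha
      · exact hN a (by
          simp only [List.mem_append, List.mem_cons] at ha ⊢; clear * - ha; tauto)
    · have h0 : excess F (q₁ :: q) = 0 := excess_eq_zero fun a ha => h.Q_sub l a (by
        rw [hQq, List.mem_append, List.mem_append]; exact Or.inr (Or.inl ha))
      rw [excess_append, excess_append, h0, hR]
      simp only [excess_append, excess_cons, if_neg hs₁F, if_neg hs₂F, if_neg hs₃F]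
      omega
    · intro v hv
      have hmem : ∀ v, v ∈ D.inner (a₀ :: (c₀ ++ m₀) ++ (q₁ :: q ++ (m₂ ++ s₃ :: (c₃ ++ l₃)))) →
          (v ∈ c₀.map D.tail ∨ v ∈ m₀.map D.tail) ∨ v = D.tail s₁ ∨ v ∈ q.map D.tail ∨
          (v ∈ m₂.map D.tail ∨ v = D.tail s₃ ∨ v ∈ c₃.map D.tail ∨ v ∈ l₃.map D.tail) := by
        intro v hv
        rw [List.cons_append, mem_inner_cons] at hv
        simp only [List.map_append, List.map_cons, List.mem_append, List.mem_cons, hq₁] at hv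
        clear * - hv
        tauto
      have hinR : ∀ a, a ∈ c₀ ∨ a ∈ m₀ ∨ a = s₁ ∨ a ∈ m₂ ∨ a = s₃ ∨ a ∈ c₃ ∨ a ∈ l₃ →
          a ∈ R.tail := fun a ha => by
        simp only [hR, List.tail_cons, List.mem_append, List.mem_cons]; clear * - ha; tauto
      rcases hv with ⟨⟨hvS, hvR⟩, hvq⟩ | hvZ
      · refine ⟨hvS, fun hv => ?_⟩
        rcases hmem v hv with (h' | h') | h' | h' | h' | h' | h' | h'
        · exact hvR (hRinner _ (fun a ha => hinR a (by clear * - ha; tauto)) v h')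
        · exact hvR (hRinner _ (fun a ha => hinR a (by clear * - ha; tauto)) v h')
        · exact hvR (hRinner [s₁] (fun a ha => hinR a (by
            rw [List.mem_singleton] at ha; clear * - ha; tauto)) v (by simp [h']))
        · exact hvq h'
        · exact hvR (hRinner _ (fun a ha => hinR a (by clear * - ha; tauto)) v h')
        · exact hvR (hRinner [s₃] (fun a ha => hinR a (by
            rw [List.mem_singleton] at ha; clear * - ha; tauto)) v (by simp [h']))
        · exact hvR (hRinner _ (fun a ha => hinR a (by clear * - ha; tauto)) v h')
        · exact hvR (hRinner _ (fun a ha => hinR a (by clear * - ha; tauto)) v h')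
      · have hvZ' : v ∈ m₁.map D.tail ∨ v = D.tail s₂ := by
          simpa only [Set.mem_ofPred_eq, List.map_append, List.map_cons, List.map_nil,
            List.mem_append, List.mem_singleton] using hvZ
        have hvj : v ∈ D.inner (Q j) := hvZ'.elim (hside hm₁Q v) (fun h' => h' ▸ hj)
        refine ⟨h.innerQ_sub j hvj, fun hv => ?_⟩
        have o1 : D.Off N v (D.tail s₂) := by
          rcases hvZ' with h' | rfl
          · exact (f_k₁ v (Or.inr (Or.inr h'))).off
          · exact Off.refl _ _
        rcases hmem v hv with h' | h' | h' | h'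
        · have o2 : D.OffPos N v (D.tail s₁) := f_k₀ v h'
          refine h.not_offPos ?_ o2
          rcases hvZ' with h'' | rfl
          · exact o_uu'.off.trans (f_m₁ v (Or.inl h''))
          · exact o_uw.off
        · exact hsep v (h' ▸ hi) hvj
        · exact hsep v (hφ₂ v h').1 hvj
        · exact h.not_offPos (f_w' v h') (o1.trans_pos o_ww')
  have n₃ : ¬ D.HasCyc ((S \ D.inner R) \ {v | v ∈ r.map D.tail}) := by
    intro hc
    refine h.minimal (a₀ :: (c₀ ++ m₀ ++ s₁ :: (c₁ ++ m₁)) ++ (r₁ :: r ++ l₃)) ⟨by simp, ?_, ?_⟩ ?_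
      (hc.mono ?_)
    · refine IsWalk.append (w := D.tail s₂) ⟨ha₀, hw₀.append ⟨rfl, hw₁⟩⟩ (hrw.append hl₃)
    · intro a ha
      rw [List.cons_append, List.tail_cons] at ha
      rcases List.mem_append.1 ha with ha | ha
      · exact hN a (by
          simp only [List.mem_append, List.mem_cons] at ha ⊢; clear * - ha; tauto)
      rcases List.mem_append.1 ha with ha | ha
      · exact hrN a ha
      · exact hN₃' a (List.mem_append_right _ ha)
    · have h0 : excess F (r₁ :: r) = 0 := excess_eq_zero fun a ha => h.Q_sub j a (by
        rw [hQr, List.mem_append, List.mem_append]; exact Or.inr (Or.inl ha))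
      rw [excess_append, excess_append, h0, hR]
      simp only [excess_append, excess_cons, if_neg hs₁F, if_neg hs₂F, if_neg hs₃F]
      omega
    · rintro v ⟨⟨hvS, hvR⟩, hvb⟩
      refine ⟨hvS, fun hv => ?_⟩
      rw [List.cons_append, mem_inner_cons, List.map_append, List.mem_append] at hv
      rcases hv with hv | hv
      · exact hvR (hRinner _ (fun a ha => by
          simp only [hR, List.tail_cons, List.mem_append, List.mem_cons] at ha ⊢
          clear * - ha
          tauto) v hv)
      rw [List.map_append, List.mem_append, List.map_cons, List.mem_cons] at hv
      rcases hv with (rfl | hv) | hv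
      · exact hvR (hr₁ ▸ hRinner [s₂] (fun a ha => by
          simp only [hR, List.tail_cons, List.mem_append, List.mem_cons] at ha ⊢
          clear * - ha
          tauto) _ (by simp))
      · exact hvb hv
      · exact hvR (hRinner _ (fun a ha => by
          simp only [hR, List.tail_cons, List.mem_append, List.mem_cons] at ha ⊢
          clear * - ha
          tauto) v hv)
  -- the last arc before `u'` on the side of the second piece
  rcases List.eq_nil_or_concat b with rfl | ⟨b', e, rfl⟩
  · apply n₁
    simpa using h.hasCyc
  refine n₂ (hasCyc_of_three_pieces (φ₁ := {v | v ∈ (b'.concat e).map D.tail})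
    (φ₃ := {v | v ∈ r.map D.tail}) (e := e) h.hasCyc n₁
    (fun hc => n₂ (hc.mono Set.subset_union_left)) n₃ ?_ ?_ ?_ ?_ ?_ ?_ ?_ ?_ ?_ ?_ ?_ ?_)
  · exact fun v hv => ⟨h.innerQ_sub j (hφ₁ v hv).1, d₁ v hv⟩
  · exact fun v hv => ⟨h.innerQ_sub l (hφ₂ v hv).1, d₂ v hv⟩
  · exact fun v hv => ⟨h.innerQ_sub j (hφ₃ v hv).1, d₃ v hv⟩
  · exact Set.disjoint_left.2 fun v hv hv' => hsep v (hφ₂ v hv).1 (hφ₁ v hv').1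
  · exact Set.disjoint_left.2 fun v hv hv' => hsep v (hφ₂ v hv).1 (hφ₃ v hv').1
  · refine Set.disjoint_left.2 fun v hv hv' => ?_
    exact h.not_offPos (o_u'w.trans (hφ₃ v hv').2.1.off) (hφ₁ v hv).2
  · refine Set.disjoint_left.2 fun v hv hv' => hv'.2 (hRinner _ (fun a ha => ?_) v hv)
    simp only [hR, List.tail_cons, List.mem_append, List.mem_cons, List.not_mem_nil] at ha ⊢
    clear * - ha
    tauto
  · exact hbw.2.connOn
  · exact hqw.2.connOn
  · have := (hm₁.append hrw).connOn
    convert this using 1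
    ext v
    simp only [Set.mem_union, Set.mem_ofPred_eq, List.map_append, List.map_cons, List.map_nil,
      List.mem_append, List.mem_cons, List.not_mem_nil, hr₁]
    clear * -
    tauto
  · simp
  · rw [List.concat_eq_append] at hbw
    rw [hbw.2.head_last]
    cases m₁ with
    | nil => simp [isWalk_nil.1 hm₁]
    | cons a m => simp [← hm₁.1]

end IsExtremal

end Multidigraph

/-! ### Few exceptional arcs suffice -/

namespace Multidigraph

variable {V A : Type*} {D : Multidigraph V A}

theorem IsDicycle.arc_eq {B : List A} (h : D.IsDicycle B) {a b : A} (ha : a ∈ B) (hb : b ∈ B)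
    (hab : D.tail a = D.tail b) : a = b :=
  List.inj_on_of_nodup_map h.2.1 ha hb hab

theorem IsDicycle.head_mem {B : List A} (h : D.IsDicycle B) {a : A} (ha : a ∈ B) :
    D.head a ∈ B.map D.tail := by
  obtain ⟨h0, -, u, hu⟩ := h.exists_isWalk
  rcases hu.head_mem' ha with h1 | h1
  · cases B with
    | nil => exact absurd rfl h0
    | cons b B => rw [h1, ← hu.1]; simp
  · exact h1

/-- A dicycle is cut at a transversal vertex `x` and at the next transversal vertex `y`. -/
theorem IsDicycle.exists_seg {Z : List A} (hZ : D.IsDicycle Z) {x : V}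
    (hx : x ∈ D.transversalVertices) :
    ∃ y Q R, y ∈ D.transversalVertices ∧ D.IsSeg D.transversalVertices x y Q ∧
      D.IsWalk y R x ∧ D.IsDicycle (Q ++ R) ∧ ∀ a, a ∈ Z ↔ a ∈ Q ++ R := by
  obtain ⟨a, l, l', rfl, ha, hdi, hw⟩ := hZ.exists_rotate (mem_transversalVertices_iff.1 hx Z hZ)
  have hX : ∃ v ∈ D.head a :: (l ++ l').map D.head, v ∈ D.transversalVertices :=
    ⟨x, by rw [hw.2.map_head_eq]; simp, hx⟩
  obtain ⟨p, R, y, hpR, h1, h2, h3⟩ := hw.2.exists_first _ hX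
  rw [hpR] at hw hdi
  obtain ⟨w, h4, h5⟩ := isWalk_append.1 hw.2
  obtain rfl := h1.end_unique h4
  refine ⟨y, a :: p, R, h2, ⟨by simp, ⟨ha, h1⟩, h3⟩, h5, hdi, fun b => ?_⟩
  rw [List.cons_append, ← hpR]
  simp only [List.mem_append, List.mem_cons]
  tauto

theorem mem_map_tail_of_isSeg {N : Set V} {x y : V} {P : List A} (h : D.IsSeg N x y P) {v : V} :
    v ∈ P.map D.tail ↔ v = x ∨ v ∈ D.inner P := by
  obtain ⟨a, p, rfl⟩ := List.exists_cons_of_ne_nil h.ne_nil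
  rw [List.map_cons, List.mem_cons, h.isWalk.1, mem_inner_cons]

/-- All segments that start at the same transversal vertex end at the same transversal vertex. -/
theorem IsSeg.end_unique {x y y' : V} {P Q R : List A} (hP : D.IsSeg D.transversalVertices x y P)
    (hQ : D.IsSeg D.transversalVertices x y' Q) (hR : D.IsWalk y' R x) (hQR : D.IsDicycle (Q ++ R))
    (hx : x ∈ D.transversalVertices) (hy : y ∈ D.transversalVertices)
    (hy' : y' ∈ D.transversalVertices) : y = y' := by
  by_cases hyx : y = x
  -- if `x` is the end, then `x` is the only transversal vertex
  · subst hyx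
    have := hP.isWalk.mem_of_closed hy' hP.ne_nil
    rw [mem_map_tail_of_isSeg hP] at this
    rcases this with h | h
    · exact h.symm
    · exact absurd hy' (hP.notMem h)
  · have hyR : y ∈ R.map D.tail := by
      have := mem_transversalVertices_iff.1 hy _ hQR
      rw [List.map_append, List.mem_append, mem_map_tail_of_isSeg hQ] at this
      rcases this with (h | h) | h
      · exact absurd h hyx
      · exact absurd hy (hQ.notMem h)
      · exact h
    by_contra hne
    obtain ⟨b, hb, rfl⟩ := List.mem_map.1 hyR
    obtain ⟨R₁, R₂, rfl⟩ := List.append_of_mem hb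
    obtain ⟨h1, h2⟩ := isWalk_append_cons.1 hR
    have h3 := (hP.isWalk.append h2).mem_of_closed hy' (by simp)
    rw [List.map_append, List.mem_append, mem_map_tail_of_isSeg hP] at h3
    have hn := hQR.exists_isWalk.2.1
    simp only [List.map_append] at hn
    rw [List.nodup_append, List.nodup_append] at hn
    rcases h3 with (h | h) | h
    · subst h
      refine hn.2.2 y' ?_ (D.tail b) (by simp) ?_
      · rw [mem_map_tail_of_isSeg hQ]; exact Or.inl rfl
      · have h4 := (h1.append h2)
        have := hQ.isWalk.mem_of_closed hy hQ.ne_nil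
        rw [mem_map_tail_of_isSeg hQ] at this
        rcases this with h | h
        · exact absurd h hyx
        · exact absurd hy (hQ.notMem h)
    · exact absurd hy' (hP.notMem h)
    · cases R₁ with
      | nil => exact hne (isWalk_nil.1 h1).symm
      | cons c R₁ => exact hn.2.1.2.2 (D.tail c) (by simp) y' h h1.1

/-- The inner vertices of a segment from `x` to `y` are not on the parts from `y` to `x` of
dicycles. -/
theorem IsSeg.inner_disjoint {x y : V} {P Q R : List A} (hP : D.IsSeg D.transversalVertices x y P)
    (hQ : D.IsSeg D.transversalVertices x y Q) (hR : D.IsWalk y R x) (hQR : D.IsDicycle (Q ++ R))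
    (hx : x ∈ D.transversalVertices) {v : V} (hv : v ∈ D.inner P) : v ∉ R.map D.tail := by
  intro hvR
  obtain ⟨p, q, rfl, hp0, hq0, hp, hq⟩ := hP.exists_split hv
  obtain ⟨b, hb, rfl⟩ := List.mem_map.1 hvR
  obtain ⟨R₁, R₂, rfl⟩ := List.append_of_mem hb
  obtain ⟨h1, h2⟩ := isWalk_append_cons.1 hR
  have h3 := (hq.append h1).mem_of_closed hx (by simp [hq0])
  rw [List.map_append, List.mem_append] at h3
  rcases h3 with h | h
  · obtain ⟨c, hc, hcx⟩ := List.mem_map.1 h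
    refine hP.inner_notMem c ?_ (hcx ▸ hx)
    rw [List.tail_append_of_ne_nil hp0]
    exact List.mem_append_right _ hc
  · have hn := hQR.exists_isWalk.2.1
    rw [List.map_append, List.nodup_append] at hn
    refine hn.2.2 x ?_ x ?_ rfl
    · rw [mem_map_tail_of_isSeg hQ]; exact Or.inl rfl
    · rw [List.map_append, List.mem_append]; exact Or.inl h

variable (D) in
/-- The vertices of the arc set `F`, if `F` is a union of dicycles. -/
def tailSet (F : Set A) : Set V := {v | ∃ a ∈ F, D.tail a = v}

/-- An arc of a dicycle that starts at a transversal vertex, or leaves the vertices of `F` without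
belonging to `F`. -/
def IsExit (D : Multidigraph V A) (F : Set A) (a : A) : Prop :=
  D.tail a ∈ D.transversalVertices ∨ (a ∉ F ∧ D.tail a ∈ D.tailSet F)

/-- The reference arc set: the union of two dicycles that meet only in transversal vertices. -/
structure IsReference (D : Multidigraph V A) (F : Set A) (Q₁ Q₂ : List A) : Prop where
  left : D.IsDicycle Q₁
  right : D.IsDicycle Q₂
  mem_iff : ∀ a, a ∈ F ↔ a ∈ Q₁ ∨ a ∈ Q₂
  meet : ∀ v ∈ Q₁.map D.tail, v ∈ Q₂.map D.tail → v ∈ D.transversalVertices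

theorem IsReference.functional {F : Set A} {Q₁ Q₂ : List A} (h : D.IsReference F Q₁ Q₂) {a b : A}
    (ha : a ∈ F) (hb : b ∈ F) (hab : D.tail a = D.tail b)
    (hT : D.tail a ∉ D.transversalVertices) : a = b := by
  rcases (h.mem_iff a).1 ha with ha | ha <;> rcases (h.mem_iff b).1 hb with hb | hb
  · exact h.left.arc_eq ha hb hab
  · exact absurd (h.meet _ (List.mem_map_of_mem ha) (hab ▸ List.mem_map_of_mem hb)) hT
  · exact absurd (h.meet _ (hab ▸ List.mem_map_of_mem hb) (List.mem_map_of_mem ha)) hT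
  · exact h.right.arc_eq ha hb hab

theorem IsReference.mem_tailSet {F : Set A} {Q₁ Q₂ : List A} (h : D.IsReference F Q₁ Q₂) {v : V} :
    v ∈ D.tailSet F ↔ v ∈ Q₁.map D.tail ∨ v ∈ Q₂.map D.tail := by
  simp only [tailSet, Set.mem_ofPred_eq, h.mem_iff, List.mem_map]
  constructor
  · rintro ⟨a, ha | ha, h⟩
    exacts [Or.inl ⟨a, ha, h⟩, Or.inr ⟨a, ha, h⟩]
  · rintro (⟨a, ha, h⟩ | ⟨a, ha, h⟩)
    exacts [⟨a, Or.inl ha, h⟩, ⟨a, Or.inr ha, h⟩]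

theorem IsReference.head_mem_tailSet {F : Set A} {Q₁ Q₂ : List A} (h : D.IsReference F Q₁ Q₂)
    {a : A} (ha : a ∈ F) : D.head a ∈ D.tailSet F := by
  rw [h.mem_tailSet]
  rcases (h.mem_iff a).1 ha with ha | ha
  exacts [Or.inl (h.left.head_mem ha), Or.inr (h.right.head_mem ha)]

variable (D) in
/-- A dicycle whose removal leaves a cycle. -/
def IsSolution (B : List A) : Prop := D.IsDicycle B ∧ D.HasCyc {v | v ∉ B.map D.tail}

open Classical in
/-- Among the solutions, one with the fewest arcs outside `F` has at most three exits between
consecutive transversal vertices. -/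
theorem IsReference.countP_isExit_le {F : Set A} {Q₁ Q₂ : List A} (h : D.IsReference F Q₁ Q₂)
    {a : A} {p B₂ : List A} (hB : D.IsSolution (a :: p ++ B₂))
    (hmin : ∀ B', D.IsSolution B' → excess F (a :: p ++ B₂) ≤ excess F B')
    (ha : D.tail a ∈ D.transversalVertices) (hp : ∀ b ∈ p, D.tail b ∉ D.transversalVertices)
    (hB₂ : ∀ b ∈ B₂.head?, D.tail b ∈ D.transversalVertices) :
    (a :: p).countP (fun b => decide (IsExit D F b)) ≤ 3 := by
  set x := D.tail a with hx
  have hw : D.IsWalk x (a :: p ++ B₂) x := hB.1.exists_isWalk.2.2.elim fun u hu => by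
    obtain rfl : x = u := hu.1
    exact hu
  obtain ⟨y, hPw, hB₂w⟩ := isWalk_append.1 hw
  have hy : y ∈ D.transversalVertices := by
    cases B₂ with
    | nil => rw [isWalk_nil.1 hB₂w]; exact ha
    | cons b B₂ => rw [← hB₂w.1]; exact hB₂ b rfl
  have hP : D.IsSeg D.transversalVertices x y (a :: p) := ⟨by simp, hPw, hp⟩
  obtain ⟨y₁, q₁, R₁, hy₁, hq₁, hR₁, hqR₁, hQ₁⟩ := h.left.exists_seg ha
  obtain ⟨y₂, q₂, R₂, hy₂, hq₂, hR₂, hqR₂, hQ₂⟩ := h.right.exists_seg ha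
  obtain rfl := hP.end_unique hq₁ hR₁ hqR₁ ha hy hy₁
  obtain rfl := hP.end_unique hq₂ hR₂ hqR₂ ha hy hy₂
  have hQtail : ∀ {q R Q : List A}, D.IsDicycle Q → (∀ a, a ∈ Q ↔ a ∈ q ++ R) →
      D.IsSeg D.transversalVertices x y q → D.IsWalk y R x → D.IsDicycle (q ++ R) →
      (∀ v ∈ D.inner q, v ∈ Q.map D.tail) ∧
      (∀ b ∈ Q, D.tail b ∈ D.inner q → b ∈ q) ∧
      ∀ v ∈ Q.map D.tail, v ∈ D.inner (a :: p) → v ∈ D.inner q := by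
    intro q R Q hQ hmem hq hR hqR
    refine ⟨fun v hv => ?_, fun b hb hbq => ?_, fun v hv hvP => ?_⟩
    · obtain ⟨b, hb, rfl⟩ := List.mem_map.1 hv
      exact List.mem_map_of_mem ((hmem b).2 (by simp [List.mem_of_mem_tail hb]))
    · obtain ⟨c, hc, hcb⟩ := List.mem_map.1 hbq
      have := hQ.arc_eq ((hmem c).2 (by simp [List.mem_of_mem_tail hc])) hb hcb
      exact this ▸ List.mem_of_mem_tail hc
    · obtain ⟨b, hb, rfl⟩ := List.mem_map.1 hv
      have := (hmem b).1 hb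
      rcases List.mem_append.1 this with hb | hb
      · rcases (mem_map_tail_of_isSeg hq).1 (List.mem_map_of_mem hb) with h | h
        · exact absurd (h ▸ ha) (hP.notMem hvP)
        · exact h
      · exact absurd (List.mem_map_of_mem hb) (hP.inner_disjoint hq hR hqR ha hvP)
  obtain ⟨i₁, j₁, t₁⟩ := hQtail h.left hQ₁ hq₁ hR₁ hqR₁
  obtain ⟨i₂, j₂, t₂⟩ := hQtail h.right hQ₂ hq₂ hR₂ hqR₂
  have hmeet : ∀ v ∈ D.inner q₁, v ∉ D.inner q₂ := fun v hv hv' =>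
    hq₁.notMem hv (h.meet v (i₁ v hv) (i₂ v hv'))
  have hcompl : ∀ P', D.IsSeg D.transversalVertices x y P' →
      {v | v ∉ (P' ++ B₂).map D.tail} = {v | v ∉ B₂.map D.tail ∧ v ≠ x} \ D.inner P' := by
    intro P' hP'
    ext v
    simp only [Set.mem_ofPred_eq, List.map_append, List.mem_append, mem_map_tail_of_isSeg hP',
      Set.mem_sdiff]
    tauto
  have hPB₂ : D.IsDicycle (a :: p ++ B₂) := hB.1
  have hext : D.IsExtremal D.transversalVertices F {v | v ∉ B₂.map D.tail ∧ v ≠ x} x y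
      (fun i => if i then q₂ else q₁) (a :: p) := by
    have hsub : ∀ q, D.IsSeg D.transversalVertices x y q →
        D.inner q ⊆ {v | v ∉ B₂.map D.tail ∧ v ≠ x} := fun q hq v hv =>
      ⟨hq.inner_disjoint hP hB₂w hPB₂ ha hv, fun h' => hq.notMem hv (h' ▸ ha)⟩
    refine ⟨?_, hy, ?_, hP, ?_, ?_, ?_, ?_, hsub _ hP, ?_, ?_⟩
    · intro u l hl h0
      obtain ⟨b, hb, hbx⟩ := List.mem_map.1 (hl.mem_of_closed ha h0)
      exact ⟨b, hb, hbx ▸ ha⟩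
    · rintro (_ | _)
      exacts [hq₁, hq₂]
    · rintro (_ | _) b hb
      · exact (h.mem_iff b).2 (Or.inl ((hQ₁ b).2 (List.mem_append_left _ hb)))
      · exact (h.mem_iff b).2 (Or.inr ((hQ₂ b).2 (List.mem_append_left _ hb)))
    · rintro (_ | _) b hb hbq
      · rcases (h.mem_iff b).1 hb with hb | hb
        · exact j₁ b hb hbq
        · exact absurd (h.meet _ (i₁ _ hbq) (List.mem_map_of_mem hb)) (hq₁.notMem hbq)
      · rcases (h.mem_iff b).1 hb with hb | hb
        · exact absurd (h.meet _ (List.mem_map_of_mem hb) (i₂ _ hbq)) (hq₂.notMem hbq)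
        · exact j₂ b hb hbq
    · rintro (_ | _) (_ | _) v hv hv'
      exacts [rfl, absurd hv' (hmeet v hv), absurd hv (hmeet v hv'), rfl]
    · rintro (_ | _)
      exacts [hsub _ hq₁, hsub _ hq₂]
    · rw [← hcompl _ hP]
      exact hB.2
    · intro P' hP' hlt hcyc
      rw [← hcompl _ hP'] at hcyc
      obtain ⟨b, P', rfl⟩ := List.exists_cons_of_ne_nil hP'.ne_nil
      have hdi : D.IsDicycle (b :: P' ++ B₂) := by
        refine IsWalk.isDicycle_of_once ha (hP'.isWalk.append hB₂w) fun hc => ?_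
        change x ∈ (P' ++ B₂).map D.tail at hc
        rw [List.map_append, List.mem_append] at hc
        rcases hc with hc | hc
        · exact hP'.notMem hc ha
        · have hn := hPB₂.exists_isWalk.2.1
          rw [List.map_append, List.nodup_append] at hn
          exact hn.2.2 x (by simp [hx]) x hc rfl
      have := hmin _ ⟨hdi, hcyc⟩
      rw [excess_append, excess_append] at this
      omega
  have hle := hext.countP_isStart_le
  rw [List.countP_cons]
  have hmono : p.countP (fun b => decide (IsExit D F b)) ≤
      p.countP (fun b => decide (IsExtremal.IsStart D F (fun i => if i then q₂ else q₁) b)) := by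
    refine List.countP_mono_left fun b hb hbe => ?_
    simp only [decide_eq_true_eq] at hbe ⊢
    have hbP : D.tail b ∈ D.inner (a :: p) := List.mem_map_of_mem hb
    rcases hbe with hbe | ⟨hbF, hbe⟩
    · exact absurd hbe (hp b hb)
    · refine ⟨hbF, ?_⟩
      rcases h.mem_tailSet.1 hbe with hbe | hbe
      · exact ⟨false, t₁ _ hbe hbP⟩
      · exact ⟨true, t₂ _ hbe hbP⟩
  rw [List.tail_cons] at hle
  split_ifs <;> omega

end Multidigraph

/-! ### Guessing the exits of a dicycle -/

/-- If each block of the list, from one element of `N` up to the next one, contains at most `c`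
elements of `p`, then the list contains at most `c` times as many elements of `p` as of `N`. -/
theorem List.countP_le_mul_of_blocks {α : Type*} (p N : α → Bool) (c : ℕ) {l : List α}
    (h0 : ∀ a ∈ l.head?, N a = true)
    (h : ∀ l₁ a q l₂, l = l₁ ++ (a :: q ++ l₂) → N a = true → (∀ b ∈ q, N b = false) →
      (∀ b ∈ l₂.head?, N b = true) → (a :: q).countP p ≤ c) :
    l.countP p ≤ c * l.countP N := by
  induction hl : l.length using Nat.strong_induction_on generalizing l with
  | _ n ih =>
    cases l with
    | nil => simp
    | cons a l =>
      have ha : N a = true := h0 a rfl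
      have heq : l = l.takeWhile (fun b => !N b) ++ l.dropWhile (fun b => !N b) :=
        List.takeWhile_append_dropWhile.symm
      set q := l.takeWhile (fun b => !N b)
      set l₂ := l.dropWhile (fun b => !N b) with hl₂
      have hq : ∀ b ∈ q, N b = false := fun b hb => by
        simpa using List.mem_takeWhile_imp hb
      have h2 : ∀ b ∈ l₂.head?, N b = true := by
        intro b hb
        have := List.head?_dropWhile_not (fun b => !N b) l
        rw [← hl₂, Option.mem_def.1 hb] at this
        simpa using this
      have h1 := h [] a q l₂ (by rw [List.nil_append, List.cons_append, ← heq]) ha hq h2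
      have h3 := ih l₂.length (by rw [← hl, heq]; simp) h2 (fun m₁ b r m₂ hm => by
        refine h (a :: q ++ m₁) b r m₂ ?_
        rw [List.append_assoc, ← hm, List.cons_append, ← heq]) rfl
      have h4 : (a :: l).countP p = (a :: q).countP p + l₂.countP p := by
        rw [← List.countP_append, List.cons_append, ← heq]
      have h5 : (a :: l).countP N = 1 + q.countP N + l₂.countP N := by
        rw [heq, List.countP_cons, List.countP_append]; simp [ha]; omega
      rw [h4, h5]
      nlinarith [Nat.zero_le (c * q.countP N)]

namespace Multidigraph

variable {V A : Type*} {D : Multidigraph V A}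

theorem IsSolution.rotate_append {l l' : List A} (h : D.IsSolution (l ++ l')) :
    D.IsSolution (l' ++ l) := by
  refine ⟨h.1.rotate_append, ?_⟩
  have : {v | v ∉ (l' ++ l).map D.tail} = {v | v ∉ (l ++ l').map D.tail} := by
    ext v
    simp only [Set.mem_ofPred_eq, List.map_append, List.mem_append]
    tauto
  rw [this]
  exact h.2

theorem excess_append_comm (F : Set A) (l l' : List A) :
    excess F (l ++ l') = excess F (l' ++ l) := by
  rw [excess_append, excess_append, Nat.add_comm]

open Classical in
/-- A solution with the fewest arcs outside `F` has at most three exits for each transversal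
vertex. -/
theorem IsReference.length_exits_le [Finite V] {F : Set A} {Q₁ Q₂ : List A}
    (h : D.IsReference F Q₁ Q₂) {B : List A} (hB : D.IsSolution B)
    (hmin : ∀ B', D.IsSolution B' → excess F B ≤ excess F B')
    (hhead : ∀ b ∈ B.head?, D.tail b ∈ D.transversalVertices) :
    (B.filter fun b => decide (IsExit D F b)).length ≤ 3 * D.transversalVertices.ncard := by
  rw [← List.countP_eq_length_filter]
  refine (List.countP_le_mul_of_blocks _ (fun b => decide (D.tail b ∈ D.transversalVertices)) 3
    (by simpa using hhead) ?_).trans (Nat.mul_le_mul_left 3 ?_)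
  · rintro l₁ a q l₂ rfl ha hq hl₂
    have hB' := hB.rotate_append
    rw [List.append_assoc] at hB'
    refine h.countP_isExit_le hB' ?_ (by simpa using ha) (by simpa using hq) ?_
    · intro B' h'
      rw [← List.append_assoc, ← excess_append_comm]
      exact hmin B' h'
    · intro b hb
      cases l₂ with
      | cons c l₂ => exact by simpa using hl₂ b hb
      | nil =>
        cases l₁ with
        | nil => simp at hb
        | cons c l₁ => exact hhead b hb
  · rw [List.countP_eq_length_filter, ← List.length_map (f := D.tail),
      ← List.toFinset_card_of_nodup (hB.1.2.1.sublist (List.filter_sublist.map _)),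
      ← Set.ncard_coe_finset]
    refine Set.ncard_le_ncard ?_ (Set.toFinite _)
    intro v hv
    simp only [List.coe_toFinset, Set.mem_ofPred_eq, List.mem_map, List.mem_filter,
      decide_eq_true_eq] at hv
    obtain ⟨a, ⟨-, ha⟩, rfl⟩ := hv
    exact ha

variable (D) in
/-- A path from `u` to `v` with all ends of arcs outside `N`. -/
def IsPathOff (N : Set V) (u v : V) (W : List A) : Prop :=
  D.IsWalk u W v ∧ (∀ a ∈ W, D.tail a ∉ N ∧ D.head a ∉ N) ∧ (W.map D.tail).Nodup

/-- If the graph outside `N` is a forest, then paths in it are unique. -/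
theorem IsPathOff.subset {N : Set V} (hN : ¬ D.HasCyc Nᶜ) {u v : V} {W W' : List A}
    (h : D.IsPathOff N u v W) (h' : D.IsPathOff N u v W') : W ⊆ W' := by
  intro a ha
  by_contra ha'
  apply hN
  have hv : v ∈ Nᶜ := by
    obtain ⟨W₀, b, rfl⟩ := List.eq_nil_or_concat' W |>.resolve_left (List.ne_nil_of_mem ha)
    rw [← h.1.head_last]
    exact (h.2.1 b (by simp)).2
  obtain ⟨p, q, rfl⟩ := List.append_of_mem ha
  obtain ⟨h1, h2⟩ := isWalk_append_cons.1 h.1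
  have hn := h.2.2
  simp only [List.map_append, List.map_cons] at hn
  rw [List.nodup_append, List.nodup_cons] at hn
  have hta := h.2.1 a ha
  refine hasCyc_of_uconn (e := a) hta.1 ?_
  have c1 : D.UConn Nᶜ {a}ᶜ (D.head a) v := by
    refine h2.2.uconn (fun b hb hba => hn.2.1.1 ?_) (fun b hb => (h.2.1 b (by simp [hb])).1) hv
    rw [← (show b = a from hba)]
    exact List.mem_map_of_mem hb
  have c2 : D.UConn Nᶜ {a}ᶜ u (D.tail a) := by
    refine h1.uconn (fun b hb hba => hn.2.2 _ (List.mem_map_of_mem hb) (D.tail a) (by simp) ?_)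
      (fun b hb => (h.2.1 b (by simp [hb])).1) hta.1
    rw [show b = a from hba]
  have c3 : D.UConn Nᶜ {a}ᶜ u v :=
    h'.1.uconn (fun b hb hba => ha' ((show b = a from hba) ▸ hb)) (fun b hb => (h'.2.1 b hb).1) hv
  exact (c1.trans c3.symm).trans c2

variable (D) in
/-- `Mk` consists, for each pair `(e, e')` of the guess `g`, of the arcs `e` and `e'`
and of the arcs of a path outside the vertices of `F` that leads from `e` to `e'`, if there is such
a path. -/
def IsMark (F : Set A) {K : ℕ} (g : Fin K → A × A) (Mk : Set A) : Prop :=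
  ∃ W : Fin K → List A,
    (∀ i, D.IsPathOff (D.tailSet F) (D.head (g i).1) (D.tail (g i).2) (W i) ∨
      (W i = [] ∧ ∀ W', ¬ D.IsPathOff (D.tailSet F) (D.head (g i).1) (D.tail (g i).2) W')) ∧
    ∀ a, a ∈ Mk ↔ ∃ i, a = (g i).1 ∨ a = (g i).2 ∨ a ∈ W i

variable (D) in
/-- The arcs of `F` are used where `Mk` does not prescribe another way. -/
def allowed (F Mk : Set A) : Set A := {a | a ∈ Mk ∨ (a ∈ F ∧ ∀ b ∈ Mk, D.tail b ≠ D.tail a)}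

variable (D) in
/-- After the arc `e`, the dicycle `B` follows the list `c` of arcs outside `N`, until it comes back
to `N` or ends. -/
def IsConnector (N : Set V) (B : List A) (e : A) (c : List A) : Prop :=
  ∃ l l', B = l ++ e :: (c ++ l') ∧ (∀ a ∈ c, D.tail a ∉ N) ∧ ∀ a ∈ l'.head?, D.tail a ∈ N

theorem exists_isConnector (N : Set V) {B : List A} {e : A} (he : e ∈ B) :
    ∃ c, D.IsConnector N B e c := by
  classical
  obtain ⟨l, l', rfl⟩ := List.append_of_mem he
  refine ⟨l'.takeWhile (fun a => D.tail a ∉ N), l, l'.dropWhile (fun a => D.tail a ∉ N),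
    by rw [List.takeWhile_append_dropWhile], fun a ha => by simpa using List.mem_takeWhile_imp ha,
    fun b hb => ?_⟩
  have := List.head?_dropWhile_not (fun a => decide (D.tail a ∉ N)) l'
  rw [Option.mem_def.1 hb] at this
  simpa using this

theorem IsConnector.unique {N : Set V} {B : List A} (hB : B.Nodup) {e : A} {c c' : List A}
    (h : D.IsConnector N B e c) (h' : D.IsConnector N B e c') : c = c' := by
  classical
  obtain ⟨l, l₁, rfl, h1, h2⟩ := h
  obtain ⟨m, m₁, heq, h3, h4⟩ := h'
  have hc : c ++ l₁ = c' ++ m₁ := by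
    have hB' := hB
    rw [List.nodup_append] at hB
    rw [heq, List.nodup_append] at hB'
    rcases List.append_eq_append_iff.1 heq with ⟨t, h5, h6⟩ | ⟨t, h5, h6⟩ <;> cases t with
    | nil => simpa [eq_comm] using h6
    | cons x t =>
      obtain ⟨rfl, -⟩ := List.cons_eq_cons.1 h6
      subst h5
      first
        | exact absurd rfl (hB'.2.2 e (by simp) e (by simp))
        | exact absurd rfl (hB.2.2 e (by simp) e (by simp))
  have key : ∀ c l : List A, (∀ a ∈ c, D.tail a ∉ N) → (∀ a ∈ l.head?, D.tail a ∈ N) →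
      (c ++ l).takeWhile (fun a => decide (D.tail a ∉ N)) = c := by
    intro c l hc hl
    rw [List.takeWhile_append_of_pos (by simpa using hc)]
    cases l with
    | nil => simp
    | cons a l => rw [List.takeWhile_cons_of_neg (by simpa using hl a rfl), List.append_nil]
  rw [← key c l₁ h1 h2, hc, key c' m₁ h3 h4]

/-- Every arc that starts outside `N` follows an arc that starts in `N`. -/
theorem exists_isConnector_of_notMem {N : Set V} {B : List A} (h0 : ∀ a ∈ B.head?, D.tail a ∈ N)
    {b : A} (hb : b ∈ B) (hbN : D.tail b ∉ N) :
    ∃ e c, D.IsConnector N B e c ∧ D.tail e ∈ N ∧ b ∈ c := by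
  classical
  obtain ⟨l, l', rfl⟩ := List.append_of_mem hb
  have : ∃ m e m', l = m ++ e :: m' ∧ D.tail e ∈ N ∧ ∀ a ∈ m', D.tail a ∉ N := by
    clear hb
    induction l using List.reverseRecOn with
    | nil => exact absurd (h0 b rfl) hbN
    | append_singleton l a ih =>
      by_cases ha : D.tail a ∈ N
      · exact ⟨l, a, [], rfl, ha, by simp⟩
      · have h0' : ∀ a ∈ (l ++ b :: l').head?, D.tail a ∈ N := by
          cases l with
          | nil => exact absurd (h0 a rfl) ha
          | cons c l => exact h0
        obtain ⟨m, e, m', rfl, h1, h2⟩ := ih h0'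
        refine ⟨m, e, m' ++ [a], by simp, h1, fun x hx => ?_⟩
        rcases List.mem_append.1 hx with hx | hx
        · exact h2 x hx
        · rw [List.mem_singleton.1 hx]; exact ha
  obtain ⟨m, e, m', rfl, he, hm'⟩ := this
  refine ⟨e, m' ++ b :: l'.takeWhile (fun a => D.tail a ∉ N),
    ⟨m, l'.dropWhile (fun a => D.tail a ∉ N), by simp, ?_, ?_⟩, he, by simp⟩
  · intro a ha
    rcases List.mem_append.1 ha with ha | ha
    · exact hm' a ha
    · rcases List.mem_cons.1 ha with rfl | ha
      · exact hbN
      · simpa using List.mem_takeWhile_imp ha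
  · intro x hx
    have := List.head?_dropWhile_not (fun a => decide (D.tail a ∉ N)) l'
    rw [Option.mem_def.1 hx] at this
    simpa using this

end Multidigraph

/-! ### A correct guess -/

namespace Multidigraph

variable {V A : Type*} {D : Multidigraph V A}

theorem IsDicycle.nodup {B : List A} (h : D.IsDicycle B) : B.Nodup := h.2.1.of_map _

/-- A connector of a closed walk leads back to `N`. -/
theorem IsConnector.isWalk {N : Set V} {B : List A} {r : V} (hB : D.IsWalk r B r) (hr : r ∈ N)
    {e : A} {c : List A} (h : D.IsConnector N B e c) :
    ∃ v ∈ N, D.IsWalk (D.head e) c v := by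
  obtain ⟨l, l', rfl, h1, h2⟩ := h
  obtain ⟨v, h3, h4⟩ := isWalk_append.1 (isWalk_append_cons.1 hB).2.2
  refine ⟨v, ?_, h3⟩
  cases l' with
  | nil => rw [isWalk_nil.1 h4]; exact hr
  | cons a l' => rw [← h4.1]; exact h2 a rfl

theorem IsConnector.mem {N : Set V} {B : List A} {e : A} {c : List A}
    (h : D.IsConnector N B e c) {b : A} (hb : b ∈ e :: c) : b ∈ B := by
  obtain ⟨l, l', rfl, -⟩ := h
  rw [← List.cons_append]
  exact List.mem_append_right _ (List.mem_append_left _ hb)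

/-- If the dicycle `B` has no more arcs outside `F` than any solution, then a connector of `B` is
determined by its first and its last arc: unless the connector is trivial, the graph outside the
vertices of `F` is a forest. -/
theorem IsReference.mem_connector_iff {F : Set A} {Q₁ Q₂ : List A} (h : D.IsReference F Q₁ Q₂)
    {B : List A} (hB : D.IsDicycle B) {r : V} (hw : D.IsWalk r B r) (hr : r ∈ D.tailSet F)
    (hmin : ∀ B', D.IsSolution B' → excess F B ≤ excess F B')
    {e : A} {c : List A} (hc : D.IsConnector (D.tailSet F) B e c) :
    ∃ e', ∀ W, (D.IsPathOff (D.tailSet F) (D.head e) (D.tail e') W ∨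
      (W = [] ∧ ∀ W', ¬ D.IsPathOff (D.tailSet F) (D.head e) (D.tail e') W')) →
      ∀ a, (a = e ∨ a = e' ∨ a ∈ W) ↔ a ∈ e :: c := by
  obtain ⟨v, hv, hcw⟩ := hc.isWalk hw hr
  obtain ⟨l, l', hBeq, h1, h2⟩ := id hc
  rcases List.eq_nil_or_concat' c with rfl | ⟨W₀, e', rfl⟩
  · refine ⟨e, fun W hW a => ?_⟩
    have : W = [] := by
      rcases hW with hW | hW
      · cases W with
        | nil => rfl
        | cons b W =>
          refine absurd ?_ (hW.2.1 b (by simp)).1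
          rw [hW.1.1, isWalk_nil.1 hcw]
          exact hv
      · exact hW.1
    subst this
    simp
  · refine ⟨e', fun W hW a => ?_⟩
    have hw₀ := (isWalk_append_cons.1 hcw).1
    have hp : D.IsPathOff (D.tailSet F) (D.head e) (D.tail e') W₀ := by
      refine ⟨hw₀, fun b hb => ⟨h1 b (by simp [hb]), ?_⟩, ?_⟩
      · rcases hw₀.head_mem' hb with h3 | h3
        · rw [h3]; exact h1 e' (by simp)
        · obtain ⟨b', hb', h4⟩ := List.mem_map.1 h3
          rw [← h4]; exact h1 b' (by simp [hb'])
      · refine hB.2.1.sublist (List.Sublist.map _ ?_)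
        rw [hBeq]
        refine List.Sublist.trans ?_ (List.sublist_append_right _ _)
        exact ((List.sublist_append_left _ _).trans (List.sublist_append_left _ _)).cons _
    have heF : e ∉ F := by
      intro heF
      have h3 := h.head_mem_tailSet heF
      cases W₀ with
      | nil => exact h1 e' (by simp) (by rw [← isWalk_nil.1 hw₀]; exact h3)
      | cons b W₀ => exact h1 b (by simp) (by rw [hw₀.1]; exact h3)
    -- otherwise `Q₁` would be a solution without arcs outside `F`, but `e` is such an arc of `B`
    have hcyc : ¬ D.HasCyc (D.tailSet F)ᶜ := by
      intro hcyc
      have h3 := hmin Q₁ ⟨h.left, HasCyc.mono (fun v (hv : v ∉ D.tailSet F) hv' =>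
        hv (h.mem_tailSet.2 (Or.inl hv'))) hcyc⟩
      rw [excess_eq_zero fun a ha => (h.mem_iff a).2 (Or.inl ha)] at h3
      have := excess_pos (F := F) (P := B) (a := e) (hc.mem (by simp)) heF
      omega
    have hW' : D.IsPathOff (D.tailSet F) (D.head e) (D.tail e') W := by
      rcases hW with hW | hW
      · exact hW
      · exact absurd hp (hW.2 _)
    have hiff : a ∈ W ↔ a ∈ W₀ :=
      ⟨fun ha => hW'.subset hcyc hp ha, fun ha => hp.subset hcyc hW' ha⟩
    simp only [hiff, List.mem_cons, List.mem_append, List.not_mem_nil, or_false]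
    tauto

/-- Every arc of a dicycle lies on a connector that starts with an exit, or it is an arc of `F`
that starts at a vertex where `F` leaves no choice. -/
theorem IsReference.mem_connector_of_exit {F : Set A} {Q₁ Q₂ : List A} (h : D.IsReference F Q₁ Q₂)
    {B : List A} {r : V} (hw : D.IsWalk r B r) (hr : r ∈ D.tailSet F)
    {b : A} (hb : b ∈ B) (hbF : ¬ (b ∈ F ∧ D.tail b ∉ D.transversalVertices)) :
    ∃ e c, D.IsConnector (D.tailSet F) B e c ∧ IsExit D F e ∧ b ∈ e :: c := by
  by_cases hbV : D.tail b ∈ D.tailSet F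
  · obtain ⟨c, hc⟩ := exists_isConnector (D := D) (D.tailSet F) hb
    refine ⟨b, c, hc, ?_, by simp⟩
    by_cases hT : D.tail b ∈ D.transversalVertices
    · exact Or.inl hT
    · exact Or.inr ⟨fun hF => hbF ⟨hF, hT⟩, hbV⟩
  · have h0 : ∀ a ∈ B.head?, D.tail a ∈ D.tailSet F := by
      intro a ha
      cases B with
      | nil => simp at ha
      | cons x B =>
        obtain rfl : x = a := by simpa using ha
        rw [hw.1]; exact hr
    obtain ⟨e, c, hc, he, hbc⟩ := exists_isConnector_of_notMem h0 hb hbV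
    refine ⟨e, c, hc, Or.inr ⟨fun heF => ?_, he⟩, by simp [hbc]⟩
    obtain ⟨v, hv, hcw⟩ := hc.isWalk hw hr
    obtain ⟨l, l', -, h1, -⟩ := hc
    cases c with
    | nil => simp at hbc
    | cons x c =>
      refine h1 x (by simp) ?_
      rw [hcw.1]
      exact h.head_mem_tailSet heF

/-- A dicycle all of whose arcs are allowed stays on the vertices of `B`, if the marked arcs
belong to `B` and contain all arcs of `B` except those that `F` forces. -/
theorem IsReference.subset_of_allowed {F Mk : Set A} {Q₁ Q₂ B B' : List A}
    (h : D.IsReference F Q₁ Q₂) (hB : D.IsDicycle B) (hB' : D.IsDicycle B')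
    {r : V} (hr : r ∈ D.transversalVertices)
    (hMk : ∀ a ∈ Mk, a ∈ B)
    (hF : ∀ a ∈ B, a ∉ Mk → a ∈ F ∧ D.tail a ∉ D.transversalVertices)
    (hall : ∀ a ∈ B', a ∈ D.allowed F Mk) : ∀ v ∈ B'.map D.tail, v ∈ B.map D.tail := by
  have hrB := mem_transversalVertices_iff.1 hr B hB
  have key : ∀ (l : List A) (u w : V), D.IsWalk u l w → u ∈ B.map D.tail → l ⊆ B' →
      ∀ v ∈ l.map D.tail, v ∈ B.map D.tail := by
    intro l
    induction l with
    | nil => simp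
    | cons a l ih =>
      rintro u w ⟨rfl, hl⟩ hu hsub v hv
      have hmem : a ∈ B := by
        obtain ⟨b, hb, hba⟩ := List.mem_map.1 hu
        rcases hall a (hsub (by simp)) with ha | ⟨ha, hb'⟩
        · exact hMk a ha
        · have h1 := hF b hb fun hbM => hb' b hbM hba
          exact h.functional h1.1 ha hba h1.2 ▸ hb
      rcases List.mem_cons.1 hv with rfl | hv
      · exact hu
      · exact ih _ _ hl (hB.head_mem hmem) (fun x hx => hsub (by simp [hx])) v hv
  obtain ⟨a, l, l', rfl, ha, -, hw⟩ :=
    hB'.exists_rotate (mem_transversalVertices_iff.1 hr B' hB')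
  intro v hv
  refine key _ r r hw hrB (fun x hx => ?_) v ?_
  · simp only [List.mem_cons, List.mem_append] at hx ⊢
    tauto
  · simp only [List.map_cons, List.map_append, List.mem_cons, List.mem_append] at hv ⊢
    tauto

theorem exists_isSolution_of_isDisjointPair {B : List A} {C : List (V × A)}
    (h : D.IsDisjointPair B C) : D.IsSolution B :=
  ⟨h.1, h.2.1.hasCyc fun _p hp hpB =>
    Set.disjoint_left.1 h.2.2 hpB (List.mem_map_of_mem hp)⟩

/-- If there is a disjoint pair and `F` is a minimal good arc set, then for some guess the marked
arcs lead to such a pair: an arbitrary dicycle among the allowed arcs leaves a cycle. -/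
theorem exists_guess [Finite V] [Finite A] {F : Set A} (hF : D.IsGood F)
    (hFmin : ∀ a ∈ F, ¬ D.IsGood (F \ {a})) {r : V} (hr : r ∈ D.transversalVertices) {k : ℕ}
    (hk : D.transversalVertices.ncard ≤ k) (hsol : ∃ B C, D.IsDisjointPair B C) :
    ∃ g : Fin (3 * k) → A × A, ∀ Mk, D.IsMark F g Mk →
      (∃ B, D.IsDicycle B ∧ ∀ a ∈ B, a ∈ D.allowed F Mk) ∧
      ∀ B, D.IsDicycle B → (∀ a ∈ B, a ∈ D.allowed F Mk) → D.HasCyc {v | v ∉ B.map D.tail} := by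
  classical
  obtain ⟨Q₁, Q₂, h1, h2, h3, h4⟩ := hF.eq_two_dicycles hFmin hr
  have href : D.IsReference F Q₁ Q₂ := ⟨h1, h2, h3, h4⟩
  have hrF : r ∈ D.tailSet F := href.mem_tailSet.2 (Or.inl (mem_transversalVertices_iff.1 hr _ h1))
  -- a solution with the fewest arcs outside `F`, rotated so that it starts at `r`
  obtain ⟨B, hB, hBmin, hw⟩ : ∃ B, D.IsSolution B ∧
      (∀ B', D.IsSolution B' → excess F B ≤ excess F B') ∧ D.IsWalk r B r := by
    have hex : ∃ t B, D.IsSolution B ∧ excess F B = t := by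
      obtain ⟨B, C, h⟩ := hsol
      exact ⟨_, B, exists_isSolution_of_isDisjointPair h, rfl⟩
    obtain ⟨B, hB, hBt⟩ := Nat.find_spec hex
    obtain ⟨a, l, l', rfl, ha, hdi, hw⟩ :=
      hB.1.exists_rotate (mem_transversalVertices_iff.1 hr B hB.1)
    have hrot := hB.rotate_append
    rw [List.cons_append] at hrot
    refine ⟨a :: (l ++ l'), hrot, fun B' hB' => ?_, hw⟩
    rw [← List.cons_append, ← excess_append_comm, hBt]
    exact Nat.find_min' hex ⟨B', hB', rfl⟩
  have hhead : ∀ b ∈ B.head?, D.tail b = r := by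
    intro b hb
    cases B with
    | nil => simp at hb
    | cons x B =>
      obtain rfl : x = b := by simpa using hb
      exact hw.1
  have hlen := (href.length_exits_le hB hBmin fun b hb => (hhead b hb).symm ▸ hr).trans
    (Nat.mul_le_mul_left 3 hk)
  set E := B.filter fun b => decide (IsExit D F b) with hE
  have hE0 : E ≠ [] := by
    obtain ⟨b, hb, hbr⟩ := List.mem_map.1 (mem_transversalVertices_iff.1 hr B hB.1)
    refine List.ne_nil_of_mem (a := b) ?_
    rw [hE, List.mem_filter]
    exact ⟨hb, decide_eq_true (Or.inl (hbr ▸ hr))⟩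
  have hEpos : 0 < E.length := List.length_pos_iff.2 hE0
  have hconn : ∀ e : A, ∃ c e', e ∈ B → D.IsConnector (D.tailSet F) B e c ∧
      ∀ W, (D.IsPathOff (D.tailSet F) (D.head e) (D.tail e') W ∨
      (W = [] ∧ ∀ W', ¬ D.IsPathOff (D.tailSet F) (D.head e) (D.tail e') W')) →
      ∀ a, (a = e ∨ a = e' ∨ a ∈ W) ↔ a ∈ e :: c := by
    intro e
    by_cases he : e ∈ B
    · obtain ⟨c, hc⟩ := exists_isConnector (D := D) (D.tailSet F) he
      obtain ⟨e', he'⟩ := href.mem_connector_iff hB.1 hw hrF hBmin hc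
      exact ⟨c, e', fun _ => ⟨hc, he'⟩⟩
    · exact ⟨[], e, fun h => absurd h he⟩
  choose c e' hc using hconn
  -- the guess enumerates the exits, with repetitions of the last one
  let s : Fin (3 * k) → A := fun i => E.get ⟨min i (E.length - 1), by omega⟩
  have hs : ∀ i, s i ∈ E := fun i => List.get_mem _ _
  have hs' : ∀ e ∈ E, ∃ i, s i = e := by
    intro e he
    obtain ⟨i, hi⟩ := List.get_of_mem he
    refine ⟨⟨i, by omega⟩, ?_⟩
    rw [← hi]
    simp only [s]
    congr 1
    ext
    simp only
    omega
  refine ⟨fun i => (s i, e' (s i)), ?_⟩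
  rintro Mk ⟨W, hW, hMk⟩
  have hsB : ∀ i, s i ∈ B := fun i => (List.mem_filter.1 (hs i)).1
  have hmem : ∀ a, a ∈ Mk ↔ ∃ e ∈ E, a ∈ e :: c e := by
    intro a
    rw [hMk]
    constructor
    · rintro ⟨i, hi⟩
      exact ⟨s i, hs i, ((hc _ (hsB i)).2 _ (hW i) a).1 hi⟩
    · rintro ⟨e, he, ha⟩
      obtain ⟨i, rfl⟩ := hs' e he
      exact ⟨i, ((hc _ (hsB i)).2 _ (hW i) a).2 ha⟩
  have hMB : ∀ a ∈ Mk, a ∈ B := by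
    intro a ha
    obtain ⟨e, he, ha⟩ := (hmem a).1 ha
    exact (hc e (List.mem_filter.1 he).1).1.mem ha
  have hBF : ∀ a ∈ B, a ∉ Mk → a ∈ F ∧ D.tail a ∉ D.transversalVertices := by
    intro a ha haM
    by_contra hcon
    obtain ⟨e, c', hc', he, hac⟩ := href.mem_connector_of_exit hw hrF ha hcon
    have heB : e ∈ B := hc'.mem (by simp)
    refine haM ((hmem a).2 ⟨e, List.mem_filter.2 ⟨heB, by simpa using he⟩, ?_⟩)
    rwa [(hc e heB).1.unique hB.1.nodup hc']
  refine ⟨⟨B, hB.1, fun a ha => ?_⟩, fun B' hB' hall => ?_⟩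
  · by_cases haM : a ∈ Mk
    · exact Or.inl haM
    · refine Or.inr ⟨(hBF a ha haM).1, fun b hb hba => haM ?_⟩
      exact hB.1.arc_eq (hMB b hb) ha hba ▸ hb
  · refine HasCyc.mono (fun v (hv : v ∉ B.map D.tail) hv' => ?_) hB.2
    exact hv (href.subset_of_allowed hB.1 hB' hr hMB hBF hall v hv')

end Multidigraph

/-! ### A language of programs with bounded loops -/

namespace RAM

/-- The state after the assignment of `v` to the variable `x`. -/
def State.setVar (s : State) (x v : ℕ) : State := ⟨Function.update s.var x v, s.arr⟩

/-- The state after the assignment of `v` to the entry `i` of the array `a`. -/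
def State.setArr (s : State) (a i v : ℕ) : State :=
  ⟨s.var, Function.update s.arr a (Function.update (s.arr a) i v)⟩

@[simp] theorem State.var_setVar (s : State) (x v y : ℕ) :
    (s.setVar x v).var y = if y = x then v else s.var y := by
  simp [setVar, Function.update_apply]

@[simp] theorem State.arr_setVar (s : State) (x v : ℕ) : (s.setVar x v).arr = s.arr := rfl

@[simp] theorem State.var_setArr (s : State) (a i v : ℕ) : (s.setArr a i v).var = s.var := rfl

@[simp] theorem State.arr_setArr (s : State) (a i v b : ℕ) :
    (s.setArr a i v).arr b = if b = a then Function.update (s.arr a) i v else s.arr b := by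
  by_cases h : b = a
  · subst h; simp [setArr]
  · simp [setArr, h]

attribute [simp] Exp.eval

/-- Programs whose loops run a variable `i` from `0` up to the value of a variable `b`. -/
inductive Cmd : Type
  | skip : Cmd
  | set (x : ℕ) (e : Exp) : Cmd
  | write (a : ℕ) (i e : Exp) : Cmd
  | seq (p q : Cmd) : Cmd
  | ite (e : Exp) (p q : Cmd) : Cmd
  | loop (i b : ℕ) (p : Cmd) : Cmd

namespace Cmd

/-- Sequential composition. -/
infixr:60 " ;; " => Cmd.seq

/-- The final state of a program. -/
def run : Cmd → State → State
  | skip, s => s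
  | set x e, s => s.setVar x (e.eval s)
  | write a i e, s => s.setArr a (i.eval s) (e.eval s)
  | seq p q, s => q.run (p.run s)
  | ite e p q, s => if e.eval s = 0 then q.run s else p.run s
  | loop i b p, s =>
      (fun s' => (p.run s').setVar i ((p.run s').var i + 1))^[s.var b] (s.setVar i 0)

@[simp] theorem run_skip (s : State) : skip.run s = s := rfl
@[simp] theorem run_set (x : ℕ) (e : Exp) (s : State) :
    (set x e).run s = s.setVar x (e.eval s) := rfl
@[simp] theorem run_write (a : ℕ) (i e : Exp) (s : State) :
    (write a i e).run s = s.setArr a (i.eval s) (e.eval s) := rfl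
@[simp] theorem run_seq (p q : Cmd) (s : State) : (p ;; q).run s = q.run (p.run s) := rfl
theorem run_ite (e : Exp) (p q : Cmd) (s : State) :
    (ite e p q).run s = if e.eval s = 0 then q.run s else p.run s := rfl
theorem run_ite_of_eq {e : Exp} {s : State} (h : e.eval s = 0) (p q : Cmd) :
    (ite e p q).run s = q.run s := if_pos h
theorem run_ite_of_ne {e : Exp} {s : State} (h : e.eval s ≠ 0) (p q : Cmd) :
    (ite e p q).run s = p.run s := if_neg h
theorem run_loop (i b : ℕ) (p : Cmd) (s : State) : (loop i b p).run s =
    (fun s' => (p.run s').setVar i ((p.run s').var i + 1))^[s.var b] (s.setVar i 0) := rfl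

/-- The variables that a program may change. -/
def wv : Cmd → List ℕ
  | skip => []
  | set x _ => [x]
  | write _ _ _ => []
  | seq p q => p.wv ++ q.wv
  | ite _ p q => p.wv ++ q.wv
  | loop i _ p => i :: p.wv

/-- The arrays that a program may change. -/
def wa : Cmd → List ℕ
  | skip => []
  | set _ _ => []
  | write a _ _ => [a]
  | seq p q => p.wa ++ q.wa
  | ite _ p q => p.wa ++ q.wa
  | loop _ _ p => p.wa

theorem run_var {x : ℕ} : ∀ {p : Cmd} (s : State), x ∉ p.wv → (p.run s).var x = s.var x
  | skip, _, _ => rfl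
  | set y e, s, h => by
      have : x ≠ y := by simpa [wv] using h
      simp [this]
  | write a i e, s, _ => by simp
  | seq p q, s, h => by
      simp only [wv, List.mem_append, not_or] at h
      rw [run_seq, run_var _ h.2, run_var _ h.1]
  | ite e p q, s, h => by
      simp only [wv, List.mem_append, not_or] at h
      rw [run_ite]
      split_ifs
      exacts [run_var _ h.2, run_var _ h.1]
  | loop i b p, s, h => by
      simp only [wv, List.mem_cons, not_or] at h
      rw [run_loop]
      have key : ∀ (n : ℕ) (s : State),
          ((fun s' => (p.run s').setVar i ((p.run s').var i + 1))^[n] s).var x = s.var x := by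
        intro n
        induction n with
        | zero => simp
        | succ n ih => intro s; rw [Function.iterate_succ_apply, ih]; simp [h.1, run_var s h.2]
      rw [key]
      simp [h.1]

theorem run_arr {x : ℕ} : ∀ {p : Cmd} (s : State), x ∉ p.wa → (p.run s).arr x = s.arr x
  | skip, _, _ => rfl
  | set y e, s, _ => by simp
  | write a i e, s, h => by
      have : x ≠ a := by simpa [wa] using h
      simp [this]
  | seq p q, s, h => by
      simp only [wa, List.mem_append, not_or] at h
      rw [run_seq, run_arr _ h.2, run_arr _ h.1]
  | ite e p q, s, h => by
      simp only [wa, List.mem_append, not_or] at h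
      rw [run_ite]
      split_ifs
      exacts [run_arr _ h.2, run_arr _ h.1]
  | loop i b p, s, h => by
      simp only [wa] at h
      rw [run_loop]
      have key : ∀ (n : ℕ) (s : State),
          ((fun s' => (p.run s').setVar i ((p.run s').var i + 1))^[n] s).arr x = s.arr x := by
        intro n
        induction n with
        | zero => simp
        | succ n ih => intro s; rw [Function.iterate_succ_apply, ih]; simp [run_arr s h]
      rw [key]
      simp

/-- The states `s` and `s'` differ only where the program `p` may change them. -/
def Frame (p : Cmd) (s s' : State) : Prop :=
  (∀ x, x ∉ p.wv → s'.var x = s.var x) ∧ ∀ a, a ∉ p.wa → s'.arr a = s.arr a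

theorem frame_run (p : Cmd) (s : State) : p.Frame s (p.run s) :=
  ⟨fun _ h => run_var s h, fun _ h => run_arr s h⟩

/-- The rule for loop invariants. -/
theorem loop_rule {i b : ℕ} {p : Cmd} {s : State} (Inv : ℕ → State → Prop)
    (hi : i ∉ p.wv) (h0 : Inv 0 (s.setVar i 0))
    (hs : ∀ j s', j < s.var b → s'.var i = j → (loop i b p).Frame s s' → Inv j s' →
      Inv (j + 1) ((p.run s').setVar i (j + 1))) :
    Inv (s.var b) ((loop i b p).run s) := by
  rw [run_loop]
  have key : ∀ n, n ≤ s.var b →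
      let s' := (fun s' => (p.run s').setVar i ((p.run s').var i + 1))^[n] (s.setVar i 0)
      s'.var i = n ∧ (loop i b p).Frame s s' ∧ Inv n s' := by
    intro n
    induction n with
    | zero =>
      intro _
      refine ⟨by simp, ⟨fun x hx => ?_, fun a _ => by simp⟩, h0⟩
      have : x ≠ i := fun h => hx (by simp [wv, h])
      simp [this]
    | succ n ih =>
      intro hn
      obtain ⟨h1, h2, h3⟩ := ih (by omega)
      simp only [Function.iterate_succ_apply'] at h1 h2 h3 ⊢
      set s' := (fun s' => (p.run s').setVar i ((p.run s').var i + 1))^[n] (s.setVar i 0)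
      have h4 : (p.run s').var i = n := by rw [run_var _ hi, h1]
      rw [h4]
      refine ⟨by simp, ⟨fun x hx => ?_, fun a ha => ?_⟩, hs n s' (by omega) h1 h2 h3⟩
      · have h5 : x ≠ i ∧ x ∉ p.wv := by simpa [wv] using hx
        simp [h5.1, run_var s' h5.2, h2.1 x hx]
      · have h5 : a ∉ p.wa := by simpa [wa] using ha
        simp [run_arr s' h5, h2.2 a ha]
  exact (key _ le_rfl).2.2

/-- The machine program of a program with bounded loops. -/
def compile : Cmd → Prog
  | skip => .skip
  | set x e => .set x e
  | write a i e => .write a i e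
  | seq p q => .seq p.compile q.compile
  | ite e p q => .ite e p.compile q.compile
  | loop i b p => .seq (.set i (.const 0))
      (.loop (.sub (.var b) (.var i)) (.seq p.compile (.set i (.add (.var i) (.const 1)))))

/-- The bounds of all loops are among the variables `1, …, 5`, which are never changed, and no loop
changes its own variable. -/
def ok : Cmd → Bool
  | skip => true
  | set x _ => x ∉ [1, 2, 3, 4, 5]
  | write _ _ _ => true
  | seq p q => p.ok && q.ok
  | ite _ p q => p.ok && q.ok
  | loop i b p => p.ok && decide (i ∉ p.wv) && decide (b ∈ [1, 2, 3, 4, 5]) &&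
      decide (i ∉ [1, 2, 3, 4, 5])

theorem notMem_wv_of_ok {x : ℕ} (hx : x ∈ [1, 2, 3, 4, 5]) : ∀ {p : Cmd}, p.ok = true → x ∉ p.wv
  | skip, _ => by simp [wv]
  | set y _, h => by
      have h' : y ∉ [1, 2, 3, 4, 5] := by simpa [ok] using h
      intro hc
      exact h' ((show x = y by simpa [wv] using hc) ▸ hx)
  | write _ _ _, _ => by simp [wv]
  | seq p q, h => by
      simp only [ok, Bool.and_eq_true] at h
      simp [wv, notMem_wv_of_ok hx h.1, notMem_wv_of_ok hx h.2]
  | ite _ p q, h => by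
      simp only [ok, Bool.and_eq_true] at h
      simp [wv, notMem_wv_of_ok hx h.1, notMem_wv_of_ok hx h.2]
  | loop i b p, h => by
      simp only [ok, Bool.and_eq_true, decide_eq_true_eq] at h
      simp only [wv, List.mem_cons, not_or]
      exact ⟨fun hc => h.2 (hc ▸ hx), notMem_wv_of_ok hx h.1.1.1⟩

open Polynomial in
/-- A bound on the number of steps, as a polynomial in a bound on the loop variables. -/
noncomputable def bound : Cmd → Polynomial ℕ
  | skip => 1
  | set _ e => C (e.cost + 1)
  | write _ i e => C (i.cost + e.cost + 1)
  | seq p q => p.bound + q.bound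
  | ite e p q => C (e.cost + 1) + p.bound + q.bound
  | loop _ _ p => 6 + X * (p.bound + 8)

/-- The machine program computes `run`, in time polynomial in a bound on the loop variables. -/
theorem exists_exec {N : ℕ} : ∀ {p : Cmd} (s : State), p.ok = true →
    (∀ x ∈ [1, 2, 3, 4, 5], s.var x ≤ N) →
    ∃ t ≤ p.bound.eval N, Exec p.compile s (p.run s) t
  | skip, s, _, _ => ⟨1, by simp [bound], Exec.skip s⟩
  | set x e, s, _, _ => ⟨e.cost + 1, by simp [bound], Exec.set x e s⟩
  | write a i e, s, _, _ => ⟨i.cost + e.cost + 1, by simp [bound], Exec.write a i e s⟩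
  | seq p q, s, h, hN => by
      simp only [ok, Bool.and_eq_true] at h
      obtain ⟨t, ht, hp⟩ := exists_exec s h.1 hN
      obtain ⟨t', ht', hq⟩ := exists_exec (p.run s) h.2 fun x hx => by
        rw [run_var s (notMem_wv_of_ok hx h.1)]; exact hN x hx
      exact ⟨t + t', by simp [bound]; omega, Exec.seq hp hq⟩
  | ite e p q, s, h, hN => by
      simp only [ok, Bool.and_eq_true] at h
      by_cases he : e.eval s = 0
      · obtain ⟨t, ht, hq⟩ := exists_exec s h.2 hN
        refine ⟨e.cost + 1 + t, by simp [bound]; omega, ?_⟩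
        rw [run_ite, if_pos he]
        exact Exec.ite_zero he hq
      · obtain ⟨t, ht, hp⟩ := exists_exec s h.1 hN
        refine ⟨e.cost + 1 + t, by simp [bound]; omega, ?_⟩
        rw [run_ite, if_neg he]
        exact Exec.ite_pos he hp
  | loop i b p, s, h, hN => by
      simp only [ok, Bool.and_eq_true, decide_eq_true_eq] at h
      obtain ⟨⟨⟨hp, hi⟩, hb⟩, hiR⟩ := h
      have hib : b ≠ i := fun hc => hiR (hc ▸ hb)
      have hbp := notMem_wv_of_ok hb hp
      set f : State → State := fun s' => (p.run s').setVar i ((p.run s').var i + 1)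
      have key : ∀ (n : ℕ) (s : State), (∀ x ∈ [1, 2, 3, 4, 5], s.var x ≤ N) →
          s.var b = s.var i + n → ∃ t ≤ n * (p.bound.eval N + 8) + 4,
            Exec (.loop (.sub (.var b) (.var i))
              (.seq p.compile (.set i (.add (.var i) (.const 1))))) s (f^[n] s) t := by
        intro n
        induction n with
        | zero =>
          intro s _ hs
          exact ⟨_, by simp [Exp.cost], Exec.loop_zero (by simp [hs])⟩
        | succ n ih =>
          intro s hN hs
          obtain ⟨t, ht, hexec⟩ := exists_exec s hp hN
          have hset := Exec.set i (.add (.var i) (.const 1)) (p.run s)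
          have hfi : (f s).var i = s.var i + 1 := by simp [f, run_var s hi]
          have hfx : ∀ x ∈ [1, 2, 3, 4, 5], (f s).var x = s.var x := fun x hx => by
            have : x ≠ i := fun hc => hiR (hc ▸ hx)
            simp only [f, State.var_setVar, this, if_false]
            exact run_var s (notMem_wv_of_ok hx hp)
          obtain ⟨t', ht', hexec'⟩ := ih (f s) (fun x hx => by rw [hfx x hx]; exact hN x hx)
            (by rw [hfi, hfx b hb]; omega)
          refine ⟨_, ?_, Exec.loop_pos (by simp [hs]) (Exec.seq hexec hset) hexec'⟩
          simp only [Exp.cost]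
          linarith
      obtain ⟨t, ht, hexec⟩ := key (s.var b) (s.setVar i 0) (fun x hx => by
        have : x ≠ i := fun hc => hiR (hc ▸ hx)
        simpa [this] using hN x hx) (by simp [hib])
      refine ⟨_, ?_, Exec.seq (Exec.set i (.const 0) s) hexec⟩
      simp only [Exp.cost, bound, Polynomial.eval_add, Polynomial.eval_mul, Polynomial.eval_X,
        Polynomial.eval_ofNat]
      nlinarith [Nat.mul_le_mul_right (p.bound.eval N + 8) (hN b hb)]

end Cmd

end RAM

/-! ### Search for a directed path -/

namespace RAM

namespace Exp

/-- Is nonzero if and only if `e` is zero. -/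
def not (e : Exp) : Exp := .sub (.const 1) e

/-- Is nonzero if and only if `e` and `f` are nonzero. -/
def and (e f : Exp) : Exp := not (.add (not e) (not f))

/-- Is nonzero if and only if `e` or `f` is nonzero. -/
def or (e f : Exp) : Exp := .add e f

/-- Is nonzero if and only if `e` and `f` are different. -/
def ne (e f : Exp) : Exp := .add (.sub e f) (.sub f e)

@[simp] theorem eval_not_eq_zero {e : Exp} {s : State} : e.not.eval s = 0 ↔ e.eval s ≠ 0 := by
  simp only [not, eval]; omega

@[simp] theorem eval_and_eq_zero {e f : Exp} {s : State} :
    (e.and f).eval s = 0 ↔ (e.eval s = 0 ∨ f.eval s = 0) := by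
  simp only [and, not, eval]; omega

@[simp] theorem eval_or_eq_zero {e f : Exp} {s : State} :
    (e.or f).eval s = 0 ↔ (e.eval s = 0 ∧ f.eval s = 0) := by
  simp only [or, eval]; omega

@[simp] theorem eval_ne_eq_zero {e f : Exp} {s : State} :
    (e.ne f).eval s = 0 ↔ e.eval s = f.eval s := by
  simp only [ne, eval]; omega

end Exp

open Multidigraph

/-- `l` is the list of edges that are chosen by `nx` on the way from `v` to `t`. -/
def Follows (G : Multidigraph ℕ ℕ) (nx : ℕ → ℕ) (t : ℕ) : ℕ → List ℕ → Prop
  | v, [] => v = t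
  | v, a :: l => v ≠ t ∧ a = nx v ∧ Follows G nx t (G.head a) l

/-- `dn v - 1` is the length of the path from `v` to `t` in which each vertex `w` is left by the
edge `nx w`; `dn v` is zero if no path is known. -/
def Ranked (G : Multidigraph ℕ ℕ) (E : Set ℕ) (n t : ℕ) (dn nx : ℕ → ℕ) : Prop :=
  dn t = 1 ∧ ∀ v < n, dn v ≠ 0 → v = t ∨ (nx v ∈ E ∧ G.tail (nx v) = v ∧
    dn v = dn (G.head (nx v)) + 1 ∧ dn (G.head (nx v)) ≠ 0)

/-- A path from `v` to `t` that uses edges of `E` and that is given by `nx`. -/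
structure IsNextPath (G : Multidigraph ℕ ℕ) (E : Set ℕ) (n t : ℕ) (nx : ℕ → ℕ) (v : ℕ)
    (l : List ℕ) : Prop where
  follows : Follows G nx t v l
  isWalk : G.IsWalk v l t
  mem : ∀ j ∈ l, j ∈ E
  nodup : (l.map G.tail).Nodup
  notMem : t ∉ l.map G.tail
  length_le : l.length ≤ n

theorem length_le_of_nodup {G : Multidigraph ℕ ℕ} {n : ℕ} {l : List ℕ}
    (hn : (l.map G.tail).Nodup) (hl : ∀ j ∈ l, G.tail j < n) : l.length ≤ n := by
  have := (List.subperm_of_subset hn (l₂ := List.range n) fun v hv => by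
    obtain ⟨j, hj, rfl⟩ := List.mem_map.1 hv
    exact List.mem_range.2 (hl j hj)).length_le
  simpa using this

/-- Since the rank decreases along the chosen edges, they form a path to the target. -/
theorem Ranked.exists_path {G : Multidigraph ℕ ℕ} {E : Set ℕ} {n t : ℕ} {dn nx : ℕ → ℕ}
    (h : Ranked G E n t dn nx) (hE : ∀ j ∈ E, G.tail j < n ∧ G.head j < n) {v : ℕ} (hv : v < n)
    (h0 : dn v ≠ 0) : ∃ l, IsNextPath G E n t nx v l := by
  suffices H : ∀ d v, v < n → dn v = d + 1 → ∃ l, Follows G nx t v l ∧ G.IsWalk v l t ∧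
      (∀ j ∈ l, j ∈ E) ∧ (l.map G.tail).Nodup ∧
      ∀ u ∈ l.map G.tail, u ≠ t ∧ dn u ≤ d + 1 by
    obtain ⟨l, h1, h2, h3, h4, h5⟩ := H (dn v - 1) v hv (by omega)
    exact ⟨l, h1, h2, h3, h4, fun hc => (h5 t hc).1 rfl,
      length_le_of_nodup h4 fun j hj => (hE j (h3 j hj)).1⟩
  intro d
  induction d with
  | zero =>
    intro v hv hd
    rcases h.2 v hv (by omega) with rfl | ⟨_, _, _, _⟩
    · exact ⟨[], rfl, rfl, by simp, by simp, by simp⟩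
    · omega
  | succ d ih =>
    intro v hv hd
    have hvt : v ≠ t := by
      rintro rfl
      have := h.1
      omega
    rcases h.2 v hv (by omega) with rfl | ⟨h1, h2, h3, h4⟩
    · exact absurd rfl hvt
    · obtain ⟨l, g1, g2, g3, g4, g5⟩ := ih (G.head (nx v)) (hE _ h1).2 (by omega)
      refine ⟨nx v :: l, ⟨hvt, rfl, g1⟩, ⟨h2, g2⟩, ?_, ?_, ?_⟩
      · intro j hj
        rcases List.mem_cons.1 hj with rfl | hj
        exacts [h1, g3 j hj]
      · rw [List.map_cons, List.nodup_cons, h2]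
        refine ⟨fun hc => ?_, g4⟩
        have := (g5 v hc).2
        omega
      · intro u hu
        rw [List.map_cons, List.mem_cons, h2] at hu
        rcases hu with rfl | hu
        · exact ⟨hvt, by omega⟩
        · have := g5 u hu
          exact ⟨this.1, by omega⟩

/-- The multidigraph given by the arrays `1` (tails) and `2` (heads). -/
def State.graph (s : State) : Multidigraph ℕ ℕ := ⟨s.arr 1, s.arr 2⟩

/-- The edges that may be used: those marked in the array `3`, except the edges in the
variables `7` and `8`. -/
def State.edges (s : State) : Set ℕ :=
  {j | j < s.var 3 ∧ s.arr 3 j ≠ 0 ∧ j ≠ s.var 7 ∧ j ≠ s.var 8}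

/-- All edges have their ends among the vertices `0, …, n - 1`. -/
def State.Valid (s : State) : Prop :=
  ∀ j < s.var 3, s.arr 1 j < s.var 1 ∧ s.arr 2 j < s.var 1

open Cmd in
/-- The edge number `var 10` is used to extend the set of vertices from which the target is known
to be reachable. -/
def searchStep : Cmd :=
  ite (.and (.and (.read 3 (.var 10)) (.and (.ne (.var 10) (.var 7)) (.ne (.var 10) (.var 8))))
      (.and (.not (.read 4 (.read 1 (.var 10)))) (.read 4 (.read 2 (.var 10)))))
    (write 4 (.read 1 (.var 10)) (.add (.read 4 (.read 2 (.var 10))) (.const 1)) ;;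
      write 5 (.read 1 (.var 10)) (.var 10))
    skip

open Cmd in
/-- Find the vertices from which the vertex `var 6` is reachable: the array `4` becomes nonzero
there, and the array `5` contains the next edge on a path. -/
def search : Cmd :=
  loop 9 1 (write 4 (.var 9) (.const 0)) ;; write 4 (.var 6) (.const 1) ;;
    loop 9 1 (loop 10 3 searchStep)

/-- A search step keeps all vertices that are known to reach the target, and adds the tail of its
edge if the head is known. -/
theorem searchStep_spec {s : State} (hlt : s.var 10 < s.var 3)
    (h : Ranked s.graph s.edges (s.var 1) (s.var 6) (s.arr 4) (s.arr 5)) :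
    let s' := searchStep.run s
    Ranked s.graph s.edges (s.var 1) (s.var 6) (s'.arr 4) (s'.arr 5) ∧
      (∀ v, s.arr 4 v ≠ 0 → s'.arr 4 v = s.arr 4 v) ∧
      (s.var 10 ∈ s.edges → s.arr 4 (s.arr 2 (s.var 10)) ≠ 0 →
        s'.arr 4 (s.arr 1 (s.var 10)) ≠ 0) := by
  intro s'
  by_cases hc : s.var 10 ∈ s.edges ∧ s.arr 4 (s.arr 1 (s.var 10)) = 0 ∧
      s.arr 4 (s.arr 2 (s.var 10)) ≠ 0
  · obtain ⟨hE, h1, h2⟩ := hc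
    have hne : s.arr 1 (s.var 10) ≠ s.arr 2 (s.var 10) := fun h' => h2 (h' ▸ h1)
    have h4 : s'.arr 4 = Function.update (s.arr 4) (s.arr 1 (s.var 10))
        (s.arr 4 (s.arr 2 (s.var 10)) + 1) := by
      simp [s', searchStep, Cmd.run_ite, h1, h2, hE.2.1, hE.2.2.1, hE.2.2.2]
    have h5 : s'.arr 5 = Function.update (s.arr 5) (s.arr 1 (s.var 10)) (s.var 10) := by
      simp [s', searchStep, Cmd.run_ite, h1, h2, hE.2.1, hE.2.2.1, hE.2.2.2]
    have hold : ∀ v, s.arr 4 v ≠ 0 → v ≠ s.arr 1 (s.var 10) := fun v hv' h' => hv' (h' ▸ h1)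
    rw [h4, h5]
    refine ⟨⟨?_, fun v hvn hv0 => ?_⟩, fun v hv' => ?_, fun _ _ => by simp⟩
    · rw [Function.update_of_ne (hold _ (by rw [h.1]; omega)), h.1]
    · by_cases hvT : v = s.arr 1 (s.var 10)
      · subst hvT
        refine Or.inr ?_
        simp only [Function.update_self, State.graph]
        rw [Function.update_of_ne hne.symm]
        exact ⟨hE, trivial, rfl, h2⟩
      · simp only [Function.update_of_ne hvT] at hv0 ⊢
        rcases h.2 v hvn hv0 with h' | ⟨h6, h7, h8, h9⟩
        · exact Or.inl h'
        · refine Or.inr ⟨h6, h7, ?_⟩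
          rw [Function.update_of_ne (hold _ h9)]
          exact ⟨h8, h9⟩
    · rw [Function.update_of_ne (hold v hv')]
  · have hs' : s' = s := by
      have : s.var 10 ∈ s.edges ↔ (s.arr 3 (s.var 10) ≠ 0 ∧ s.var 10 ≠ s.var 7 ∧
          s.var 10 ≠ s.var 8) := by simp [State.edges, hlt]
      rw [this] at hc
      simp only [s', searchStep, Cmd.run_ite, Exp.eval_and_eq_zero, Exp.eval_not_eq_zero,
        Exp.eval_ne_eq_zero, Exp.eval, Cmd.run_skip]
      rw [if_pos]
      tauto
    rw [hs']
    refine ⟨h, fun _ _ => rfl, fun hE h2 h1 => hc ⟨hE, h1, h2⟩⟩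

/-- After the search, exactly the vertices from which the target is reachable are marked: the round
number `r` reaches all vertices with a walk of length at most `r` to the target. -/
theorem search_spec {s : State} (hv : s.Valid) :
    let s' := search.run s
    Ranked s.graph s.edges (s.var 1) (s.var 6) (s'.arr 4) (s'.arr 5) ∧
      ∀ v < s.var 1, ∀ l, s.graph.IsWalk v l (s.var 6) → (∀ j ∈ l, j ∈ s.edges) →
        s'.arr 4 v ≠ 0 := by
  intro s'
  set s₁ := (Cmd.loop 9 1 (.write 4 (.var 9) (.const 0))).run s with hs₁
  have h1 : ∀ v < s.var 1, s₁.arr 4 v = 0 :=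
    Cmd.loop_rule (fun j s' => ∀ v < j, s'.arr 4 v = 0) (by decide) (by simp)
      (fun j s' _ hj _ hI v hv => by
        simp only [Cmd.run_write, State.arr_setVar, State.arr_setArr, Exp.eval, hj, if_true]
        rcases Nat.lt_succ_iff_lt_or_eq.1 hv with hv | rfl
        · rw [Function.update_of_ne (by omega)]
          exact hI v hv
        · simp)
  have hf₁ := Cmd.frame_run (Cmd.loop 9 1 (.write 4 (.var 9) (.const 0))) s
  rw [← hs₁] at hf₁
  set s₂ := (Cmd.write 4 (.var 6) (.const 1)).run s₁ with hs₂
  have h2 : s₂.arr 4 = Function.update (s₁.arr 4) (s.var 6) 1 := by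
    simp [hs₂, hf₁.1 6 (by decide)]
  have hf₂ : ∀ x, x ≠ 9 → s₂.var x = s.var x := fun x hx => by
    rw [← hf₁.1 x (by simpa [Cmd.wv] using hx)]; simp [hs₂]
  have hf₂' : ∀ x, x ≠ 4 → s₂.arr x = s.arr x := fun x hx => by
    rw [← hf₁.2 x (by simpa [Cmd.wa] using hx)]; simp [hs₂, hx]
  have hs' : s' = (Cmd.loop 9 1 (Cmd.loop 10 3 searchStep)).run s₂ := rfl
  have hagree : ∀ u : State, (Cmd.loop 9 1 (Cmd.loop 10 3 searchStep)).Frame s₂ u →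
      u.graph = s.graph ∧ u.edges = s.edges ∧ u.var 1 = s.var 1 ∧ u.var 6 = s.var 6 ∧
        u.var 3 = s.var 3 ∧ u.Valid := by
    intro u hu
    have e1 : u.arr 1 = s.arr 1 := by rw [hu.2 1 (by decide), hf₂' 1 (by decide)]
    have e2 : u.arr 2 = s.arr 2 := by rw [hu.2 2 (by decide), hf₂' 2 (by decide)]
    have e3 : u.arr 3 = s.arr 3 := by rw [hu.2 3 (by decide), hf₂' 3 (by decide)]
    have v1 : u.var 1 = s.var 1 := by rw [hu.1 1 (by decide), hf₂ 1 (by decide)]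
    have v3 : u.var 3 = s.var 3 := by rw [hu.1 3 (by decide), hf₂ 3 (by decide)]
    have v6 : u.var 6 = s.var 6 := by rw [hu.1 6 (by decide), hf₂ 6 (by decide)]
    have v7 : u.var 7 = s.var 7 := by rw [hu.1 7 (by decide), hf₂ 7 (by decide)]
    have v8 : u.var 8 = s.var 8 := by rw [hu.1 8 (by decide), hf₂ 8 (by decide)]
    refine ⟨by simp [State.graph, e1, e2], by simp [State.edges, e3, v3, v7, v8], v1, v6, v3, ?_⟩
    simpa [State.Valid, e1, e2, v1, v3] using hv
  have key := Cmd.loop_rule (i := 9) (b := 1) (p := Cmd.loop 10 3 searchStep) (s := s₂)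
    (fun r u => Ranked s.graph s.edges (s.var 1) (s.var 6) (u.arr 4) (u.arr 5) ∧
      ∀ v < s.var 1, ∀ l, s.graph.IsWalk v l (s.var 6) → (∀ j ∈ l, j ∈ s.edges) →
        l.length ≤ r → u.arr 4 v ≠ 0) (by decide) ?_ ?_
  · rw [← hs', hf₂ 1 (by decide)] at key
    refine ⟨key.1, fun v hvn l hl hE => ?_⟩
    obtain ⟨l', hl', hsub, hn⟩ := hl.exists_nodup
    refine key.2 v hvn l' hl' (fun j hj => hE j (hsub hj)) (length_le_of_nodup hn fun j hj => ?_)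
    exact (hv j (hE j (hsub hj)).1).1
  · refine ⟨⟨by simp [h2], fun v hvn hv0 => Or.inl ?_⟩, fun v hvn l hl _ hlen => ?_⟩
    · by_contra hc
      rw [State.arr_setVar, h2, Function.update_of_ne hc] at hv0
      exact hv0 (h1 v hvn)
    · obtain rfl := List.length_eq_zero_iff.1 (Nat.le_zero.1 hlen)
      obtain rfl := isWalk_nil.1 hl
      simp [h2]
  · intro r u hr hu9 hfu hI
    obtain ⟨g1, g2, g3, g4, g5, g6⟩ := hagree u hfu
    have inner := Cmd.loop_rule (i := 10) (b := 3) (p := searchStep) (s := u)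
      (fun j w => Ranked s.graph s.edges (s.var 1) (s.var 6) (w.arr 4) (w.arr 5) ∧
        (∀ v, u.arr 4 v ≠ 0 → w.arr 4 v ≠ 0) ∧
        ∀ j' < j, j' ∈ s.edges → u.arr 4 (s.arr 2 j') ≠ 0 → w.arr 4 (s.arr 1 j') ≠ 0)
      (by decide) ⟨hI.1, fun _ h => h, by simp⟩ (fun j w hj hw10 hfw hIw => by
        obtain ⟨q1, q2, q3⟩ := hIw
        have hfw' : (Cmd.loop 9 1 (Cmd.loop 10 3 searchStep)).Frame s₂ w :=
          ⟨fun x hx => by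
            rw [← hfu.1 x hx]
            exact hfw.1 x fun h => hx (List.mem_cons_of_mem _ h),
          fun a ha => by rw [← hfu.2 a ha]; exact hfw.2 a ha⟩
        obtain ⟨w1, w2, w3, w4, w5, w6⟩ := hagree w hfw'
        have e1 : w.arr 1 = s.arr 1 := congrArg Multidigraph.tail w1
        have e2 : w.arr 2 = s.arr 2 := congrArg Multidigraph.head w1
        obtain ⟨p1, p2, p3⟩ := searchStep_spec (by rw [hw10, w5, ← g5]; exact hj)
          (by rwa [w1, w2, w3, w4])
        rw [w1, w2, w3, w4] at p1
        rw [hw10, w2, e1, e2] at p3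
        refine ⟨p1, fun v hv' => ?_, fun j' hj' hjE hjd => ?_⟩
        · rw [State.arr_setVar, p2 v (q2 v hv')]; exact q2 v hv'
        · rw [State.arr_setVar]
          rcases Nat.lt_succ_iff_lt_or_eq.1 hj' with hj' | rfl
          · rw [p2 _ (q3 j' hj' hjE hjd)]; exact q3 j' hj' hjE hjd
          · exact p3 hjE (q2 _ hjd))
    obtain ⟨i1, i2, i3⟩ := inner
    refine ⟨i1, fun v hvn l hl hE hlen => ?_⟩
    rw [State.arr_setVar]
    cases l with
    | nil => exact i2 v (hI.2 v hvn [] hl hE (by simp))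
    | cons j l =>
      have hjE := hE j (by simp)
      rw [← hl.1]
      refine i3 j (by rw [g5]; exact hjE.1) hjE ?_
      exact hI.2 _ (hv j hjE.1).2 l hl.2 (fun i hi => hE i (by simp [hi]))
        (by simpa using hlen)

open Cmd in
/-- One step along the path given by the array `5`, from the vertex `var 11` towards the
vertex `var 6`. -/
def followStep : Cmd :=
  ite (.ne (.var 11) (.var 6))
    (write 16 (.var 12) (.read 5 (.var 11)) ;; set 12 (.add (.var 12) (.const 1)) ;;
      write 17 (.read 5 (.var 11)) (.const 1) ;; write 18 (.var 11) (.const 1) ;;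
      set 11 (.read 2 (.read 5 (.var 11))))
    skip

/-- Follow the path that is given by the array `5`, from the vertex `var 11` to the
vertex `var 6`. The edges are appended to the list in the array `16`, whose length is `var 12`, and
marked in the array `17`, and the vertices of the path, except the last one, are marked in the
array `18`. -/
def follow : Cmd := .loop 9 1 followStep

theorem follow_spec {s : State} {l : List ℕ}
    (hl : IsNextPath s.graph s.edges (s.var 1) (s.var 6) (s.arr 5) (s.var 11) l) :
    let s' := follow.run s
    s'.var 12 = s.var 12 + l.length ∧
      (∀ i, s'.arr 16 i = if s.var 12 ≤ i ∧ i < s.var 12 + l.length then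
        l.getD (i - s.var 12) 0 else s.arr 16 i) ∧
      (∀ a, s'.arr 17 a = if a ∈ l then 1 else s.arr 17 a) ∧
      ∀ v, s'.arr 18 v = if v ∈ l.map s.graph.tail then 1 else s.arr 18 v := by
  intro s'
  have key : ∀ (N : ℕ) (l : List ℕ) (u : State), l.length ≤ N →
      Follows u.graph (u.arr 5) (u.var 6) (u.var 11) l → u.graph.IsWalk (u.var 11) l (u.var 6) →
      let u' := (fun s' => (followStep.run s').setVar 9 ((followStep.run s').var 9 + 1))^[N] u
      u'.var 12 = u.var 12 + l.length ∧
      (∀ i, u'.arr 16 i = if u.var 12 ≤ i ∧ i < u.var 12 + l.length then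
        l.getD (i - u.var 12) 0 else u.arr 16 i) ∧
      (∀ a, u'.arr 17 a = if a ∈ l then 1 else u.arr 17 a) ∧
      ∀ v, u'.arr 18 v = if v ∈ l.map u.graph.tail then 1 else u.arr 18 v := by
    intro N
    induction N with
    | zero =>
      intro l u hN hF _
      obtain rfl := List.length_eq_zero_iff.1 (Nat.le_zero.1 hN)
      simp
    | succ N ih =>
      intro l u hN hF hW
      rw [Function.iterate_succ_apply]
      set u₁ := (followStep.run u).setVar 9 ((followStep.run u).var 9 + 1) with hu₁
      cases l with
      | nil =>
        have heq : u.var 11 = u.var 6 := hF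
        have h1 : u₁ = u.setVar 9 (u.var 9 + 1) := by
          simp [hu₁, followStep, Cmd.run_ite, heq]
        have := ih [] u₁ (by simp) (by rw [h1]; simpa [State.graph] using hF)
          (by rw [h1]; simpa [State.graph] using hW)
        rw [h1] at this ⊢
        simpa [State.graph] using this
      | cons a l =>
        obtain ⟨hne, ha, hF⟩ := hF
        have h12 : u₁.var 12 = u.var 12 + 1 := by
          simp [hu₁, followStep, Cmd.run_ite, hne]
        have h11 : u₁.var 11 = u.arr 2 a := by
          simp [hu₁, followStep, Cmd.run_ite, hne, ha]
        have h16 : u₁.arr 16 = Function.update (u.arr 16) (u.var 12) a := by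
          simp [hu₁, followStep, Cmd.run_ite, hne, ha]
        have h17 : u₁.arr 17 = Function.update (u.arr 17) a 1 := by
          simp [hu₁, followStep, Cmd.run_ite, hne, ha]
        have h18 : u₁.arr 18 = Function.update (u.arr 18) (u.var 11) 1 := by
          simp [hu₁, followStep, Cmd.run_ite, hne]
        have h6 : u₁.var 6 = u.var 6 := by
          simp [hu₁, followStep, Cmd.run_ite, hne]
        have h5 : u₁.arr 5 = u.arr 5 := by
          simp [hu₁, followStep, Cmd.run_ite, hne]
        have hG : u₁.graph = u.graph := by
          simp [hu₁, followStep, Cmd.run_ite, hne, State.graph]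
        obtain ⟨k1, k2, k3, k4⟩ := ih l u₁ (by simpa using hN)
          (by rw [hG, h5, h6, h11]; exact hF) (by rw [hG, h6, h11]; exact hW.2)
        refine ⟨by rw [k1, h12]; simp; omega, fun i => ?_, fun b => ?_, fun v => ?_⟩
        · rw [k2, h12, h16]
          rcases lt_trichotomy i (u.var 12) with hi | rfl | hi
          · rw [if_neg (by omega), if_neg (by omega), Function.update_of_ne (by omega)]
          · rw [if_neg (by omega), if_pos (by simp), Function.update_self]; simp
          · by_cases hi2 : i < u.var 12 + 1 + l.length
            · rw [if_pos ⟨by omega, hi2⟩, if_pos ⟨by omega, by simp; omega⟩]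
              rw [show i - u.var 12 = (i - (u.var 12 + 1)) + 1 by omega, List.getD_cons_succ]
            · rw [if_neg (by omega), if_neg (by simp; omega), Function.update_of_ne (by omega)]
        · rw [k3, h17, Function.update_apply]
          by_cases h1 : b ∈ l <;> by_cases h2 : b = a <;> simp [h1, h2]
        · rw [k4, h18, hG, Function.update_apply]
          have hta : u.graph.tail a = u.var 11 := hW.1
          by_cases h1 : v ∈ l.map u.graph.tail
          · rw [if_pos h1, if_pos (show v ∈ (a :: l).map u.graph.tail from
              List.mem_cons_of_mem _ h1)]
          · have h3 : v ∈ (a :: l).map u.graph.tail ↔ v = u.var 11 := by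
              rw [List.map_cons, List.mem_cons, hta]
              tauto
            simp only [if_neg h1, h3]
  have := key (s.var 1) l (s.setVar 9 0) hl.length_le (by simpa [State.graph] using hl.follows)
    (by simpa [State.graph] using hl.isWalk)
  have hs' : s' = (fun s' => (followStep.run s').setVar 9 ((followStep.run s').var 9 + 1))^[s.var 1]
    (s.setVar 9 0) := rfl
  rw [hs']
  simpa [State.graph] using this

end RAM

/-! ### Search for a cycle -/

namespace RAM

open Multidigraph

/-- The edges that are marked in the array `3`. -/
def State.marked (s : State) : Set ℕ := {j | j < s.var 3 ∧ s.arr 3 j ≠ 0}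

open Cmd in
/-- Test whether the edge `var 15` lies on a cycle that does not use the reverse edge. -/
def testEdge : Cmd :=
  set 7 (.var 15) ;; set 8 (.add (.var 15) (.var 2)) ;; set 6 (.read 1 (.var 15)) ;; search ;;
    ite (.read 4 (.read 2 (.var 15))) (set 13 (.const 1) ;; set 14 (.var 15)) skip

open Cmd in
/-- Find an edge that lies on a cycle, `var 14`; the variable `13` tells whether there is one. -/
def findCycle : Cmd :=
  set 13 (.const 0) ;;
    loop 15 2 (ite (.and (.not (.var 13)) (.read 3 (.var 15))) testEdge skip)

open Cmd in
/-- List the edges of the cycle that has been found in the array `16`, and mark its vertices in the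
array `18`. -/
def traceCycle : Cmd :=
  loop 9 1 (write 18 (.var 9) (.const 0)) ;;
    write 16 (.const 0) (.var 14) ;; set 12 (.const 1) ;; set 11 (.read 2 (.var 14)) ;; follow ;;
    write 18 (.var 6) (.const 1)

open Cmd in
/-- Find and list a cycle among the marked edges, if there is one. -/
def cycle : Cmd := findCycle ;; ite (.var 13) traceCycle skip

/-- The closed walk with first edge `a` and further edges `l` uses marked edges, no vertex twice,
and not both the edge `a` and an opposite edge. -/
structure IsMarkedCycle (G : Multidigraph ℕ ℕ) (E : Set ℕ) (m a : ℕ) (l : List ℕ) : Prop where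
  lt : a < m
  mem : a ∈ E
  isWalk : G.IsWalk (G.head a) l (G.tail a)
  mem' : ∀ j ∈ l, j ∈ E ∧ j ≠ a ∧ j ≠ a + m
  nodup : (l.map G.tail).Nodup
  notMem : G.tail a ∉ l.map G.tail

/-- The search, started in `s`, has found a cycle of marked edges: it consists of the edge `var 14`
of `u` and of the path given by the array `5` of `u`. -/
def FoundCycle (s u : State) : Prop :=
  u.var 13 = 1 ∧ u.var 14 < s.var 2 ∧ u.var 14 ∈ s.marked ∧ u.var 6 = s.arr 1 (u.var 14) ∧
    u.edges = {j | j ∈ s.marked ∧ j ≠ u.var 14 ∧ j ≠ u.var 14 + s.var 2} ∧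
    ∃ l, IsNextPath s.graph u.edges (s.var 1) (u.var 6) (u.arr 5) (s.arr 2 (u.var 14)) l

/-- There is no cycle of marked edges that contains the edge `a` and does not use the reverse
edge. -/
def NoCycle (s : State) (a : ℕ) : Prop :=
  a ∈ s.marked → ∀ l, s.graph.IsWalk (s.arr 2 a) l (s.arr 1 a) →
    ¬ ∀ j ∈ l, j ∈ s.marked ∧ j ≠ a ∧ j ≠ a + s.var 2

theorem testEdge_spec {s : State} (hv : s.Valid) (hm : s.var 2 ≤ s.var 3)
    (hlt : s.var 15 < s.var 2) (hmem : s.var 15 ∈ s.marked) (h0 : s.var 13 = 0) :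
    ((testEdge.run s).var 13 = 0 ∧ NoCycle s (s.var 15)) ∨ FoundCycle s (testEdge.run s) := by
  set s₁ := ((s.setVar 7 (s.var 15)).setVar 8 (s.var 15 + s.var 2)).setVar 6 (s.arr 1 (s.var 15))
    with hs₁
  set s₂ := search.run s₁ with hs₂
  have hrun : testEdge.run s = if s₂.arr 4 (s₂.arr 2 (s₂.var 15)) = 0 then s₂ else
      (s₂.setVar 13 1).setVar 14 (s₂.var 15) := by
    simp [testEdge, Cmd.run_ite, hs₂, hs₁]
  have hG : s₁.graph = s.graph := by simp [hs₁, State.graph]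
  have hE : s₁.edges = {j | j ∈ s.marked ∧ j ≠ s.var 15 ∧ j ≠ s.var 15 + s.var 2} := by
    ext j; simp [hs₁, State.edges, State.marked, and_assoc]
  have hv₁ : s₁.Valid := by simpa [hs₁, State.Valid] using hv
  have hf := Cmd.frame_run search s₁
  rw [← hs₂] at hf
  obtain ⟨h1, h2⟩ := search_spec hv₁
  rw [← hs₂] at h1 h2
  have v15 : s₂.var 15 = s.var 15 := by rw [hf.1 15 (by decide)]; simp [hs₁]
  have v13 : s₂.var 13 = 0 := by rw [hf.1 13 (by decide)]; simp [hs₁, h0]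
  have v6 : s₂.var 6 = s.arr 1 (s.var 15) := by rw [hf.1 6 (by decide)]; simp [hs₁]
  have v6' : s₁.var 6 = s.arr 1 (s.var 15) := by simp [hs₁]
  have v1 : s₁.var 1 = s.var 1 := by simp [hs₁]
  have a2 : s₂.arr 2 = s.arr 2 := by rw [hf.2 2 (by decide)]; simp [hs₁]
  have hHlt : s.arr 2 (s.var 15) < s.var 1 := (hv _ (by omega)).2
  rw [a2, v15] at hrun
  by_cases hc : s₂.arr 4 (s.arr 2 (s.var 15)) = 0
  · rw [if_pos hc] at hrun
    refine Or.inl ⟨by rw [hrun, v13], fun _ l hl hall => ?_⟩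
    rw [v1, v6', hG, hE] at h2
    exact h2 _ hHlt l hl hall hc
  · rw [if_neg hc] at hrun
    have hE₂ : s₂.edges = s₁.edges := by
      simp only [State.edges, hf.1 3 (by decide), hf.1 7 (by decide), hf.1 8 (by decide),
        hf.2 3 (by decide)]
    have hE₃ : (testEdge.run s).edges = s₁.edges := by
      rw [hrun, ← hE₂]; simp [State.edges]
    refine Or.inr ⟨by simp [hrun], by simp [hrun, hlt], by simp [hrun, hmem],
      by simp [hrun, v6], by rw [hE₃, hE]; simp [hrun], ?_⟩
    rw [hE₃, hrun]
    simp only [State.var_setVar, State.arr_setVar, if_true, v6]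
    rw [← hG, ← v6', ← v1]
    refine Ranked.exists_path h1 ?_ (by rw [v1]; exact hHlt) hc
    intro j hj
    exact hv₁ j hj.1

theorem findCycle_spec {s : State} (hv : s.Valid) (hm : s.var 2 ≤ s.var 3) :
    ((findCycle.run s).var 13 = 0 ∧ ∀ a < s.var 2, NoCycle s a) ∨
      FoundCycle s (findCycle.run s) := by
  set s₁ := s.setVar 13 0 with hs₁
  have hagree : ∀ u, (Cmd.loop 15 2 (.ite (.and (.not (.var 13)) (.read 3 (.var 15))) testEdge
      .skip)).Frame s₁ u → u.graph = s.graph ∧ u.marked = s.marked ∧ u.var 1 = s.var 1 ∧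
        u.var 2 = s.var 2 ∧ u.var 3 = s.var 3 ∧ u.Valid := by
    intro u hu
    have e1 : u.arr 1 = s.arr 1 := by rw [hu.2 1 (by decide)]; simp [hs₁]
    have e2 : u.arr 2 = s.arr 2 := by rw [hu.2 2 (by decide)]; simp [hs₁]
    have e3 : u.arr 3 = s.arr 3 := by rw [hu.2 3 (by decide)]; simp [hs₁]
    have v1 : u.var 1 = s.var 1 := by rw [hu.1 1 (by decide)]; simp [hs₁]
    have v2 : u.var 2 = s.var 2 := by rw [hu.1 2 (by decide)]; simp [hs₁]
    have v3 : u.var 3 = s.var 3 := by rw [hu.1 3 (by decide)]; simp [hs₁]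
    refine ⟨by simp [State.graph, e1, e2], by simp [State.marked, e3, v3], v1, v2, v3, ?_⟩
    simpa [State.Valid, e1, e2, v1, v3] using hv
  have key := Cmd.loop_rule (i := 15) (b := 2) (s := s₁)
    (p := .ite (.and (.not (.var 13)) (.read 3 (.var 15))) testEdge .skip)
    (fun j u => (u.var 13 = 0 ∧ ∀ a < j, NoCycle s a) ∨ FoundCycle s u) (by decide)
    (Or.inl ⟨by simp [hs₁], by simp⟩) ?_
  · have h2 : s₁.var 2 = s.var 2 := by simp [hs₁]
    rw [h2] at key
    exact key
  · intro j u hj hu15 hfu hI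
    obtain ⟨g1, g2, g3, g4, g5, g6⟩ := hagree u hfu
    have hj' : j < s.var 2 := by simpa [hs₁] using hj
    have a1 : u.arr 1 = s.arr 1 := congrArg Multidigraph.tail g1
    have a2 : u.arr 2 = s.arr 2 := congrArg Multidigraph.head g1
    have hset : ∀ w : State, FoundCycle s w → FoundCycle s (w.setVar 15 (j + 1)) := by
      intro w hw
      simpa [FoundCycle, State.edges] using hw
    have hno : ∀ a, NoCycle u a ↔ NoCycle s a := fun a => by
      simp only [NoCycle, g1, g2, g4, a1, a2]
    have hfo : ∀ w, FoundCycle u w ↔ FoundCycle s w := fun w => by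
      simp only [FoundCycle, g1, g2, g3, g4, a1, a2]
    rcases hI with ⟨hI0, hIn⟩ | hI
    · by_cases hjm : j ∈ s.marked
      · have hrun : (Cmd.ite (.and (.not (.var 13)) (.read 3 (.var 15))) testEdge .skip).run u =
            testEdge.run u := by
          rw [Cmd.run_ite, if_neg]
          have := g2 ▸ hjm
          simp [hI0, hu15, this.2]
        rw [hrun]
        rcases testEdge_spec g6 (by omega) (by omega) (by rw [hu15, g2]; exact hjm) hI0 with
          ⟨h1, h2⟩ | h
        · refine Or.inl ⟨by simp [h1], fun a ha => ?_⟩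
          rcases Nat.lt_succ_iff_lt_or_eq.1 ha with ha | rfl
          · exact hIn a ha
          · rw [hu15] at h2
            exact (hno _).1 h2
        · exact Or.inr (hset _ ((hfo _).1 h))
      · have hrun : (Cmd.ite (.and (.not (.var 13)) (.read 3 (.var 15))) testEdge .skip).run u =
            u := by
          rw [Cmd.run_ite, if_pos]
          · rfl
          · have : j ∉ u.marked := by rwa [g2]
            simp [hI0, hu15]
            by_contra hc
            exact this ⟨by omega, hc⟩
        rw [hrun]
        refine Or.inl ⟨by simp [hI0], fun a ha => ?_⟩
        rcases Nat.lt_succ_iff_lt_or_eq.1 ha with ha | rfl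
        · exact hIn a ha
        · exact fun hc => absurd hc hjm
    · have hrun : (Cmd.ite (.and (.not (.var 13)) (.read 3 (.var 15))) testEdge .skip).run u =
          u := by
        rw [Cmd.run_ite, if_pos]
        · rfl
        · simp [hI.1]
      rw [hrun]
      exact Or.inr (hset _ hI)

/-- The array `a` begins with the list `l`. -/
def State.Lists (s : State) (a : ℕ) (l : List ℕ) : Prop := ∀ i < l.length, s.arr a i = l.getD i 0

theorem clear_spec (s : State) (a : ℕ) :
    ∀ v < s.var 1, ((Cmd.loop 9 1 (.write a (.var 9) (.const 0))).run s).arr a v = 0 :=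
  Cmd.loop_rule (fun j s' => ∀ v < j, s'.arr a v = 0) (by simp [Cmd.wv]) (by simp)
    (fun j s' _ hj _ hI v hv => by
      simp only [Cmd.run_write, State.arr_setVar, State.arr_setArr, Exp.eval, hj, if_true]
      rcases Nat.lt_succ_iff_lt_or_eq.1 hv with hv | rfl
      · rw [Function.update_of_ne (by omega)]
        exact hI v hv
      · simp)

/-- Either there is no cycle of marked edges, or one is listed in the array `16`. -/
theorem cycle_spec {s : State} (hv : s.Valid) (hm : s.var 2 ≤ s.var 3) :
    let s' := cycle.run s
    (s'.var 13 = 0 ∧ ∀ a < s.var 2, NoCycle s a) ∨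
      (s'.var 13 = 1 ∧ ∃ a l, IsMarkedCycle s.graph s.marked (s.var 2) a l ∧
        s'.var 12 = (a :: l).length ∧ s'.Lists 16 (a :: l) ∧
        ∀ v < s.var 1, s'.arr 18 v ≠ 0 ↔ v ∈ (a :: l).map s.graph.tail) := by
  intro s'
  set s₁ := findCycle.run s with hs₁
  have hrun : s' = if s₁.var 13 = 0 then s₁ else traceCycle.run s₁ := by
    rfl
  rcases findCycle_spec hv hm with ⟨h0, h1⟩ | ⟨h0, h1, h2, h3, h4, l, hl⟩
  · rw [if_pos h0] at hrun
    rw [hrun]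
    exact Or.inl ⟨h0, h1⟩
  · rw [← hs₁] at h0 h1 h2 h3 h4 hl
    rw [if_neg (by rw [h0]; decide)] at hrun
    have hf₁ := Cmd.frame_run findCycle s
    rw [← hs₁] at hf₁
    set s₂ := (Cmd.loop 9 1 (.write 18 (.var 9) (.const 0))).run s₁ with hs₂
    have hf₂ := Cmd.frame_run (Cmd.loop 9 1 (.write 18 (.var 9) (.const 0))) s₁
    rw [← hs₂] at hf₂
    set s₃ := ((s₂.setArr 16 0 (s₂.var 14)).setVar 12 1).setVar 11 (s₂.arr 2 (s₂.var 14)) with hs₃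
    have v1 : s₃.var 1 = s.var 1 := by
      simp [hs₃, hf₂.1 1 (by decide), hf₁.1 1 (by decide)]
    have v6 : s₃.var 6 = s.arr 1 (s₁.var 14) := by
      simp [hs₃, hf₂.1 6 (by decide), h3]
    have v11 : s₃.var 11 = s.arr 2 (s₁.var 14) := by
      simp [hs₃, hf₂.1 14 (by decide), hf₂.2 2 (by decide), hf₁.2 2 (by decide)]
    have v12 : s₃.var 12 = 1 := by simp [hs₃]
    have a5 : s₃.arr 5 = s₁.arr 5 := by simp [hs₃, hf₂.2 5 (by decide)]
    have a16 : s₃.arr 16 0 = s₁.var 14 := by simp [hs₃, hf₂.1 14 (by decide)]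
    have a18 : ∀ v < s.var 1, s₃.arr 18 v = 0 := by
      intro v hv
      have := clear_spec s₁ 18 v (by rw [hf₁.1 1 (by decide)]; exact hv)
      simpa [hs₃, hs₂] using this
    have g3 : s₃.graph = s.graph := by
      simp [State.graph, hs₃, hf₂.2 1 (by decide), hf₂.2 2 (by decide), hf₁.2 1 (by decide),
        hf₁.2 2 (by decide)]
    have e3 : s₃.edges = s₁.edges := by
      simp [State.edges, hs₃, hf₂.1 3 (by decide), hf₂.1 7 (by decide), hf₂.1 8 (by decide),
        hf₂.2 3 (by decide)]
    have hrun' : s' = (follow.run s₃).setArr 18 ((follow.run s₃).var 6) 1 := by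
      rw [hrun]; simp [traceCycle, hs₃, hs₂]
    have f6 : (follow.run s₃).var 6 = s₃.var 6 := Cmd.run_var _ (by decide)
    have f13 : (follow.run s₃).var 13 = 1 := by
      rw [Cmd.run_var _ (by decide)]; simp [hs₃, hf₂.1 13 (by decide), h0]
    obtain ⟨k1, k2, k3, k4⟩ := follow_spec (s := s₃) (l := l) (by
      rw [g3, e3, v1, v6, a5, v11, ← h3]; exact hl)
    rw [h3, h4] at hl
    refine Or.inr ⟨by simp [hrun', f13], s₁.var 14, l,
      ⟨h1, h2, hl.isWalk, fun j hj => hl.mem j hj, hl.nodup, hl.notMem⟩, ?_, ?_, ?_⟩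
    · simp [hrun', k1, v12, Nat.add_comm]
    · intro i hi
      have : s'.arr 16 i = (follow.run s₃).arr 16 i := by simp [hrun']
      rw [this, k2, v12]
      cases i with
      | zero => simp [a16]
      | succ i => rw [if_pos (by simp at hi ⊢; omega)]; simp
    · intro v hv
      rw [hrun', f6, v6]
      simp only [State.arr_setArr, if_true, List.map_cons, List.mem_cons, Function.update_apply, k4,
        g3]
      by_cases hv1 : v = s.arr 1 (s₁.var 14)
      · subst hv1
        simp [State.graph]
      · have h5 : v ≠ s.graph.tail (s₁.var 14) := hv1
        simp only [hv1, h5, if_false, false_or, a18 v hv]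
        split_ifs with h6 <;> simp [h6]

end RAM

/-! ### Cycles of the given digraph -/

namespace RAM

open Multidigraph

variable {n m : ℕ} {D : Multidigraph (Fin n) (Fin m)}

/-- The number of an arc of the symmetric digraph: the arc `a` has the number `a`, and its reverse
has the number `m + a`. -/
def idx : Fin m ⊕ Fin m → ℕ := Sum.elim Fin.val fun a => m + a

@[simp] theorem idx_inl (a : Fin m) : idx (.inl a) = (a : ℕ) := rfl

@[simp] theorem idx_inr (a : Fin m) : idx (.inr a) = m + (a : ℕ) := rfl

theorem idx_injective : Function.Injective (idx (m := m)) := by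
  rintro (a | a) (b | b) h <;> simp only [idx_inl, idx_inr] at h
  · rw [Fin.ext h]
  · omega
  · omega
  · rw [Fin.ext (by omega : (a : ℕ) = b)]

theorem idx_lt (i : Fin m ⊕ Fin m) : idx i < 2 * m := by
  rcases i with a | a <;> simp only [idx_inl, idx_inr] <;> omega

theorem exists_idx {j : ℕ} (hj : j < 2 * m) : ∃ i : Fin m ⊕ Fin m, idx i = j := by
  by_cases h : j < m
  · exact ⟨.inl ⟨j, h⟩, rfl⟩
  · exact ⟨.inr ⟨j - m, by omega⟩, by simp only [idx_inr]; omega⟩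

/-- The memory holds the symmetric digraph of `D`. -/
structure Rep (D : Multidigraph (Fin n) (Fin m)) (s : State) : Prop where
  var_one : s.var 1 = n
  var_two : s.var 2 = m
  var_three : s.var 3 = 2 * m
  var_five : s.var 5 = n + 1
  tail_eq : ∀ i, s.arr 1 (idx i) = D.sym.tail i
  head_eq : ∀ i, s.arr 2 (idx i) = D.sym.head i

theorem Rep.valid {s : State} (h : Rep D s) : s.Valid := by
  intro j hj
  rw [h.var_three] at hj
  obtain ⟨i, rfl⟩ := exists_idx hj
  rw [h.tail_eq, h.head_eq, h.var_one]
  exact ⟨Fin.is_lt _, Fin.is_lt _⟩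

theorem Rep.of_eq {s s' : State} (h : Rep D s) (hv : ∀ x ∈ [1, 2, 3, 5], s'.var x = s.var x)
    (ha : ∀ a ∈ [1, 2], s'.arr a = s.arr a) : Rep D s' := by
  refine ⟨?_, ?_, ?_, ?_, fun i => ?_, fun i => ?_⟩
  · rw [hv 1 (by simp), h.var_one]
  · rw [hv 2 (by simp), h.var_two]
  · rw [hv 3 (by simp), h.var_three]
  · rw [hv 5 (by simp), h.var_five]
  · rw [ha 1 (by simp), h.tail_eq]
  · rw [ha 2 (by simp), h.head_eq]

theorem Rep.frame {s s' : State} {p : Cmd} (h : Rep D s) (hf : p.Frame s s')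
    (hv : ∀ x ∈ [1, 2, 3, 5], x ∉ p.wv) (ha : ∀ a ∈ [1, 2], a ∉ p.wa) : Rep D s' :=
  h.of_eq (fun x hx => hf.1 x (hv x hx)) fun a hx => hf.2 a (ha a hx)

theorem Rep.isWalk_idx {s : State} (h : Rep D s) {u v : Fin n} {l : List (Fin m ⊕ Fin m)} :
    s.graph.IsWalk u (l.map idx) v ↔ D.sym.IsWalk u l v := by
  induction l generalizing u with
  | nil => simp [Fin.ext_iff]
  | cons i l ih =>
    rw [List.map_cons, isWalk_cons, isWalk_cons, ← ih]
    simp only [State.graph, h.tail_eq, h.head_eq, Fin.ext_iff]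

theorem Rep.isWalk_val {s : State} (h : Rep D s) {u v : Fin n} {l : List (Fin m)} :
    s.graph.IsWalk u (l.map Fin.val) v ↔ D.IsWalk u l v := by
  induction l generalizing u with
  | nil => simp [Fin.ext_iff]
  | cons i l ih =>
    rw [List.map_cons, isWalk_cons, isWalk_cons, ← ih]
    have h1 := h.tail_eq (.inl i)
    have h2 := h.head_eq (.inl i)
    simp only [idx_inl, sym_tail_inl, sym_head_inl] at h1 h2
    simp only [State.graph, h1, h2, Fin.ext_iff]

theorem Rep.tail_val {s : State} (h : Rep D s) (a : Fin m) : s.arr 1 a = D.tail a :=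
  h.tail_eq (.inl a)

theorem Rep.head_val {s : State} (h : Rep D s) (a : Fin m) : s.arr 2 a = D.head a :=
  h.head_eq (.inl a)

theorem Rep.map_tail_val {s : State} (h : Rep D s) (l : List (Fin m)) :
    (l.map Fin.val).map s.graph.tail = (l.map D.tail).map Fin.val := by
  simp [State.graph, h.tail_val]

theorem Rep.map_tail_idx {s : State} (h : Rep D s) (l : List (Fin m ⊕ Fin m)) :
    (l.map idx).map s.graph.tail = (l.map D.sym.tail).map Fin.val := by
  simp [State.graph, h.tail_eq]

theorem mem_map_val {v : Fin n} {l : List (Fin n)} :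
    (v : ℕ) ∈ l.map Fin.val ↔ v ∈ l := by
  simp only [List.mem_map, Fin.val_inj, exists_eq_right]

/-- The search for a cycle finds a dicycle, if the marked edges are arcs of `D`. -/
theorem Rep.dicycle_spec {s : State} (h : Rep D s) {S : Set (Fin m)}
    (hS : ∀ j, j ∈ s.marked ↔ ∃ b ∈ S, j = (b : ℕ)) :
    let s' := cycle.run s
    (s'.var 13 = 0 ∧ ¬ ∃ B, D.IsDicycle B ∧ ∀ a ∈ B, a ∈ S) ∨
      (s'.var 13 = 1 ∧ ∃ B, D.IsDicycle B ∧ (∀ a ∈ B, a ∈ S) ∧ s'.var 12 = B.length ∧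
        s'.Lists 16 (B.map Fin.val) ∧
        ∀ v : Fin n, s'.arr 18 v ≠ 0 ↔ v ∈ B.map D.tail) := by
  intro s'
  have hm : s.var 2 ≤ s.var 3 := by rw [h.var_two, h.var_three]; omega
  rcases cycle_spec h.valid hm with ⟨h1, h2⟩ | ⟨h1, a, l, hc, h2, h3, h4⟩
  · refine Or.inl ⟨h1, ?_⟩
    rintro ⟨B, hB, hBS⟩
    cases B with
    | nil => exact hB.1 rfl
    | cons b B =>
      obtain ⟨hn, hw⟩ := isDicycle_cons_iff.1 hB
      refine h2 b (by rw [h.var_two]; exact b.2) ((hS _).2 ⟨b, hBS b (by simp), rfl⟩)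
        (B.map Fin.val) ?_ ?_
      · rw [h.tail_val, h.head_val, h.isWalk_val]
        exact hw.2
      · intro j hj
        obtain ⟨c, hc, rfl⟩ := List.mem_map.1 hj
        refine ⟨(hS _).2 ⟨c, hBS c (by simp [hc]), rfl⟩, fun hcb => ?_, ?_⟩
        · rw [List.map_cons, List.nodup_cons] at hn
          exact hn.1 ((Fin.ext hcb : c = b) ▸ List.mem_map_of_mem hc)
        · rw [h.var_two]; omega
  · obtain ⟨b, hb, rfl⟩ := (hS a).1 hc.mem
    obtain ⟨B, rfl, hBS⟩ : ∃ B : List (Fin m), l = B.map Fin.val ∧ ∀ a ∈ B, a ∈ S := by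
      have hmem := hc.mem'
      clear hc h2 h3 h4
      induction l with
      | nil => exact ⟨[], rfl, by simp⟩
      | cons j l ih =>
        obtain ⟨B, rfl, hB⟩ := ih fun i hi => hmem i (by simp [hi])
        obtain ⟨c, hc, rfl⟩ := (hS j).1 (hmem j (by simp)).1
        exact ⟨c :: B, rfl, by simpa using ⟨hc, hB⟩⟩
    have hval : ((b :: B).map Fin.val) = (b : ℕ) :: B.map Fin.val := rfl
    have htl : s.graph.tail b = D.tail b := h.tail_val b
    have hhd : s.graph.head b = D.head b := h.head_val b
    have hw := hc.isWalk
    have hn := hc.nodup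
    have hnm := hc.notMem
    rw [htl, hhd, h.isWalk_val] at hw
    rw [h.map_tail_val, List.nodup_map_iff Fin.val_injective] at hn
    rw [h.map_tail_val, htl, mem_map_val] at hnm
    refine Or.inr ⟨h1, b :: B, isDicycle_cons_iff.2 ⟨?_, rfl, hw⟩, ?_, ?_, h3, fun v => ?_⟩
    · rw [List.map_cons, List.nodup_cons]
      exact ⟨hnm, hn⟩
    · simpa using ⟨hb, hBS⟩
    · simpa using h2
    · rw [h4 v (by rw [h.var_one]; exact v.2), ← hval, h.map_tail_val, mem_map_val]

/-- The search for a cycle finds a cycle of the underlying graph that is induced on `U`, if the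
marked edges are the arcs of the symmetric digraph with both ends in `U`. -/
theorem Rep.ucycle_spec {s : State} (h : Rep D s) {U : Set (Fin n)}
    (hU : ∀ j, j ∈ s.marked ↔
      ∃ i : Fin m ⊕ Fin m, (D.sym.tail i ∈ U ∧ D.sym.head i ∈ U) ∧ j = idx i) :
    let s' := cycle.run s
    (s'.var 13 = 0 ∧ ¬ D.HasCyc U) ∨
      (s'.var 13 = 1 ∧ ∃ L : List (Fin m ⊕ Fin m),
        D.IsCycle (L.map fun j => (D.sym.tail j, arc j)) ∧ (∀ j ∈ L, D.sym.tail j ∈ U) ∧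
        s'.var 12 = L.length ∧ s'.Lists 16 (L.map idx)) := by
  intro s'
  have hm : s.var 2 ≤ s.var 3 := by rw [h.var_two, h.var_three]; omega
  rcases cycle_spec h.valid hm with ⟨h1, h2⟩ | ⟨h1, a, l, hc, h2, h3, -⟩
  · refine Or.inl ⟨h1, fun hcyc => ?_⟩
    obtain ⟨e, he1, he2, hconn⟩ := hcyc.exists_uconn
    obtain ⟨l, hl, hmem⟩ := hconn.exists_isWalk
    refine h2 e (by rw [h.var_two]; exact e.2) ((hU _).2 ⟨.inl e, ⟨he1, he2⟩, rfl⟩)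
      (l.map idx) ?_ ?_
    · rw [h.tail_val, h.head_val, h.isWalk_idx]
      exact hl
    · intro j hj
      obtain ⟨i, hi, rfl⟩ := List.mem_map.1 hj
      obtain ⟨q1, q2⟩ := hmem i hi
      refine ⟨(hU _).2 ⟨i, q2, rfl⟩, fun hie => q1 ?_, fun hie => q1 ?_⟩
      · rw [idx_injective (hie.trans (idx_inl e).symm)]; rfl
      · have hie' : idx i = idx (.inr e) := hie.trans (by rw [h.var_two, idx_inr, Nat.add_comm])
        rw [idx_injective hie']
        rfl
  · obtain ⟨i, hi, hai⟩ := (hU a).1 hc.mem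
    obtain ⟨e, rfl⟩ : ∃ e, i = .inl e := by
      rcases i with e | e
      · exact ⟨e, rfl⟩
      · have := hc.lt
        rw [hai, h.var_two, idx_inr] at this
        omega
    obtain rfl : a = (e : ℕ) := hai
    obtain ⟨L, rfl, hLU⟩ : ∃ L : List (Fin m ⊕ Fin m), l = L.map idx ∧
        ∀ j ∈ L, D.sym.tail j ∈ U ∧ D.sym.head j ∈ U := by
      have hmem := hc.mem'
      clear hc h2 h3
      induction l with
      | nil => exact ⟨[], rfl, by simp⟩
      | cons j l ih =>
        obtain ⟨B, rfl, hB⟩ := ih fun i hi => hmem i (by simp [hi])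
        obtain ⟨c, hc, rfl⟩ := (hU j).1 (hmem j (by simp)).1
        exact ⟨c :: B, rfl, fun x hx => (List.mem_cons.1 hx).elim (fun h => h ▸ hc) (hB x)⟩
    have htl : s.graph.tail e = D.tail e := h.tail_val e
    have hhd : s.graph.head e = D.head e := h.head_val e
    have hw := hc.isWalk
    have hn := hc.nodup
    have hnm := hc.notMem
    rw [htl, hhd, h.isWalk_idx] at hw
    rw [h.map_tail_idx, List.nodup_map_iff Fin.val_injective] at hn
    rw [h.map_tail_idx, htl, mem_map_val] at hnm
    refine Or.inr ⟨h1, .inl e :: L, isCycle_of_path hw ?_ hn hnm, ?_, ?_, h3⟩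
    · rintro j hj rfl
      have h5 := (hc.mem' (idx j) (List.mem_map_of_mem hj)).2
      rcases j with j | j
      · exact h5.1 rfl
      · exact h5.2 (by rw [h.var_two, idx_inr, Nat.add_comm]; rfl)
    · intro j hj
      rcases List.mem_cons.1 hj with rfl | hj
      exacts [hi.1, (hLU j hj).1]
    · simpa using h2

/-- Filling an array with the values of an expression. -/
theorem fill_spec {s : State} {i b A : ℕ} {e : Exp} (f : ℕ → ℕ)
    (he : ∀ j u, j < s.var b → u.var i = j → (∀ x, x ≠ i → u.var x = s.var x) →
      (∀ x, x ≠ A → u.arr x = s.arr x) → e.eval u = f j) :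
    ∀ j < s.var b, ((Cmd.loop i b (.write A (.var i) e)).run s).arr A j = f j :=
  Cmd.loop_rule (fun j s' => ∀ v < j, s'.arr A v = f v) (by simp [Cmd.wv]) (by simp)
    (fun j s' hjb hj hF hI v hv => by
      have hev := he j s' hjb hj (fun x hx => hF.1 x (by simp [Cmd.wv, hx]))
        (fun x hx => hF.2 x (by simp [Cmd.wa, hx]))
      simp only [Cmd.run_write, State.arr_setVar, State.arr_setArr, Exp.eval, hj, if_true, hev]
      rcases Nat.lt_succ_iff_lt_or_eq.1 hv with hv | rfl
      · rw [Function.update_of_ne (by omega)]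
        exact hI v hv
      · simp)

/-- Mark the edges for which the expression `e`, evaluated with the number of the edge
as `var 15`, is nonzero. -/
def mark (e : Exp) : Cmd := .loop 15 3 (.write 3 (.var 15) e)

theorem mark_spec {s : State} {e : Exp} {p : ℕ → Prop}
    (he : ∀ j u, j < s.var 3 → u.var 15 = j → (∀ x, x ≠ 15 → u.var x = s.var x) →
      (∀ x, x ≠ 3 → u.arr x = s.arr x) → (e.eval u ≠ 0 ↔ p j)) (j : ℕ) :
    j ∈ ((mark e).run s).marked ↔ j < s.var 3 ∧ p j := by
  have key := Cmd.loop_rule (s := s) (i := 15) (b := 3) (p := .write 3 (.var 15) e)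
    (fun j s' => ∀ v < j, s'.arr 3 v ≠ 0 ↔ p v) (by simp [Cmd.wv]) (by simp)
    (fun j s' hjb hj hF hI v hv => by
      have hev := he j s' hjb hj (fun x hx => hF.1 x (by simp [Cmd.wv, hx]))
        (fun x hx => hF.2 x (by simp [Cmd.wa, hx]))
      simp only [Cmd.run_write, State.arr_setVar, State.arr_setArr, Exp.eval, hj, if_true]
      rcases Nat.lt_succ_iff_lt_or_eq.1 hv with hv | rfl
      · rw [Function.update_of_ne (by omega)]
        exact hI v hv
      · rw [Function.update_self]
        exact hev)
  have h3 : ((mark e).run s).var 3 = s.var 3 := Cmd.run_var _ (by simp [mark, Cmd.wv])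
  simp only [State.marked, h3, Set.mem_ofPred_eq]
  exact and_congr_right fun hj => key j hj

end RAM

/-! ### Computing a minimal good arc set -/

namespace RAM

open Multidigraph

variable {n m : ℕ} {D : Multidigraph (Fin n) (Fin m)}

/-- The arcs that are marked in the array `a`. -/
def State.arcs (m : ℕ) (s : State) (a : ℕ) : Set (Fin m) := {b | s.arr a b ≠ 0}

/-- The arc set `F` contains a dicycle that avoids the vertex `v`. -/
def Avoids (D : Multidigraph (Fin n) (Fin m)) (F : Set (Fin m)) (v : ℕ) : Prop :=
  ∃ B, D.IsDicycle B ∧ (∀ a ∈ B, a ∈ F) ∧ ∀ a ∈ B, (D.tail a : ℕ) ≠ v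

/-- Search for a dicycle that avoids the vertex `var 19` and uses arcs marked in the array `7`. -/
def avoid : Cmd :=
  .seq (mark (.and (.sub (.var 2) (.var 15)) (.and (.read 7 (.var 15))
    (.and (.ne (.read 1 (.var 15)) (.var 19)) (.ne (.read 2 (.var 15)) (.var 19)))))) cycle

theorem Rep.avoid_spec {s : State} (h : Rep D s) :
    (avoid.run s).var 13 ≤ 1 ∧
      ((avoid.run s).var 13 ≠ 0 ↔ Avoids D (s.arcs m 7) (s.var 19)) := by
  set e : Exp := .and (.sub (.var 2) (.var 15)) (.and (.read 7 (.var 15))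
    (.and (.ne (.read 1 (.var 15)) (.var 19)) (.ne (.read 2 (.var 15)) (.var 19)))) with he
  set s₁ := (mark e).run s with hs₁
  have hrun : avoid.run s = cycle.run s₁ := rfl
  have hmark := mark_spec (s := s) (e := e)
    (p := fun j => j < m ∧ s.arr 7 j ≠ 0 ∧ s.arr 1 j ≠ s.var 19 ∧ s.arr 2 j ≠ s.var 19)
    (fun j u _ hu hv ha => by
      simp only [he, ne_eq, Exp.eval_and_eq_zero, Exp.eval_ne_eq_zero, Exp.eval, hu,
        hv 2 (by decide), hv 19 (by decide), ha 7 (by decide), ha 1 (by decide),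
        ha 2 (by decide), h.var_two, not_or]
      rw [Nat.sub_eq_zero_iff_le, not_le])
  rw [← hs₁, h.var_three] at hmark
  have h₁ : Rep D s₁ := h.frame (Cmd.frame_run (mark e) s) (by simp [mark, Cmd.wv])
    (by simp [mark, Cmd.wa])
  have hspec := h₁.dicycle_spec
    (S := {b | b ∈ s.arcs m 7 ∧ (D.tail b : ℕ) ≠ s.var 19 ∧ (D.head b : ℕ) ≠ s.var 19}) (by
    intro j
    rw [hmark]
    constructor
    · rintro ⟨-, hj, h1, h2, h3⟩
      refine ⟨⟨j, hj⟩, ⟨h1, ?_, ?_⟩, rfl⟩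
      · rw [← h.tail_val]; exact h2
      · rw [← h.head_val]; exact h3
    · rintro ⟨b, ⟨h1, h2, h3⟩, rfl⟩
      refine ⟨by omega, b.2, h1, ?_, ?_⟩
      · rw [h.tail_val]; exact h2
      · rw [h.head_val]; exact h3)
  rw [hrun]
  have hiff : (∃ B, D.IsDicycle B ∧ ∀ a ∈ B, a ∈ {b : Fin m | b ∈ s.arcs m 7 ∧
      (D.tail b : ℕ) ≠ s.var 19 ∧ (D.head b : ℕ) ≠ s.var 19}) ↔
      Avoids D (s.arcs m 7) (s.var 19) := by
    constructor
    · rintro ⟨B, hB, hall⟩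
      exact ⟨B, hB, fun a ha => (hall a ha).1, fun a ha => (hall a ha).2.1⟩
    · rintro ⟨B, hB, hF, hv⟩
      refine ⟨B, hB, fun a ha => ⟨hF a ha, hv a ha, ?_⟩⟩
      obtain ⟨b, hb, hba⟩ := List.mem_map.1 (hB.head_mem ha)
      rw [← hba]
      exact hv b hb
  rcases hspec with ⟨h1, h2⟩ | ⟨h1, B, h2, h3, -⟩
  · rw [h1]
    exact ⟨by omega, by simpa using fun hc => h2 (hiff.2 hc)⟩
  · rw [h1]
    exact ⟨le_rfl, by simpa using hiff.1 ⟨B, h2, h3⟩⟩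

theorem avoids_iff {F : Set (Fin m)} {v : Fin n} :
    Avoids D F v ↔ ∃ B, D.IsDicycle B ∧ (∀ a ∈ B, a ∈ F) ∧ v ∉ B.map D.tail := by
  simp only [Avoids, List.mem_map, not_exists, not_and, Fin.val_inj, ne_eq]

theorem avoids_univ_iff {v : Fin n} : Avoids D Set.univ v ↔ v ∉ D.transversalVertices := by
  rw [avoids_iff, mem_transversalVertices_iff]
  push Not
  simp

/-- The array `6` marks the transversal vertices. -/
def MarksTransversal (D : Multidigraph (Fin n) (Fin m)) (s : State) : Prop :=
  s.arr 6 n = 0 ∧ ∀ v : Fin n, s.arr 6 v ≠ 0 ↔ v ∈ D.transversalVertices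

/-- The number `n` is no vertex and not marked, so it takes care of the condition that there is a
dicycle at all. -/
theorem isGood_iff {s : State} (hs : MarksTransversal D s) {F : Set (Fin m)} :
    D.IsGood F ↔ ∀ v < n + 1, s.arr 6 v = 0 → Avoids D F v := by
  constructor
  · rintro ⟨⟨B, h1, h2⟩, h3⟩ v hv h0
    rcases Nat.lt_succ_iff_lt_or_eq.1 hv with hv | rfl
    · exact avoids_iff.2 (h3 ⟨v, hv⟩ fun hc => (hs.2 ⟨v, hv⟩).2 hc h0)
    · exact ⟨B, h1, h2, fun a _ hc => absurd (D.tail a).2 (by omega)⟩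
  · intro h
    obtain ⟨B, h1, h2, -⟩ := h n (by omega) hs.1
    refine ⟨⟨B, h1, h2⟩, fun v hv => avoids_iff.1 (h v (by omega) ?_)⟩
    by_contra hc
    exact hv ((hs.2 v).1 hc)

open Cmd in
/-- Start with all arcs, and mark the transversal vertices in the array `6`. -/
def transversalStage : Cmd :=
  loop 9 2 (write 7 (.var 9) (.const 1)) ;;
    loop 19 1 (avoid ;; write 6 (.var 19) (.sub (.const 1) (.var 13)))

theorem Rep.transversalStage_spec {s : State} (h : Rep D s) (h6 : s.arr 6 n = 0) :
    MarksTransversal D (transversalStage.run s) ∧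
      (transversalStage.run s).arcs m 7 = Set.univ := by
  set s₁ := (Cmd.loop 9 2 (.write 7 (.var 9) (.const 1))).run s with hs₁
  have h7 : s₁.arcs m 7 = Set.univ := by
    have := fill_spec (s := s) (i := 9) (b := 2) (A := 7) (e := .const 1) (fun _ => 1)
      (fun _ _ _ _ _ _ => rfl)
    rw [← hs₁, h.var_two] at this
    ext a
    simp [State.arcs, this a a.2]
  have h₁ : Rep D s₁ := h.frame (Cmd.frame_run _ s) (by decide) (by decide)
  have h61 : s₁.arr 6 n = 0 := by rw [hs₁, Cmd.run_arr _ (by decide), h6]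
  have hrun : transversalStage.run s = (Cmd.loop 19 1 (.seq avoid
    (.write 6 (.var 19) (.sub (.const 1) (.var 13))))).run s₁ := rfl
  rw [hrun]
  have key := Cmd.loop_rule (s := s₁) (i := 19) (b := 1)
    (p := .seq avoid (.write 6 (.var 19) (.sub (.const 1) (.var 13))))
    (fun j u => u.arr 6 n = 0 ∧ ∀ v < j, u.arr 6 v ≠ 0 ↔ ¬ Avoids D Set.univ v) (by decide)
    ⟨h61, by simp⟩ (fun j u hj hu hF hI => by
      have hu' : Rep D u := h₁.frame hF (by decide) (by decide)
      obtain ⟨h1, h2⟩ := hu'.avoid_spec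
      have h3 : u.arcs m 7 = Set.univ := by
        rw [← h7]; simp only [State.arcs, hF.2 7 (by decide)]
      have h4 : (avoid.run u).arr 6 = u.arr 6 := Cmd.run_arr _ (by decide)
      have h5 : (avoid.run u).var 19 = j := by rw [Cmd.run_var _ (by decide), hu]
      rw [h3, hu] at h2
      rw [h₁.var_one] at hj
      simp only [Cmd.run_seq, Cmd.run_write, State.arr_setVar, State.arr_setArr, if_true, h4, h5,
        Exp.eval]
      refine ⟨?_, fun v hv => ?_⟩
      · rw [Function.update_of_ne (by omega)]; exact hI.1
      · rcases Nat.lt_succ_iff_lt_or_eq.1 hv with hv | rfl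
        · rw [Function.update_of_ne (by omega)]
          exact hI.2 v hv
        · rw [Function.update_self, ← h2]
          omega)
  refine ⟨⟨key.1, fun v => ?_⟩, ?_⟩
  · rw [key.2 v (by rw [h₁.var_one]; exact v.2), avoids_univ_iff, not_not]
  · rw [← h7]
    simp only [State.arcs]
    rw [Cmd.run_arr _ (by decide)]

open Cmd in
/-- Test whether the arcs marked in the array `7` form a good set; otherwise the variable `21` is
set to `0`. -/
def testGood : Cmd :=
  loop 19 5 (ite (.read 6 (.var 19)) skip (avoid ;; ite (.var 13) skip (set 21 (.const 0))))

theorem Rep.testGood_spec {s : State} (h : Rep D s) (ht : MarksTransversal D s)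
    (h21 : s.var 21 = 1) :
    ((testGood.run s).var 21 ≠ 0 ↔ D.IsGood (s.arcs m 7)) := by
  rw [isGood_iff ht]
  have key := Cmd.loop_rule (s := s) (i := 19) (b := 5)
    (p := .ite (.read 6 (.var 19)) .skip (.seq avoid (.ite (.var 13) .skip (.set 21 (.const 0)))))
    (fun j u => u.var 21 ≠ 0 ↔ ∀ v < j, s.arr 6 v = 0 → Avoids D (s.arcs m 7) v) (by decide)
    (by simp [h21]) (fun j u hj hu hF hI => by
      have hu' : Rep D u := h.frame hF (by decide) (by decide)
      obtain ⟨-, h2⟩ := hu'.avoid_spec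
      have h3 : u.arcs m 7 = s.arcs m 7 := by simp only [State.arcs, hF.2 7 (by decide)]
      have h4 : u.arr 6 = s.arr 6 := hF.2 6 (by decide)
      have h5 : (avoid.run u).var 21 = u.var 21 := Cmd.run_var _ (by decide)
      rw [h3, hu] at h2
      have hsucc : (∀ v < j + 1, s.arr 6 v = 0 → Avoids D (s.arcs m 7) v) ↔
          (∀ v < j, s.arr 6 v = 0 → Avoids D (s.arcs m 7) v) ∧
            (s.arr 6 j = 0 → Avoids D (s.arcs m 7) j) := by
        constructor
        · exact fun h => ⟨fun v hv => h v (by omega), h j (by omega)⟩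
        · rintro ⟨h6, h7⟩ v hv
          rcases Nat.lt_succ_iff_lt_or_eq.1 hv with hv | rfl
          exacts [h6 v hv, h7]
      rw [hsucc, ← hI]
      have hne : (21 : ℕ) ≠ 19 := by decide
      have h8 : Exp.eval u (.read 6 (.var 19)) = s.arr 6 j := by simp [hu, h4]
      rw [State.var_setVar, if_neg hne]
      by_cases h6 : s.arr 6 j = 0
      · rw [Cmd.run_ite_of_eq (h8.trans h6), Cmd.run_seq]
        by_cases h7 : (avoid.run u).var 13 = 0
        · rw [Cmd.run_ite_of_eq (show Exp.eval _ (.var 13) = 0 from h7)]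
          simp only [Cmd.run_set, Exp.eval, State.var_setVar, if_true]
          have := fun hc => (h2.2 hc) h7
          tauto
        · rw [Cmd.run_ite_of_ne (show Exp.eval _ (.var 13) ≠ 0 from h7), Cmd.run_skip, h5]
          have := h2.1 h7
          tauto
      · rw [Cmd.run_ite_of_ne (h8 ▸ h6), Cmd.run_skip]
        tauto)
  rw [h.var_five] at key
  exact key

open Cmd in
/-- Delete the arc `var 20` if the remaining arc set is still good. -/
def tryDelete : Cmd :=
  write 7 (.var 20) (.const 0) ;; set 21 (.const 1) ;; testGood ;;
    ite (.var 21) skip (write 7 (.var 20) (.const 1))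

theorem Rep.tryDelete_spec {s : State} (h : Rep D s) (ht : MarksTransversal D s) {a : Fin m}
    (ha : s.var 20 = a) (hg : D.IsGood (s.arcs m 7)) :
    D.IsGood ((tryDelete.run s).arcs m 7) ∧ (tryDelete.run s).arcs m 7 ⊆ s.arcs m 7 ∧
      (a ∈ (tryDelete.run s).arcs m 7 → ¬ D.IsGood ((tryDelete.run s).arcs m 7 \ {a})) := by
  set s₁ := (s.setArr 7 (s.var 20) 0).setVar 21 1 with hs₁
  set s₂ := testGood.run s₁ with hs₂
  have hrun : tryDelete.run s =
      if s₂.var 21 = 0 then s₂.setArr 7 (s₂.var 20) 1 else s₂ := rfl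
  have h₁ : Rep D s₁ := h.of_eq (by simp [hs₁]) (by simp [hs₁])
  have ht₁ : MarksTransversal D s₁ := by simpa [hs₁, MarksTransversal] using ht
  have hF₁ : s₁.arcs m 7 = s.arcs m 7 \ {a} := by
    ext b
    by_cases hb : b = a
    · subst hb; simp [hs₁, State.arcs, ha]
    · have : (b : ℕ) ≠ a := fun hc => hb (Fin.ext hc)
      simp [hs₁, State.arcs, ha, hb, Function.update_of_ne this]
  have hspec := h₁.testGood_spec ht₁ (by simp [hs₁])
  rw [← hs₂, hF₁] at hspec
  have h7 : s₂.arr 7 = s₁.arr 7 := Cmd.run_arr _ (by decide)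
  have h20 : s₂.var 20 = a := by
    rw [hs₂, Cmd.run_var _ (by decide)]; simp [hs₁, ha]
  by_cases hc : s₂.var 21 = 0
  · have hbad : ¬ D.IsGood (s.arcs m 7 \ {a}) := fun hg' => hspec.2 hg' hc
    have haF : a ∈ s.arcs m 7 := by
      by_contra haF
      rw [Set.sdiff_singleton_eq_self haF] at hbad
      exact hbad hg
    have hF : (tryDelete.run s).arcs m 7 = s.arcs m 7 := by
      ext b
      rw [hrun, if_pos hc]
      by_cases hb : b = a
      · subst hb
        simpa [State.arcs, h20] using haF
      · have : (b : ℕ) ≠ a := fun hc => hb (Fin.ext hc)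
        simp [State.arcs, h20, h7, hs₁, ha, Function.update_of_ne this]
    rw [hF]
    exact ⟨hg, subset_rfl, fun _ => hbad⟩
  · have hF : (tryDelete.run s).arcs m 7 = s.arcs m 7 \ {a} := by
      rw [hrun, if_neg hc, ← hF₁]
      simp only [State.arcs, h7]
    rw [hF]
    exact ⟨hspec.1 hc, Set.sdiff_subset, fun hm => absurd rfl hm.2⟩

/-- Delete arcs as long as the arc set remains good. -/
def goodStage : Cmd := .loop 20 2 tryDelete

/-- The greedy deletion ends with a minimal good arc set, since supersets of good sets are good. -/
theorem Rep.goodStage_spec {s : State} (h : Rep D s) (ht : MarksTransversal D s)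
    (hg : D.IsGood (s.arcs m 7)) :
    D.IsGood ((goodStage.run s).arcs m 7) ∧
      ∀ a ∈ (goodStage.run s).arcs m 7, ¬ D.IsGood ((goodStage.run s).arcs m 7 \ {a}) := by
  have key := Cmd.loop_rule (s := s) (i := 20) (b := 2) (p := tryDelete)
    (fun j u => D.IsGood (u.arcs m 7) ∧
      ∀ a : Fin m, (a : ℕ) < j → a ∈ u.arcs m 7 → ¬ D.IsGood (u.arcs m 7 \ {a})) (by decide)
    ⟨hg, by simp⟩ (fun j u hj hu hF hI => by
      have hu' : Rep D u := h.frame hF (by decide) (by decide)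
      have htu : MarksTransversal D u := by
        simpa only [MarksTransversal, hF.2 6 (by decide)] using ht
      rw [h.var_two] at hj
      obtain ⟨h1, h2, h3⟩ := hu'.tryDelete_spec htu (a := ⟨j, hj⟩) hu hI.1
      refine ⟨h1, fun a ha haF => ?_⟩
      change a ∈ (tryDelete.run u).arcs m 7 at haF
      rcases Nat.lt_succ_iff_lt_or_eq.1 ha with ha | ha
      · exact fun hc => hI.2 a ha (h2 haF) (hc.mono (Set.sdiff_subset_sdiff_left h2))
      · obtain rfl : a = ⟨j, hj⟩ := Fin.ext ha
        exact h3 haF)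
  rw [h.var_two] at key
  exact ⟨key.1, fun a ha => key.2 a a.2 ha⟩

open Cmd in
/-- Mark the tails of the arcs marked in the array `7` in the array `8`. -/
def vertexStage : Cmd :=
  loop 9 1 (write 8 (.var 9) (.const 0)) ;;
    loop 9 2 (ite (.read 7 (.var 9)) (write 8 (.read 1 (.var 9)) (.const 1)) skip)

theorem Rep.vertexStage_spec {s : State} (h : Rep D s) (v : Fin n) :
    (vertexStage.run s).arr 8 v ≠ 0 ↔ v ∈ D.tailSet (s.arcs m 7) := by
  set s₁ := (Cmd.loop 9 1 (.write 8 (.var 9) (.const 0))).run s with hs₁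
  have h8 : ∀ v : Fin n, s₁.arr 8 v = 0 := fun v =>
    clear_spec s 8 v (by rw [h.var_one]; exact v.2)
  have h₁ : Rep D s₁ := h.frame (Cmd.frame_run _ s) (by decide) (by decide)
  have h7 : s₁.arr 7 = s.arr 7 := Cmd.run_arr _ (by decide)
  have key := Cmd.loop_rule (s := s₁) (i := 9) (b := 2)
    (p := .ite (.read 7 (.var 9)) (.write 8 (.read 1 (.var 9)) (.const 1)) .skip)
    (fun j u => ∀ v : Fin n, u.arr 8 v ≠ 0 ↔
      ∃ a : Fin m, (a : ℕ) < j ∧ s.arr 7 a ≠ 0 ∧ D.tail a = v) (by decide)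
    (fun v => by simp [h8]) (fun j u hj hu hF hI v => by
      have hu' : Rep D u := h₁.frame hF (by decide) (by decide)
      have hu7 : u.arr 7 = s.arr 7 := by rw [hF.2 7 (by decide), h7]
      rw [h₁.var_two] at hj
      have h1 : u.arr 1 j = D.tail ⟨j, hj⟩ := hu'.tail_val ⟨j, hj⟩
      rw [State.arr_setVar, Cmd.run_ite]
      simp only [Exp.eval, hu, hu7]
      by_cases hc : s.arr 7 j = 0
      · rw [if_pos hc, Cmd.run_skip, hI]
        constructor
        · rintro ⟨a, h2, h3⟩; exact ⟨a, by omega, h3⟩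
        · rintro ⟨a, h2, h3⟩
          refine ⟨a, ?_, h3⟩
          rcases Nat.lt_succ_iff_lt_or_eq.1 h2 with h2 | h2
          · exact h2
          · exact absurd (h2 ▸ hc) h3.1
      · rw [if_neg hc]
        simp only [Cmd.run_write, Exp.eval, State.arr_setArr, if_true, hu, h1,
          Function.update_apply, Fin.val_inj]
        split_ifs with hv
        · exact ⟨fun _ => ⟨⟨j, hj⟩, by simp, hc, hv.symm⟩, fun _ => by decide⟩
        · rw [hI]
          constructor
          · rintro ⟨a, h2, h3⟩; exact ⟨a, by omega, h3⟩
          · rintro ⟨a, h2, h3⟩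
            refine ⟨a, ?_, h3⟩
            rcases Nat.lt_succ_iff_lt_or_eq.1 h2 with h2 | h2
            · exact h2
            · obtain rfl : a = ⟨j, hj⟩ := Fin.ext h2
              exact absurd h3.2.symm hv)
  rw [h₁.var_two] at key
  refine (key v).trans ⟨?_, ?_⟩
  · rintro ⟨a, -, h2, h3⟩; exact ⟨a, h2, h3⟩
  · rintro ⟨a, h2, h3⟩; exact ⟨a, a.2, h2, h3⟩

end RAM

/-! ### Marking the arcs of a guess -/

namespace RAM

open Multidigraph

variable {n m : ℕ} {D : Multidigraph (Fin n) (Fin m)}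

open Cmd in
/-- Find a path outside the marked vertices that connects the two arcs of the pair
number `var 22`. -/
def connect : Cmd :=
  mark (.and (.sub (.var 2) (.var 15)) (.and (.not (.read 8 (.read 1 (.var 15))))
      (.not (.read 8 (.read 2 (.var 15)))))) ;;
    set 7 (.var 3) ;; set 8 (.var 3) ;; set 6 (.read 1 (.read 10 (.var 22))) ;; search ;;
    set 11 (.read 2 (.read 9 (.var 22))) ;; set 12 (.const 0) ;;
    ite (.read 4 (.var 11)) follow skip

open Cmd in
/-- Mark the arcs of the pair number `var 22`, and of a path that connects them, in the array `17`,
and their tails in the array `18`. -/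
def markPair : Cmd :=
  connect ;; write 17 (.read 9 (.var 22)) (.const 1) ;;
    write 18 (.read 1 (.read 9 (.var 22))) (.const 1) ;;
    write 17 (.read 10 (.var 22)) (.const 1) ;;
    write 18 (.read 1 (.read 10 (.var 22))) (.const 1)

open Cmd in
/-- Mark the arcs that are prescribed by the guess in the arrays `9` and `10`. -/
def markGuess : Cmd :=
  loop 9 2 (write 17 (.var 9) (.const 0)) ;; loop 9 1 (write 18 (.var 9) (.const 0)) ;;
    loop 22 4 markPair

/-- `W` is a path from `u` to `v` outside `N`, or it is empty, and there is no such path. -/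
def IsPathOrNone (D : Multidigraph (Fin n) (Fin m)) (N : Set (Fin n)) (u v : Fin n)
    (W : List (Fin m)) : Prop :=
  D.IsPathOff N u v W ∨ (W = [] ∧ ∀ W', ¬ D.IsPathOff N u v W')

theorem Rep.connect_spec {s : State} (h : Rep D s) {N : Set (Fin n)}
    (hN : ∀ v : Fin n, s.arr 8 v ≠ 0 ↔ v ∈ N) {e e' : Fin m}
    (he : s.arr 9 (s.var 22) = e) (he' : s.arr 10 (s.var 22) = e') :
    ∃ W, IsPathOrNone D N (D.head e) (D.tail e') W ∧
      (∀ a : Fin m, (connect.run s).arr 17 a ≠ 0 ↔ s.arr 17 a ≠ 0 ∨ a ∈ W) ∧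
      ∀ v : Fin n, (connect.run s).arr 18 v ≠ 0 ↔ s.arr 18 v ≠ 0 ∨ v ∈ W.map D.tail := by
  set ex : Exp := .and (.sub (.var 2) (.var 15)) (.and (.not (.read 8 (.read 1 (.var 15))))
      (.not (.read 8 (.read 2 (.var 15))))) with hex
  set s₁ := (mark ex).run s with hs₁
  have hmark := mark_spec (s := s) (e := ex)
    (p := fun j => j < m ∧ s.arr 8 (s.arr 1 j) = 0 ∧ s.arr 8 (s.arr 2 j) = 0)
    (fun j u _ hu hv ha => by
      simp only [hex, ne_eq, Exp.eval_and_eq_zero, Exp.eval_not_eq_zero, Exp.eval, hu,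
        hv 2 (by decide), ha 8 (by decide), ha 1 (by decide),
        ha 2 (by decide), h.var_two, not_or, not_not]
      rw [Nat.sub_eq_zero_iff_le, not_le])
  rw [← hs₁, h.var_three] at hmark
  have hmark' : ∀ j, j ∈ s₁.marked ↔ ∃ b : Fin m, (D.tail b ∉ N ∧ D.head b ∉ N) ∧ j = b := by
    intro j
    rw [hmark]
    have key : ∀ b : Fin m, (s.arr 8 (s.arr 1 b) = 0 ∧ s.arr 8 (s.arr 2 b) = 0) ↔
        (D.tail b ∉ N ∧ D.head b ∉ N) := fun b => by
      rw [h.tail_val, h.head_val, ← hN, ← hN, not_not, not_not]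
    constructor
    · rintro ⟨-, hj, h1⟩
      exact ⟨⟨j, hj⟩, (key ⟨j, hj⟩).1 h1, rfl⟩
    · rintro ⟨b, h1, rfl⟩
      exact ⟨by omega, b.2, (key b).2 h1⟩
  have hf₁ := Cmd.frame_run (mark ex) s
  rw [← hs₁] at hf₁
  have hwv : (mark ex).wv = [15] := rfl
  have hwa : (mark ex).wa = [3] := rfl
  have fv : ∀ x, x ≠ 15 → s₁.var x = s.var x := fun x hx => hf₁.1 x (by simpa [hwv] using hx)
  have fa : ∀ x, x ≠ 3 → s₁.arr x = s.arr x := fun x hx => hf₁.2 x (by simpa [hwa] using hx)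
  have h₁ : Rep D s₁ := h.frame hf₁ (by simp [hwv]) (by simp [hwa])
  set s₂ := ((s₁.setVar 7 (s₁.var 3)).setVar 8 (s₁.var 3)).setVar 6 (D.tail e') with hs₂
  have h₂ : Rep D s₂ := h₁.of_eq (by simp [hs₂]) (by simp [hs₂])
  have hE₂ : s₂.edges = s₁.marked := by
    ext j
    simp only [hs₂, State.edges, State.marked, State.var_setVar, State.arr_setVar,
      Set.mem_ofPred_eq]
    constructor
    · rintro ⟨q1, q2, -⟩; exact ⟨q1, q2⟩
    · rintro ⟨q1, q2⟩
      refine ⟨q1, q2, ?_⟩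
      have : j < s₁.var 3 := q1
      simp
      omega
  have h6 : s₂.var 6 = D.tail e' := by simp [hs₂]
  set s₃ := search.run s₂ with hs₃
  obtain ⟨k1, k2⟩ := search_spec h₂.valid
  rw [← hs₃, h6, h₂.var_one, hE₂] at k1 k2
  have hf₃ := Cmd.frame_run search s₂
  rw [← hs₃] at hf₃
  have h₃ : Rep D s₃ := h₂.frame hf₃ (by decide) (by decide)
  set s₄ := (s₃.setVar 11 (D.head e)).setVar 12 0 with hs₄
  have h₄ : Rep D s₄ := h₃.of_eq (by simp [hs₄]) (by simp [hs₄])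
  have e22 : s₃.var 22 = s.var 22 := by
    rw [hf₃.1 22 (by decide)]; simp [hs₂, fv 22 (by decide)]
  have e9 : s₃.arr 9 = s.arr 9 := by
    rw [hf₃.2 9 (by decide)]; simp [hs₂, fa 9 (by decide)]
  have hrun : connect.run s = (Cmd.ite (.read 4 (.var 11)) follow .skip).run s₄ := by
    have hA : s₁.arr 1 (s₁.arr 10 (s₁.var 22)) = D.tail e' := by
      rw [fv 22 (by decide), fa 10 (by decide), he', h₁.tail_val]
    have hB : s₃.arr 2 (s₃.arr 9 (s₃.var 22)) = D.head e := by
      rw [e22, e9, he, h₃.head_val]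
    rw [hs₄, ← hB, hs₃, hs₂, ← hA]
    simp only [connect, Cmd.run_seq, Cmd.run_set, Exp.eval, State.var_setVar, State.arr_setVar]
    rfl
  have h17 : s₄.arr 17 = s.arr 17 := by
    simp [hs₄, hf₃.2 17 (by decide), hs₂, fa 17 (by decide)]
  have h18 : s₄.arr 18 = s.arr 18 := by
    simp [hs₄, hf₃.2 18 (by decide), hs₂, fa 18 (by decide)]
  have h4 : Exp.eval s₄ (.read 4 (.var 11)) = s₃.arr 4 (D.head e) := by simp [hs₄]
  rw [hrun]
  by_cases hc : s₃.arr 4 (D.head e) = 0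
  · rw [Cmd.run_ite_of_eq (h4.trans hc), Cmd.run_skip]
    refine ⟨[], Or.inr ⟨rfl, fun W' hW' => ?_⟩, by simp [h17], by simp [h18]⟩
    refine k2 (D.head e) (Fin.is_lt _) (W'.map Fin.val) (h₂.isWalk_val.2 hW'.1) ?_ hc
    intro j hj
    obtain ⟨b, hb, rfl⟩ := List.mem_map.1 hj
    exact (hmark' _).2 ⟨b, hW'.2.1 b hb, rfl⟩
  · rw [Cmd.run_ite_of_ne (h4 ▸ hc)]
    obtain ⟨l, hl⟩ := k1.exists_path (v := D.head e) (fun j hj => by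
      have := h₂.valid j hj.1
      rwa [h₂.var_one] at this) (Fin.is_lt _) hc
    have hE₄ : s₄.edges = s₂.edges := by
      simp [State.edges, hs₄, hf₃.1 3 (by decide), hf₃.1 7 (by decide), hf₃.1 8 (by decide),
        hf₃.2 3 (by decide)]
    have hG₄ : s₄.graph = s₂.graph := by
      simp [State.graph, hs₄, hf₃.2 1 (by decide), hf₃.2 2 (by decide)]
    have h46 : s₄.var 6 = D.tail e' := by simp [hs₄, hf₃.1 6 (by decide), h6]
    have h411 : s₄.var 11 = D.head e := by simp [hs₄]
    have h45 : s₄.arr 5 = s₃.arr 5 := by simp [hs₄]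
    obtain ⟨-, -, q3, q4⟩ := follow_spec (s := s₄) (l := l) (by
      rw [hG₄, hE₄, hE₂, h₄.var_one, h46, h411, h45]; exact hl)
    obtain ⟨W, rfl, hW⟩ : ∃ W : List (Fin m), l = W.map Fin.val ∧
        ∀ a ∈ W, D.tail a ∉ N ∧ D.head a ∉ N := by
      have hmem := hl.mem
      clear hl q3 q4
      induction l with
      | nil => exact ⟨[], rfl, by simp⟩
      | cons j l ih =>
        obtain ⟨B, rfl, hB⟩ := ih fun i hi => hmem i (by simp [hi])
        obtain ⟨c, hc, rfl⟩ := (hmark' j).1 (hmem j (by simp))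
        exact ⟨c :: B, rfl, fun x hx => (List.mem_cons.1 hx).elim (fun h => h ▸ hc) (hB x)⟩
    have hw := hl.isWalk
    have hn := hl.nodup
    rw [h₂.isWalk_val] at hw
    rw [h₂.map_tail_val, List.nodup_map_iff Fin.val_injective] at hn
    refine ⟨W, Or.inl ⟨hw, hW, hn⟩, fun a => ?_, fun v => ?_⟩
    · have hiff : (a : ℕ) ∈ W.map Fin.val ↔ a ∈ W := by
        simp only [List.mem_map, Fin.val_inj, exists_eq_right]
      rw [q3, h17]
      by_cases ha : a ∈ W
      · rw [if_pos (hiff.2 ha)]; simp [ha]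
      · rw [if_neg fun hc => ha (hiff.1 hc)]; simp [ha]
    · have hiff : (v : ℕ) ∈ (W.map Fin.val).map s₄.graph.tail ↔ v ∈ W.map D.tail := by
        rw [h₄.map_tail_val, mem_map_val]
      rw [q4, h18]
      by_cases ha : v ∈ W.map D.tail
      · rw [if_pos (hiff.2 ha)]; simp only [ha, or_true, iff_true]; decide
      · rw [if_neg fun hc => ha (hiff.1 hc)]; simp only [ha, or_false]

theorem Rep.markPair_spec {s : State} (h : Rep D s) {N : Set (Fin n)}
    (hN : ∀ v : Fin n, s.arr 8 v ≠ 0 ↔ v ∈ N) {e e' : Fin m}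
    (he : s.arr 9 (s.var 22) = e) (he' : s.arr 10 (s.var 22) = e') :
    ∃ W, IsPathOrNone D N (D.head e) (D.tail e') W ∧
      (∀ a : Fin m, (markPair.run s).arr 17 a ≠ 0 ↔ s.arr 17 a ≠ 0 ∨ a = e ∨ a = e' ∨ a ∈ W) ∧
      ∀ v : Fin n, (markPair.run s).arr 18 v ≠ 0 ↔
        s.arr 18 v ≠ 0 ∨ ∃ a, (a = e ∨ a = e' ∨ a ∈ W) ∧ D.tail a = v := by
  obtain ⟨W, h1, h2, h3⟩ := h.connect_spec hN he he'
  have h' : Rep D (connect.run s) := h.frame (Cmd.frame_run _ s) (by decide) (by decide)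
  set u := connect.run s with hu
  have u22 : u.var 22 = s.var 22 := Cmd.run_var _ (by decide)
  have u9 : u.arr 9 = s.arr 9 := Cmd.run_arr _ (by decide)
  have u10 : u.arr 10 = s.arr 10 := Cmd.run_arr _ (by decide)
  have r17 : (markPair.run s).arr 17 =
      Function.update (Function.update (u.arr 17) e 1) e' 1 := by
    simp [markPair, ← hu, u22, u9, u10, he, he']
  have r18 : (markPair.run s).arr 18 =
      Function.update (Function.update (u.arr 18) (D.tail e) 1) (D.tail e') 1 := by
    simp [markPair, ← hu, u22, u9, u10, he, he', h'.tail_val]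
  refine ⟨W, h1, fun a => ?_, fun v => ?_⟩
  · rw [r17]
    simp only [Function.update_apply, Fin.val_inj]
    by_cases q1 : a = e' <;> by_cases q2 : a = e <;> (simp [q1, q2]; try tauto)
    have := h2 a
    tauto
  · rw [r18]
    simp only [Function.update_apply, Fin.val_inj]
    have hex : (∃ a, (a = e ∨ a = e' ∨ a ∈ W) ∧ D.tail a = v) ↔
        v = D.tail e' ∨ v = D.tail e ∨ v ∈ W.map D.tail := by
      simp only [List.mem_map]
      constructor
      · rintro ⟨a, rfl | rfl | ha, rfl⟩
        exacts [Or.inr (Or.inl rfl), Or.inl rfl, Or.inr (Or.inr ⟨a, ha, rfl⟩)]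
      · rintro (rfl | rfl | ⟨a, ha, rfl⟩)
        exacts [⟨e', by simp, rfl⟩, ⟨e, by simp, rfl⟩, ⟨a, by simp [ha], rfl⟩]
    rw [hex]
    by_cases q1 : v = D.tail e'
    · rw [if_pos q1]; simp [q1]
    · by_cases q2 : v = D.tail e
      · rw [if_neg q1, if_pos q2]; simp [q2]
      · rw [if_neg q1, if_neg q2, h3]; simp only [q1, q2, false_or]

/-- The marked arcs are those prescribed by the guess, and their tails are marked, too. -/
theorem Rep.markGuess_spec {s : State} (h : Rep D s) {F : Set (Fin m)}
    (hN : ∀ v : Fin n, s.arr 8 v ≠ 0 ↔ v ∈ D.tailSet F) {K : ℕ} (hK : s.var 4 = K)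
    {g : Fin K → Fin m × Fin m}
    (hg : ∀ i : Fin K, s.arr 9 i = (g i).1 ∧ s.arr 10 i = (g i).2) :
    D.IsMark F g ((markGuess.run s).arcs m 17) ∧
      ∀ v : Fin n, (markGuess.run s).arr 18 v ≠ 0 ↔
        ∃ a ∈ (markGuess.run s).arcs m 17, D.tail a = v := by
  set s₁ := (Cmd.loop 9 2 (.write 17 (.var 9) (.const 0))).run s with hs₁
  set s₂ := (Cmd.loop 9 1 (.write 18 (.var 9) (.const 0))).run s₁ with hs₂
  have h₁ : Rep D s₁ := h.frame (Cmd.frame_run _ s) (by decide) (by decide)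
  have h₂ : Rep D s₂ := h₁.frame (Cmd.frame_run _ s₁) (by decide) (by decide)
  have h17 : ∀ a : Fin m, s₂.arr 17 a = 0 := fun a => by
    have := fill_spec (s := s) (i := 9) (b := 2) (A := 17) (e := .const 0) (fun _ => 0)
      (fun _ _ _ _ _ _ => rfl)
    rw [← hs₁, h.var_two] at this
    rw [hs₂, Cmd.run_arr _ (by decide)]
    exact this a a.2
  have h18 : ∀ v : Fin n, s₂.arr 18 v = 0 := fun v =>
    clear_spec s₁ 18 v (by rw [h₁.var_one]; exact v.2)
  have fa : ∀ a, a ≠ 17 → a ≠ 18 → s₂.arr a = s.arr a := fun a q1 q2 => by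
    rw [hs₂, Cmd.run_arr _ (by simpa [Cmd.wa] using q2), hs₁,
      Cmd.run_arr _ (by simpa [Cmd.wa] using q1)]
  have h4 : s₂.var 4 = K := by
    rw [hs₂, Cmd.run_var _ (by decide), hs₁, Cmd.run_var _ (by decide), hK]
  have hrun : markGuess.run s = (Cmd.loop 22 4 markPair).run s₂ := rfl
  rw [hrun]
  have key := Cmd.loop_rule (s := s₂) (i := 22) (b := 4) (p := markPair)
    (fun j u => ∃ W : Fin K → List (Fin m),
      (∀ i : Fin K, (i : ℕ) < j →
        IsPathOrNone D (D.tailSet F) (D.head (g i).1) (D.tail (g i).2) (W i)) ∧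
      (∀ a : Fin m, u.arr 17 a ≠ 0 ↔
        ∃ i : Fin K, (i : ℕ) < j ∧ (a = (g i).1 ∨ a = (g i).2 ∨ a ∈ W i)) ∧
      ∀ v : Fin n, u.arr 18 v ≠ 0 ↔ ∃ i : Fin K, (i : ℕ) < j ∧
        ∃ a, (a = (g i).1 ∨ a = (g i).2 ∨ a ∈ W i) ∧ D.tail a = v) (by decide)
    ⟨fun _ => [], by simp, by simp [h17], by simp [h18]⟩ (fun j u hj hu hF hI => by
      obtain ⟨W, q1, q2, q3⟩ := hI
      have hu' : Rep D u := h₂.frame hF (by decide) (by decide)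
      rw [h4] at hj
      have u8 : u.arr 8 = s.arr 8 := by rw [hF.2 8 (by decide), fa 8 (by decide) (by decide)]
      have u9 : u.arr 9 = s.arr 9 := by rw [hF.2 9 (by decide), fa 9 (by decide) (by decide)]
      have u10 : u.arr 10 = s.arr 10 := by
        rw [hF.2 10 (by decide), fa 10 (by decide) (by decide)]
      obtain ⟨W', p1, p2, p3⟩ := hu'.markPair_spec (N := D.tailSet F) (by rwa [u8])
        (e := (g ⟨j, hj⟩).1) (e' := (g ⟨j, hj⟩).2) (by rw [u9, hu]; exact (hg ⟨j, hj⟩).1)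
        (by rw [u10, hu]; exact (hg ⟨j, hj⟩).2)
      have hne : ∀ i : Fin K, (i : ℕ) < j → Function.update W ⟨j, hj⟩ W' i = W i := fun i hi =>
        Function.update_of_ne (fun hc => by rw [hc] at hi; simp at hi) _ _
      have hsucc : ∀ P : Fin K → Prop, (∃ i : Fin K, (i : ℕ) < j + 1 ∧ P i) ↔
          (∃ i : Fin K, (i : ℕ) < j ∧ P i) ∨ P ⟨j, hj⟩ := by
        intro P
        constructor
        · rintro ⟨i, hi, hP⟩
          rcases Nat.lt_succ_iff_lt_or_eq.1 hi with hi | hi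
          · exact Or.inl ⟨i, hi, hP⟩
          · obtain rfl : i = ⟨j, hj⟩ := Fin.ext hi
            exact Or.inr hP
        · rintro (⟨i, hi, hP⟩ | hP)
          exacts [⟨i, by omega, hP⟩, ⟨⟨j, hj⟩, by simp, hP⟩]
      refine ⟨Function.update W ⟨j, hj⟩ W', fun i hi => ?_, fun a => ?_, fun v => ?_⟩
      · rcases Nat.lt_succ_iff_lt_or_eq.1 hi with hi | hi
        · rw [hne i hi]; exact q1 i hi
        · obtain rfl : i = ⟨j, hj⟩ := Fin.ext hi
          rw [Function.update_self]; exact p1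
      · rw [State.arr_setVar, p2, q2, hsucc, Function.update_self]
        refine or_congr_left (exists_congr fun i => and_congr_right fun hi => ?_)
        rw [hne i hi]
      · rw [State.arr_setVar, p3, q3, hsucc, Function.update_self]
        refine or_congr_left (exists_congr fun i => and_congr_right fun hi => ?_)
        rw [hne i hi])
  rw [h4] at key
  obtain ⟨W, q1, q2, q3⟩ := key
  refine ⟨⟨W, fun i => q1 i i.2, fun a => (q2 a).trans ?_⟩, fun v => (q3 v).trans ?_⟩
  · exact exists_congr fun i => and_iff_right i.2
  · constructor
    · rintro ⟨i, hi, a, ha, hv⟩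
      exact ⟨a, (q2 a).2 ⟨i, hi, ha⟩, hv⟩
    · rintro ⟨a, ha, hv⟩
      obtain ⟨i, hi, ha⟩ := (q2 a).1 ha
      exact ⟨i, hi, a, ha, hv⟩

end RAM

/-! ### Testing a guess -/

namespace RAM

open Multidigraph

variable {n m : ℕ} {D : Multidigraph (Fin n) (Fin m)}

open Cmd in
/-- Append the value of an expression to the output. -/
def emit (e : Exp) : Cmd := write 0 (.var 0) e ;; set 0 (.add (.var 0) (.const 1))

theorem output_congr {s s' : State} (h : s'.var 0 = s.var 0) (h' : s'.arr 0 = s.arr 0) :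
    output s' = output s := by
  simp only [output, h, h']

theorem output_emit (e : Exp) (s : State) :
    output ((emit e).run s) = output s ++ [e.eval s] := by
  simp only [output, emit, Cmd.run_seq, Cmd.run_write, Cmd.run_set, Exp.eval, State.var_setVar,
    State.arr_setVar, State.var_setArr, State.arr_setArr, if_true, List.range_succ, List.map_append,
    List.map_cons, List.map_nil, Function.update_self]
  congr 1
  refine List.map_congr_left fun i hi => ?_
  rw [Function.update_of_ne (List.mem_range.1 hi).ne]

/-- Run `p` for all values of `var 24` that are less than `var 12`. -/
def forList (p : Cmd) : Cmd := .loop 24 1 (.ite (.sub (.var 12) (.var 24)) p .skip)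

theorem forList_spec {α : Type*} {s : State} {p : Cmd} {L : List α} (f : α → List ℕ)
    (hwv : ∀ x, x ≠ 0 → x ∉ p.wv) (h12 : s.var 12 = L.length) (hle : L.length ≤ s.var 1)
    (hp : ∀ (j : ℕ) (hj : j < L.length) (u : State), u.var 24 = j →
      (∀ x, x ≠ 24 → x ≠ 0 → u.var x = s.var x) → (∀ a, a ∉ p.wa → u.arr a = s.arr a) →
      output (p.run u) = output u ++ f L[j]) :
    output ((forList p).run s) = output s ++ L.flatMap f := by
  have key := Cmd.loop_rule (s := s) (i := 24) (b := 1)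
    (p := .ite (.sub (.var 12) (.var 24)) p .skip)
    (fun j u => output u = output s ++ (L.take j).flatMap f)
    (by simpa [Cmd.wv] using hwv 24 (by decide))
    (by simpa using output_congr (by simp) (by simp)) (fun j u hj hu hF hI => by
      have hx : ∀ x, x ≠ 24 → x ≠ 0 → u.var x = s.var x := fun x h1 h2 =>
        hF.1 x (by simp [Cmd.wv, h1, hwv x h2])
      have hset : ∀ w : State, output (w.setVar 24 (j + 1)) = output w := fun w =>
        output_congr (by simp) (by simp)
      have hev : Exp.eval u (.sub (.var 12) (.var 24)) = L.length - j := by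
        simp [hu, hx 12 (by decide) (by decide), h12]
      rw [hset]
      by_cases hjl : j < L.length
      · rw [Cmd.run_ite_of_ne (by rw [hev]; omega),
          hp j hjl u hu hx (fun a ha => hF.2 a (by simpa [Cmd.wa] using ha)), hI,
          List.take_succ_eq_append_getElem hjl, List.flatMap_append, List.append_assoc]
        simp
      · rw [Cmd.run_ite_of_eq (by rw [hev]; omega), Cmd.run_skip, hI,
          List.take_of_length_le (by omega), List.take_of_length_le (by omega)])
  rw [List.take_of_length_le hle] at key
  exact key

open Cmd in
/-- Search for a cycle that avoids the vertices marked in the array `18`, and append it to the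
output. The variable `25` is set to `1` in the case of success. -/
def secondCycle : Cmd :=
  mark (.and (.not (.read 18 (.read 1 (.var 15)))) (.not (.read 18 (.read 2 (.var 15))))) ;;
    cycle ;;
    ite (.var 13)
      (emit (.var 12) ;;
        forList (emit (.read 1 (.read 16 (.var 24))) ;;
          ite (.sub (.var 2) (.read 16 (.var 24))) (emit (.read 16 (.var 24)))
            (emit (.sub (.read 16 (.var 24)) (.var 2)))) ;;
        set 25 (.const 1))
      skip

open Cmd in
/-- Test the guess in the arrays `9` and `10`, unless a pair of cycles has been found before. -/
def tryGuess : Cmd :=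
  ite (.var 25) skip
    (markGuess ;;
      mark (.and (.sub (.var 2) (.var 15)) (.or (.read 17 (.var 15))
        (.and (.read 7 (.var 15)) (.not (.read 18 (.read 1 (.var 15))))))) ;;
      cycle ;;
      ite (.var 13)
        (set 0 (.const 0) ;; emit (.const 1) ;; emit (.var 12) ;;
          forList (emit (.read 16 (.var 24))) ;; secondCycle)
        skip)

/-- The code of the second half of an answer. -/
def cycleCode (C : List (Fin n × Fin m)) : List ℕ :=
  C.length :: C.flatMap fun p => [(p.1 : ℕ), (p.2 : ℕ)]

/-- `U` is the set of the vertices that are not marked, in which the second cycle is searched for.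
-/
theorem Rep.secondCycle_spec {s : State} (h : Rep D s) {U : Set (Fin n)}
    (hU : ∀ v : Fin n, s.arr 18 v = 0 ↔ v ∈ U) (h25 : s.var 25 = 0) :
    ((secondCycle.run s).var 25 = 0 ∧ ¬ D.HasCyc U) ∨
      ((secondCycle.run s).var 25 = 1 ∧ ∃ C, D.IsCycle C ∧ (∀ p ∈ C, p.1 ∈ U) ∧
        output (secondCycle.run s) = output s ++ cycleCode C) := by
  set e : Exp := .and (.not (.read 18 (.read 1 (.var 15)))) (.not (.read 18 (.read 2 (.var 15))))
    with he
  set s₁ := (mark e).run s with hs₁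
  have hmark := mark_spec (s := s) (e := e)
    (p := fun j => s.arr 18 (s.arr 1 j) = 0 ∧ s.arr 18 (s.arr 2 j) = 0)
    (fun j u _ hu hv ha => by
      simp only [he, ne_eq, Exp.eval_and_eq_zero, Exp.eval_not_eq_zero, Exp.eval, hu,
        ha 18 (by decide), ha 1 (by decide), ha 2 (by decide), not_or, not_not])
  rw [← hs₁, h.var_three] at hmark
  have h₁ : Rep D s₁ := h.frame (Cmd.frame_run (mark e) s) (by simp [mark, Cmd.wv])
    (by simp [mark, Cmd.wa])
  have hout₁ : output s₁ = output s :=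
    output_congr (Cmd.run_var _ (by simp [mark, Cmd.wv])) (Cmd.run_arr _ (by simp [mark, Cmd.wa]))
  have h25₁ : s₁.var 25 = 0 := by
    rw [hs₁, Cmd.run_var _ (by simp [mark, Cmd.wv]), h25]
  set s₂ := cycle.run s₁ with hs₂
  have h₂ : Rep D s₂ := h₁.frame (Cmd.frame_run _ s₁) (by decide) (by decide)
  have hout₂ : output s₂ = output s := by
    rw [← hout₁]
    exact output_congr (Cmd.run_var _ (by decide)) (Cmd.run_arr _ (by decide))
  have h25₂ : s₂.var 25 = 0 := by rw [hs₂, Cmd.run_var _ (by decide), h25₁]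
  have hspec := h₁.ucycle_spec (U := U) (fun j => by
    rw [hmark]
    constructor
    · rintro ⟨hj, h1, h2⟩
      obtain ⟨i, rfl⟩ := exists_idx hj
      rw [h.tail_eq, hU] at h1
      rw [h.head_eq, hU] at h2
      exact ⟨i, ⟨h1, h2⟩, rfl⟩
    · rintro ⟨i, ⟨h1, h2⟩, rfl⟩
      rw [h.tail_eq, h.head_eq, hU, hU]
      exact ⟨idx_lt i, h1, h2⟩)
  rw [← hs₂] at hspec
  rcases hspec with ⟨h1, h2⟩ | ⟨h1, L, h2, h3, h4, h5⟩
  · have hrun : secondCycle.run s = s₂ :=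
      Cmd.run_ite_of_eq (show Exp.eval s₂ (.var 13) = 0 from h1) _ _
    rw [hrun]
    exact Or.inl ⟨h25₂, h2⟩
  · set p : Cmd := .seq (emit (.read 1 (.read 16 (.var 24))))
      (.ite (.sub (.var 2) (.read 16 (.var 24))) (emit (.read 16 (.var 24)))
            (emit (.sub (.read 16 (.var 24)) (.var 2)))) with hp
    set s₃ := (emit (.var 12)).run s₂ with hs₃
    have hrun : secondCycle.run s = ((forList p).run s₃).setVar 25 1 :=
      Cmd.run_ite_of_ne (show Exp.eval s₂ (.var 13) ≠ 0 by rw [Exp.eval, h1]; decide) _ _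
    have h₃ : Rep D s₃ := h₂.frame (Cmd.frame_run _ s₂) (by decide) (by decide)
    have hlen : L.length ≤ n := by
      have := h2.2.1.length_le_card
      simpa using this
    have hwa : p.wa = [0, 0, 0] := rfl
    have hwv : p.wv = [0, 0, 0] := rfl
    have key := forList_spec (s := s₃) (p := p) (L := L)
      (fun j => [(D.sym.tail j : ℕ), ((arc j : Fin m) : ℕ)]) (by simp [hwv])
      (by rw [hs₃, Cmd.run_var _ (by decide), h4]) (by rw [h₃.var_one]; exact hlen) (by
        intro j hj u hu huv hua
        rw [hwa] at hua
        have hu16 : u.arr 16 j = idx L[j] := by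
          rw [hua 16 (by decide), hs₃, Cmd.run_arr _ (by decide), h5 j (by simpa using hj)]
          simp [hj]
        have hu1 : u.arr 1 (idx L[j]) = D.sym.tail L[j] := by
          rw [hua 1 (by decide), h₃.tail_eq]
        have hu2 : u.var 2 = m := by rw [huv 2 (by decide) (by decide), h₃.var_two]
        set w := (emit (.read 1 (.read 16 (.var 24)))).run u with hw
        have w24 : w.var 24 = j := by rw [hw, Cmd.run_var _ (by decide), hu]
        have w16 : w.arr 16 j = idx L[j] := by rw [hw, Cmd.run_arr _ (by decide), hu16]
        have w2 : w.var 2 = m := by rw [hw, Cmd.run_var _ (by decide), hu2]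
        have hwo : output w = output u ++ [(D.sym.tail L[j] : ℕ)] := by
          rw [hw, output_emit]
          simp only [Exp.eval, hu, hu16, hu1]
        have hev : Exp.eval w (.sub (.var 2) (.read 16 (.var 24))) = m - idx L[j] := by
          simp only [Exp.eval, w24, w16, w2]
        have hpr : p.run u = (Cmd.ite (.sub (.var 2) (.read 16 (.var 24)))
          (emit (.read 16 (.var 24))) (emit (.sub (.read 16 (.var 24)) (.var 2)))).run w := rfl
        rw [hpr]
        rcases hLj : L[j] with a | a <;> rw [hLj] at hev w16 hwo
        · rw [Cmd.run_ite_of_ne (by rw [hev, idx_inl]; omega), output_emit, hwo]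
          simp only [Exp.eval, w24, w16, idx_inl, arc_inl, List.append_assoc, List.cons_append,
            List.nil_append]
        · rw [Cmd.run_ite_of_eq (by rw [hev, idx_inr]; omega), output_emit, hwo]
          simp only [Exp.eval, w24, w16, w2, idx_inr, arc_inr, List.append_assoc, List.cons_append,
            List.nil_append, Nat.add_sub_cancel_left])
    refine Or.inr ⟨by simp [hrun], _, h2, ?_, ?_⟩
    · intro q hq
      obtain ⟨j, hj, rfl⟩ := List.mem_map.1 hq
      exact h3 j hj
    · have : output (secondCycle.run s) = output ((forList p).run s₃) := by
        rw [hrun]; exact output_congr (by simp) (by simp)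
      rw [this, key, hs₃, output_emit, hout₂]
      simp [cycleCode, h4, List.flatMap_map]

/-- The memory during the tests of guesses: the arrays `7` and `8` mark the arcs and the vertices
of `F`. -/
structure Base (D : Multidigraph (Fin n) (Fin m)) (F : Set (Fin m)) (K : ℕ) (s : State) : Prop
    extends Rep D s where
  arcs_eq : s.arcs m 7 = F
  mem_tailSet : ∀ v : Fin n, s.arr 8 v ≠ 0 ↔ v ∈ D.tailSet F
  var_four : s.var 4 = K

theorem Base.of_eq {F : Set (Fin m)} {K : ℕ} {s s' : State} (h : Base D F K s)
    (hv : ∀ x ∈ [1, 2, 3, 4, 5], s'.var x = s.var x)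
    (ha : ∀ a ∈ [1, 2, 7, 8], s'.arr a = s.arr a) : Base D F K s' := by
  refine ⟨h.toRep.of_eq (fun x hx => hv x ?_) (fun a hx => ha a ?_), ?_, ?_, ?_⟩
  · simp only [List.mem_cons] at hx ⊢; tauto
  · simp only [List.mem_cons] at hx ⊢; tauto
  · rw [← h.arcs_eq]; simp only [State.arcs, ha 7 (by simp)]
  · rw [ha 8 (by simp)]; exact h.mem_tailSet
  · rw [hv 4 (by simp), h.var_four]

theorem Base.frame {F : Set (Fin m)} {K : ℕ} {s s' : State} {p : Cmd} (h : Base D F K s)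
    (hf : p.Frame s s') (hv : ∀ x ∈ [1, 2, 3, 4, 5], x ∉ p.wv)
    (ha : ∀ a ∈ [1, 2, 7, 8], a ∉ p.wa) : Base D F K s' :=
  h.of_eq (fun x hx => hf.1 x (hv x hx)) fun a hx => hf.2 a (ha a hx)

/-- The guess `g` does not lead to a solution in the way it should. -/
def Fails (D : Multidigraph (Fin n) (Fin m)) (F : Set (Fin m)) {K : ℕ}
    (g : Fin K → Fin m × Fin m) : Prop :=
  ∃ Mk, D.IsMark F g Mk ∧ ¬ ((∃ B, D.IsDicycle B ∧ ∀ a ∈ B, a ∈ D.allowed F Mk) ∧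
    ∀ B, D.IsDicycle B → (∀ a ∈ B, a ∈ D.allowed F Mk) → D.HasCyc {v | v ∉ B.map D.tail})

/-- The output is a correct answer, different from "no". -/
def Solved (D : Multidigraph (Fin n) (Fin m)) (s : State) : Prop :=
  ∃ B C, D.IsDisjointPair B C ∧ output s = encodeAnswer (some (B, C))

/-- The test of a guess either finds a pair of cycles or shows that the guess fails. -/
theorem Base.tryGuess_spec {F : Set (Fin m)} {K : ℕ} {s : State} (h : Base D F K s)
    {g : Fin K → Fin m × Fin m}
    (hg : ∀ i : Fin K, s.arr 9 i = (g i).1 ∧ s.arr 10 i = (g i).2) (h25 : s.var 25 = 0) :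
    ((tryGuess.run s).var 25 = 0 ∧ Fails D F g) ∨
      ((tryGuess.run s).var 25 = 1 ∧ Solved D (tryGuess.run s)) := by
  set s₁ := markGuess.run s with hs₁
  have h₁ : Base D F K s₁ := h.frame (Cmd.frame_run _ s) (by decide) (by decide)
  obtain ⟨hM, h18⟩ := h.toRep.markGuess_spec h.mem_tailSet h.var_four hg
  rw [← hs₁] at hM h18
  set Mk := s₁.arcs m 17 with hMk
  set e : Exp := .and (.sub (.var 2) (.var 15)) (.or (.read 17 (.var 15))
        (.and (.read 7 (.var 15)) (.not (.read 18 (.read 1 (.var 15)))))) with he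
  set s₂ := (mark e).run s₁ with hs₂
  have hmark := mark_spec (s := s₁) (e := e)
    (p := fun j => j < m ∧ (s₁.arr 17 j ≠ 0 ∨ (s₁.arr 7 j ≠ 0 ∧ s₁.arr 18 (s₁.arr 1 j) = 0)))
    (fun j u _ hu hv ha => by
      simp only [he, ne_eq, Exp.eval_and_eq_zero, Exp.eval_or_eq_zero, Exp.eval_not_eq_zero,
        Exp.eval, hu, hv 2 (by decide), ha 17 (by decide), ha 18 (by decide), ha 1 (by decide),
        ha 7 (by decide), h₁.var_two, not_or, not_not, not_and_or]
      rw [Nat.sub_eq_zero_iff_le, not_le])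
  rw [← hs₂, h₁.var_three] at hmark
  have h₂ : Rep D s₂ := h₁.toRep.frame (Cmd.frame_run (mark e) s₁) (by simp [mark, Cmd.wv])
    (by simp [mark, Cmd.wa])
  have hkey : ∀ b : Fin m, (s₁.arr 17 b ≠ 0 ∨ (s₁.arr 7 b ≠ 0 ∧ s₁.arr 18 (s₁.arr 1 b) = 0)) ↔
      b ∈ D.allowed F Mk := by
    intro b
    refine or_congr Iff.rfl (and_congr ?_ ?_)
    · rw [← h₁.arcs_eq]; rfl
    · rw [h₁.tail_val]
      have := h18 (D.tail b)
      constructor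
      · exact fun h0 a ha hab => this.2 ⟨a, ha, hab⟩ h0
      · intro h0
        by_contra hc
        obtain ⟨a, ha, hab⟩ := this.1 hc
        exact h0 a ha hab
  have hspec := h₂.dicycle_spec (S := D.allowed F Mk) (fun j => by
    rw [hmark]
    constructor
    · rintro ⟨-, hj, h1⟩
      exact ⟨⟨j, hj⟩, (hkey ⟨j, hj⟩).1 h1, rfl⟩
    · rintro ⟨b, h1, rfl⟩
      exact ⟨by omega, b.2, (hkey b).2 h1⟩)
  set s₃ := cycle.run s₂ with hs₃
  have h₃ : Rep D s₃ := h₂.frame (Cmd.frame_run _ s₂) (by decide) (by decide)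
  have h25₃ : s₃.var 25 = 0 := by
    rw [hs₃, Cmd.run_var _ (by decide), hs₂, Cmd.run_var _ (by simp [mark, Cmd.wv]), hs₁,
      Cmd.run_var _ (by decide), h25]
  set s₀ : Cmd := .seq (.set 0 (.const 0)) (.seq (emit (.const 1)) (.seq (emit (.var 12))
    (.seq (forList (emit (.read 16 (.var 24)))) secondCycle))) with hs₀
  have hrun : tryGuess.run s = (Cmd.ite (.var 13) s₀ .skip).run s₃ :=
    Cmd.run_ite_of_eq (show Exp.eval s (.var 25) = 0 from h25) _ _
  rcases hspec with ⟨h1, h2⟩ | ⟨h1, B, h2, h3, h4, h5, h6⟩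
  · rw [Cmd.run_ite_of_eq (show Exp.eval s₃ (.var 13) = 0 from h1), Cmd.run_skip] at hrun
    rw [hrun]
    exact Or.inl ⟨h25₃, Mk, hM, fun hc => h2 hc.1⟩
  · rw [Cmd.run_ite_of_ne (show Exp.eval s₃ (.var 13) ≠ 0 by rw [Exp.eval, h1]; decide)] at hrun
    set s₄ := s₃.setVar 0 0 with hs₄
    set s₅ := (emit (.const 1)).run s₄ with hs₅
    set s₆ := (emit (.var 12)).run s₅ with hs₆
    set s₇ := (forList (emit (.read 16 (.var 24)))).run s₆ with hs₇
    have hrun' : tryGuess.run s = secondCycle.run s₇ := hrun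
    have fv : ∀ x, x ≠ 0 → s₆.var x = s₃.var x := fun x hx => by
      rw [hs₆, Cmd.run_var _ (by simpa [emit, Cmd.wv] using hx), hs₅,
        Cmd.run_var _ (by simpa [emit, Cmd.wv] using hx)]
      simp [hs₄, hx]
    have fa : ∀ x, x ≠ 0 → s₆.arr x = s₃.arr x := fun x hx => by
      rw [hs₆, Cmd.run_arr _ (by simpa [emit, Cmd.wa] using hx), hs₅,
        Cmd.run_arr _ (by simpa [emit, Cmd.wa] using hx)]
      simp [hs₄]
    have h₆ : Rep D s₆ := h₃.of_eq (fun x hx => fv x (by rintro rfl; simp at hx))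
      (fun x hx => fa x (by rintro rfl; simp at hx))
    have h₇ : Rep D s₇ := h₆.frame (Cmd.frame_run _ s₆) (by decide) (by decide)
    have hlen : B.length ≤ n := by
      have := h2.2.1.length_le_card
      simpa using this
    have hfor := forList_spec (s := s₆) (p := emit (.read 16 (.var 24))) (L := B)
      (fun a => [(a : ℕ)]) (by simp [emit, Cmd.wv]) (by rw [fv 12 (by decide), h4])
      (by rw [h₆.var_one]; exact hlen) (fun j hj u hu _ hua => by
        rw [output_emit]
        simp only [Exp.eval, hu]
        rw [hua 16 (by decide), fa 16 (by decide), h5 j (by simpa using hj)]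
        simp [hj])
    have hout₄ : output s₄ = [] := by simp [output, hs₄]
    rw [← hs₇, hs₆, output_emit, hs₅, output_emit, hout₄] at hfor
    have h12 : Exp.eval ((emit (.const 1)).run s₄) (.var 12) = B.length := by
      rw [Exp.eval, Cmd.run_var _ (by decide)]
      simp [hs₄, h4]
    rw [h12] at hfor
    have hsec := h₇.secondCycle_spec (U := {v | v ∉ B.map D.tail}) (fun v => by
      rw [hs₇, Cmd.run_arr _ (by decide), fa 18 (by decide), Set.mem_ofPred_eq, ← h6, not_not])
      (by rw [hs₇, Cmd.run_var _ (by decide), fv 25 (by decide), h25₃])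
    rw [← hrun'] at hsec
    rcases hsec with ⟨q1, q2⟩ | ⟨q1, C, q2, q3, q4⟩
    · exact Or.inl ⟨q1, Mk, hM, fun hc => q2 (hc.2 B h2 h3)⟩
    · refine Or.inr ⟨q1, B, C, ⟨h2, q2, ?_⟩, ?_⟩
      · rw [Set.disjoint_left]
        intro v hv hv'
        obtain ⟨p, hp, rfl⟩ := List.mem_map.1 hv'
        exact q3 p hp hv
      · rw [q4, hfor]
        simp [encodeAnswer, cycleCode]

end RAM

/-! ### Testing all guesses -/

namespace RAM

open Multidigraph

variable {n m : ℕ} {D : Multidigraph (Fin n) (Fin m)}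

open Cmd in
/-- Run `p` for all values less than `var 2` of the entry number `j` of the array `A`. -/
def each (x A j : ℕ) (p : Cmd) : Cmd := loop x 2 (write A (.const j) (.var x) ;; p)

/-- The invariants do not depend on the loop variable `x`. -/
theorem each_rule {x A j : ℕ} {p : Cmd} {s : State} (Inv : ℕ → State → Prop) (hx : x ∉ p.wv)
    (hset : ∀ a u v, Inv a u → Inv a (u.setVar x v)) (h0 : Inv 0 s)
    (hs : ∀ a u, a < s.var 2 → Inv a u → Inv (a + 1) (p.run (u.setArr A j a))) :
    Inv (s.var 2) ((each x A j p).run s) := by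
  refine Cmd.loop_rule Inv (by simpa [Cmd.wv] using hx) (hset _ _ _ h0) fun a u ha hu _ hI =>
    hset _ _ _ ?_
  have := hs a u ha hI
  rwa [← hu] at this ⊢

/-- Run `tryGuess` for all guesses of the first `j` pairs of arcs. -/
def tryAll : ℕ → Cmd
  | 0 => tryGuess
  | j + 1 => each (26 + 2 * j) 9 j (each (27 + 2 * j) 10 j (tryAll j))

theorem lt_of_mem_wv_tryAll {x : ℕ} : ∀ {j : ℕ}, x ∈ (tryAll j).wv →
    x < 26 + 2 * j ∧ x ∉ [1, 2, 3, 4, 5]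
  | 0, h => by
      have : ∀ x ∈ tryGuess.wv, x < 26 ∧ x ∉ [1, 2, 3, 4, 5] := by decide
      simpa using this x h
  | j + 1, h => by
      simp only [tryAll, each, Cmd.wv, List.mem_cons, List.nil_append] at h
      rcases h with rfl | rfl | h
      · simp; omega
      · simp; omega
      · have := lt_of_mem_wv_tryAll h
        exact ⟨by omega, this.2⟩

theorem notMem_wa_tryAll {a : ℕ} (ha : a ∈ [1, 2, 7, 8]) : ∀ j : ℕ, a ∉ (tryAll j).wa
  | 0 => by
      have : ∀ a ∈ [1, 2, 7, 8], a ∉ tryGuess.wa := by decide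
      exact this a ha
  | j + 1 => by
      have := notMem_wa_tryAll ha j
      simp only [tryAll, each, Cmd.wa, List.mem_append, List.mem_singleton]
      rintro (rfl | rfl | h)
      · simp at ha
      · simp at ha
      · exact this h

theorem ok_tryAll : ∀ j : ℕ, (tryAll j).ok = true
  | 0 => by decide
  | j + 1 => by
      have h1 : 27 + 2 * j ∉ (tryAll j).wv := fun h => by
        have := (lt_of_mem_wv_tryAll h).1; omega
      have h2 : 26 + 2 * j ∉ (tryAll j).wv := fun h => by
        have := (lt_of_mem_wv_tryAll h).1; omega
      simp only [tryAll, each, Cmd.ok, Cmd.wv, ok_tryAll j, List.nil_append, List.mem_cons, h1, h2]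
      simp
      omega

theorem notMem_wv_tryAll {x j : ℕ} (hx : 26 + 2 * j ≤ x) : x ∉ (tryAll j).wv := fun h => by
  have := (lt_of_mem_wv_tryAll h).1
  omega

theorem notMem_wv_each {j : ℕ} (A : ℕ) :
    26 + 2 * j ∉ (each (27 + 2 * j) A j (tryAll j)).wv := by
  simp only [each, Cmd.wv, List.nil_append, List.mem_cons, not_or]
  exact ⟨by omega, notMem_wv_tryAll (by omega)⟩

/-- A pair of cycles has been found and written to the output. -/
def Done (D : Multidigraph (Fin n) (Fin m)) (s : State) : Prop := s.var 25 = 1 ∧ Solved D s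

theorem Done.of_eq {s s' : State} (h : Done D s) (h0 : s'.var 0 = s.var 0)
    (h25 : s'.var 25 = s.var 25) (ha : s'.arr 0 = s.arr 0) : Done D s' := by
  refine ⟨h25.trans h.1, ?_⟩
  obtain ⟨B, C, h1, h2⟩ := h.2
  exact ⟨B, C, h1, (output_congr h0 ha).trans h2⟩

theorem Done.setVar {s : State} (h : Done D s) {x : ℕ} (hx : 26 ≤ x) (v : ℕ) :
    Done D (s.setVar x v) := by
  refine h.of_eq ?_ ?_ rfl <;> rw [State.var_setVar, if_neg (by omega)]

theorem Done.setArr {s : State} (h : Done D s) {A : ℕ} (hA : A ≠ 0) (i v : ℕ) :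
    Done D (s.setArr A i v) := by
  refine h.of_eq rfl rfl ?_
  rw [State.arr_setArr, if_neg hA.symm]

theorem Done.tryAll : ∀ (j : ℕ) {s : State}, Done D s → Done D ((tryAll j).run s)
  | 0, s, h => by
      have : tryGuess.run s = s :=
        Cmd.run_ite_of_ne (show Exp.eval s (.var 25) ≠ 0 by rw [Exp.eval, h.1]; decide) _ _
      change Done D (tryGuess.run s)
      rwa [this]
  | j + 1, s, h =>
      each_rule (fun _ u => Done D u) (notMem_wv_each 10) (fun _ _ v hu => hu.setVar (by omega) v) h
        fun _ u _ hu => each_rule (s := u.setArr 9 j _) (fun _ u => Done D u)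
          (notMem_wv_tryAll (by omega)) (fun _ _ v hu => hu.setVar (by omega) v)
          (hu.setArr (by decide) _ _) fun _ _ _ hw => Done.tryAll j (hw.setArr (by decide) _ _)

/-- Only the first `j` pairs of the guess are changed. -/
theorem tryAll_arr {i c d : ℕ} : ∀ {j : ℕ}, j ≤ i → ∀ {s : State},
    s.arr 9 i = c ∧ s.arr 10 i = d →
    ((tryAll j).run s).arr 9 i = c ∧ ((tryAll j).run s).arr 10 i = d
  | 0, _, s, h => by
      change (tryGuess.run s).arr 9 i = _ ∧ (tryGuess.run s).arr 10 i = _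
      rwa [Cmd.run_arr s (by decide), Cmd.run_arr s (by decide)]
  | j + 1, hj, s, h => by
      have hne : i ≠ j := by omega
      refine each_rule (fun _ u => u.arr 9 i = c ∧ u.arr 10 i = d) (notMem_wv_each 10)
        (fun _ _ _ hu => hu) h fun a u _ hu => ?_
      refine each_rule (s := u.setArr 9 j _) (fun _ u => u.arr 9 i = c ∧ u.arr 10 i = d)
        (notMem_wv_tryAll (by omega)) (fun _ _ _ hu => hu)
        (by simpa [Function.update_of_ne hne] using hu) fun b w _ hw => ?_
      exact tryAll_arr (by omega) (by simpa [Function.update_of_ne hne] using hw)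

theorem Base.tryAll {F : Set (Fin m)} {K j : ℕ} {s : State} (h : Base D F K s) :
    Base D F K ((tryAll j).run s) :=
  h.frame (Cmd.frame_run _ s) (fun _ hx h => (lt_of_mem_wv_tryAll h).2 hx)
    fun _ ha => notMem_wa_tryAll ha j

theorem Base.setVar {F : Set (Fin m)} {K : ℕ} {s : State} (h : Base D F K s) {x : ℕ} (hx : 26 ≤ x)
    (v : ℕ) : Base D F K (s.setVar x v) :=
  h.of_eq (fun y hy => by
    have : y ≠ x := by rintro rfl; simp at hy; omega
    simp [this]) fun _ _ => rfl

theorem Base.setArr {F : Set (Fin m)} {K : ℕ} {s : State} (h : Base D F K s) {A : ℕ}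
    (hA : A ∉ [1, 2, 7, 8]) (i v : ℕ) : Base D F K (s.setArr A i v) :=
  h.of_eq (fun _ _ => rfl) fun a ha => by
    have : a ≠ A := fun hc => hA (hc ▸ ha)
    simp [this]

/-- The arrays `9` and `10` contain the guess `g`, except perhaps its first `j` pairs. -/
def Agrees {K : ℕ} (j : ℕ) (s : State) (g : Fin K → Fin m × Fin m) : Prop :=
  ∀ i : Fin K, j ≤ i → s.arr 9 i = (g i).1 ∧ s.arr 10 i = (g i).2

/-- Either a pair of cycles has been found, or all guesses in `Q` fail. -/
def Outcome (D : Multidigraph (Fin n) (Fin m)) (F : Set (Fin m)) {K : ℕ}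
    (Q : (Fin K → Fin m × Fin m) → Prop) (s : State) : Prop :=
  Done D s ∨ (s.var 25 = 0 ∧ ∀ g, Q g → Fails D F g)

theorem Outcome.setVar {F : Set (Fin m)} {K : ℕ} {Q : (Fin K → Fin m × Fin m) → Prop} {s : State}
    (h : Outcome D F Q s) {x : ℕ} (hx : 26 ≤ x) (v : ℕ) : Outcome D F Q (s.setVar x v) := by
  rcases h with h | h
  · exact Or.inl (h.setVar hx v)
  · refine Or.inr ⟨?_, h.2⟩
    rw [State.var_setVar, if_neg (by omega), h.1]

/-- The parts of the arrays `9` and `10` with indices at least `j` are the same in `s` and `u`. -/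
def SameFrom (j : ℕ) (s u : State) : Prop :=
  ∀ i, j ≤ i → u.arr 9 i = s.arr 9 i ∧ u.arr 10 i = s.arr 10 i

theorem SameFrom.setArr {j A v : ℕ} {s u : State} (h : SameFrom (j + 1) s u) :
    SameFrom (j + 1) s (u.setArr A j v) := fun i hi => by
  have hne : i ≠ j := by omega
  have key : ∀ B, (u.setArr A j v).arr B i = u.arr B i := fun B => by
    by_cases hB : B = A
    · subst hB; simp [Function.update_of_ne hne]
    · simp [hB]
  rw [key, key]
  exact h i hi

/-- If the later pairs of arcs are valid, then `tryAll j` tests all guesses that have these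
later pairs. Validity matters, since a test with an entry that is no arc need not be meaningful. -/
theorem Base.tryAll_spec {F : Set (Fin m)} {K : ℕ} : ∀ {j : ℕ}, j ≤ K → ∀ {s : State},
    Base D F K s → s.var 25 = 0 → (∃ g : Fin K → Fin m × Fin m, Agrees j s g) →
    Outcome D F (Agrees (K := K) j s) ((RAM.tryAll j).run s)
  | 0, _, s, h, h25, ⟨g, hg⟩ => by
      have hg' := fun i => hg i (Nat.zero_le _)
      rcases h.tryGuess_spec hg' h25 with ⟨h1, h2⟩ | ⟨h1, h2⟩
      · refine Or.inr ⟨h1, fun g' hg'' => ?_⟩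
        have : g' = g := funext fun i => Prod.ext
          (Fin.ext ((hg'' i (Nat.zero_le _)).1.symm.trans (hg' i).1))
          (Fin.ext ((hg'' i (Nat.zero_le _)).2.symm.trans (hg' i).2))
        rwa [this]
      · exact Or.inl ⟨h1, h2⟩
  | j + 1, hj, s, h, h25, ⟨g₀, hg₀⟩ => by
      set y : Fin K := ⟨j, hj⟩ with hy
      have outer := each_rule (x := 26 + 2 * j) (A := 9) (j := j)
        (p := each (27 + 2 * j) 10 j (RAM.tryAll j)) (s := s)
        (fun a u => Base D F K u ∧ SameFrom (j + 1) s u ∧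
          Outcome D F (fun g : Fin K → Fin m × Fin m => Agrees (j + 1) s g ∧ (g y).1 < a) u)
        (notMem_wv_each 10)
        (fun a u v hu => ⟨hu.1.setVar (by omega) v, hu.2.1, hu.2.2.setVar (by omega) v⟩)
        ⟨h, fun _ _ => ⟨rfl, rfl⟩, Or.inr ⟨h25, fun g hg => absurd hg.2 (Nat.not_lt_zero _)⟩⟩
        fun a u ha hu => ?_
      · obtain ⟨-, -, h1 | ⟨h1, h2⟩⟩ := outer
        · exact Or.inl h1
        · exact Or.inr ⟨h1, fun g hg => h2 g ⟨hg, by rw [h.var_two]; exact (g y).1.2⟩⟩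
      · rw [h.var_two] at ha
        set u' := u.setArr 9 j a with hu'
        have hB' : Base D F K u' := hu.1.setArr (by decide) _ _
        have inner := each_rule (x := 27 + 2 * j) (A := 10) (j := j) (p := RAM.tryAll j) (s := u')
          (fun b w => Base D F K w ∧ SameFrom (j + 1) s w ∧ w.arr 9 j = a ∧
            Outcome D F (fun g : Fin K → Fin m × Fin m => Agrees (j + 1) s g ∧
              ((g y).1 < a ∨ ((g y).1 : ℕ) = a ∧ (g y).2 < b)) w)
          (notMem_wv_tryAll (by omega))
          (fun b w v hw =>
            ⟨hw.1.setVar (by omega) v, hw.2.1, hw.2.2.1, hw.2.2.2.setVar (by omega) v⟩)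
          ⟨hB', hu.2.1.setArr, by simp [hu'], ?_⟩ fun b w hb hw => ?_
        · obtain ⟨h1, h2, -, h3⟩ := inner
          refine ⟨h1, h2, h3.imp id fun h4 => ⟨h4.1, fun g hg => h4.2 g ⟨hg.1, ?_⟩⟩⟩
          rw [hB'.var_two]
          have := (g y).2.2
          have := hg.2
          omega
        · refine hu.2.2.imp (fun h1 => h1.setArr (by decide) _ _) fun h1 => ⟨h1.1, fun g hg => ?_⟩
          exact h1.2 g ⟨hg.1, hg.2.resolve_right fun hc => Nat.not_lt_zero _ hc.2⟩
        · rw [hB'.var_two] at hb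
          obtain ⟨hBw, hSw, h9, hO⟩ := hw
          set w' := w.setArr 10 j b with hw'
          have hBw' : Base D F K w' := hBw.setArr (by decide) _ _
          have hSw' : SameFrom (j + 1) s w' := hSw.setArr
          have h9' : w'.arr 9 j = a := by simp [hw', h9]
          have h10' : w'.arr 10 j = b := by simp [hw']
          have hagree : ∀ g : Fin K → Fin m × Fin m, Agrees (j + 1) s g → ((g y).1 : ℕ) = a →
              ((g y).2 : ℕ) = b → Agrees j w' g := by
            intro g hg h1 h2 i hi
            rcases hi.lt_or_eq with hlt | heq
            · have := hSw' i hlt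
              rw [this.1, this.2]
              exact hg i hlt
            · have : i = y := Fin.ext heq.symm
              rw [this, h1, h2]
              exact ⟨h9', h10'⟩
          refine ⟨hBw'.tryAll, fun i hi => tryAll_arr (by omega) (hSw' i hi),
            (tryAll_arr le_rfl ⟨h9', h10'⟩).1, ?_⟩
          rcases hO with hD | ⟨hO1, hO2⟩
          · exact Or.inl ((hD.setArr (by decide) _ _).tryAll j)
          · have hex : ∃ g : Fin K → Fin m × Fin m, Agrees j w' g := by
              refine ⟨Function.update g₀ y (⟨a, ha⟩, ⟨b, hb⟩), hagree _ (fun i hi => ?_) (by simp)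
                (by simp)⟩
              have : i ≠ y := by rintro rfl; simp [hy] at hi
              rw [Function.update_of_ne this]
              exact hg₀ i hi
            refine (Base.tryAll_spec (by omega) hBw' hO1 hex).imp id fun h1 =>
              ⟨h1.1, fun g hg => ?_⟩
            by_cases hlast : ((g y).1 : ℕ) = a ∧ ((g y).2 : ℕ) = b
            · exact h1.2 g (hagree g hg.1 hlast.1 hlast.2)
            · refine hO2 g ⟨hg.1, ?_⟩
              have := hg.2
              omega

end RAM

/-! ### The whole algorithm -/

theorem List.getElem?_flatMap_pair {α : Type*} (f g : α → ℕ) : ∀ (l : List α) (i : ℕ),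
    (l.flatMap fun a => [f a, g a])[2 * i]? = l[i]?.map f ∧
      (l.flatMap fun a => [f a, g a])[2 * i + 1]? = l[i]?.map g
  | [], i => by simp
  | a :: l, 0 => by simp
  | a :: l, i + 1 => by
      have := List.getElem?_flatMap_pair f g l i
      simp only [List.flatMap_cons, List.cons_append, List.nil_append,
        show 2 * (i + 1) = 2 * i + 1 + 1 by ring, List.getElem?_cons_succ]
      exact this

namespace RAM

open Multidigraph

variable {n m : ℕ} {D : Multidigraph (Fin n) (Fin m)}

theorem getD_encode_tail (a : Fin m) : D.encode.getD (2 * a + 2) 0 = D.tail a := by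
  have := (List.getElem?_flatMap_pair (fun a => (D.tail a : ℕ)) (fun a => (D.head a : ℕ))
    (List.finRange m) a).1
  simp only [encode, List.getD_eq_getElem?_getD, List.getElem?_cons_succ]
  rw [this]
  simp

theorem getD_encode_head (a : Fin m) : D.encode.getD (2 * a + 3) 0 = D.head a := by
  have := (List.getElem?_flatMap_pair (fun a => (D.tail a : ℕ)) (fun a => (D.head a : ℕ))
    (List.finRange m) a).2
  simp only [encode, List.getD_eq_getElem?_getD, List.getElem?_cons_succ]
  rw [this]
  simp

open Cmd in
/-- Read the numbers of vertices and arcs, and set the bounds of all loops. This is the only part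
of the algorithm that changes the variables `1, …, 5`. -/
def setup (K : ℕ) : Cmd :=
  set 1 (.read 0 (.const 0)) ;; set 2 (.read 0 (.const 1)) ;; set 3 (.add (.var 2) (.var 2)) ;;
    set 4 (.const K) ;; set 5 (.add (.var 1) (.const 1))

open Cmd in
/-- Write the arc with the number `var 9` and its reverse to the arrays `1` and `2`. -/
def loadArc : Cmd :=
  write 1 (.var 9) (.read 0 (.add (.add (.var 9) (.var 9)) (.const 2))) ;;
  write 2 (.var 9) (.read 0 (.add (.add (.var 9) (.var 9)) (.const 3))) ;;
  write 1 (.add (.var 2) (.var 9)) (.read 0 (.add (.add (.var 9) (.var 9)) (.const 3))) ;;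
  write 2 (.add (.var 2) (.var 9)) (.read 0 (.add (.add (.var 9) (.var 9)) (.const 2)))

/-- Write the symmetric digraph to the arrays `1` and `2`. -/
def load : Cmd := .loop 9 2 loadArc

open Cmd in
/-- The algorithm, after `setup`, with guesses of `K` pairs of arcs. -/
def solve (K : ℕ) : Cmd :=
  load ;; transversalStage ;; goodStage ;; vertexStage ;; tryAll K ;;
    ite (.var 25) skip (set 0 (.const 0) ;; emit (.const 0))

theorem exec_setup (K : ℕ) (s : State) :
    Exec (setup K).compile s ((setup K).run s) 16 :=
  .seq (.set _ _ _) (.seq (.set _ _ _) (.seq (.set _ _ _) (.seq (.set _ _ _) (.set _ _ _))))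

theorem ok_solve (K : ℕ) : (solve K).ok = true := by
  have h1 : load.ok = true := by decide
  have h2 : transversalStage.ok = true := by decide
  have h3 : goodStage.ok = true := by decide
  have h4 : vertexStage.ok = true := by decide
  simp only [solve, Cmd.ok, h1, h2, h3, h4, ok_tryAll]
  decide

theorem rep_load {s : State} (h0 : s.arr 0 = fun i => D.encode.getD i 0) (h1 : s.var 1 = n)
    (h2 : s.var 2 = m) (h3 : s.var 3 = 2 * m) (h5 : s.var 5 = n + 1) : Rep D (load.run s) := by
  have key := Cmd.loop_rule (s := s) (i := 9) (b := 2) (p := loadArc)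
    (fun j u => ∀ a : Fin m, (a : ℕ) < j → u.arr 1 a = D.tail a ∧ u.arr 2 a = D.head a ∧
      u.arr 1 (m + a) = D.head a ∧ u.arr 2 (m + a) = D.tail a) (by decide)
    (fun a ha => absurd ha (Nat.not_lt_zero _)) (fun j u hj hu hF hI a ha => ?_)
  · rw [h2] at key
    refine ⟨?_, ?_, ?_, ?_, ?_, ?_⟩
    · rw [Cmd.run_var _ (by decide), h1]
    · rw [Cmd.run_var _ (by decide), h2]
    · rw [Cmd.run_var _ (by decide), h3]
    · rw [Cmd.run_var _ (by decide), h5]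
    · rintro (a | a)
      · exact (key a a.2).1
      · exact (key a a.2).2.2.1
    · rintro (a | a)
      · exact (key a a.2).2.1
      · exact (key a a.2).2.2.2
  · have hu0 : u.arr 0 = fun i => D.encode.getD i 0 := by rw [hF.2 0 (by decide), h0]
    have hu2 : u.var 2 = m := by rw [hF.1 2 (by decide), h2]
    rw [h2] at hj
    have e1 := getD_encode_tail (D := D) ⟨j, hj⟩
    have e2 := getD_encode_head (D := D) ⟨j, hj⟩
    simp only [two_mul] at e1 e2
    have ham := a.2
    rcases Nat.lt_succ_iff_lt_or_eq.1 ha with haj | haj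
    · have := hI a haj
      simp [loadArc, hu0, hu, hu2, this, show (a : ℕ) ≠ j by omega,
        show (a : ℕ) ≠ m + j by omega, show m + (a : ℕ) ≠ j by omega]
    · have : (⟨j, hj⟩ : Fin m) = a := Fin.ext haj.symm
      rw [this] at e1 e2
      simp only [← haj, List.getD_eq_getElem?_getD] at e1 e2 hu ⊢
      simp [loadArc, hu0, hu, hu2, e1, e2, show m ≠ 0 by omega]

/-- If `F` is a minimal good arc set, then failure of all guesses shows that there is no pair of
disjoint cycles. -/
theorem not_isDisjointPair_of_fails {F : Set (Fin m)} (hF : D.IsGood F)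
    (hFmin : ∀ a ∈ F, ¬ D.IsGood (F \ {a})) {r : Fin n} (hr : r ∈ D.transversalVertices) {k : ℕ}
    (hk : D.transversalVertices.ncard ≤ k)
    (hfail : ∀ g : Fin (3 * k) → Fin m × Fin m, Fails D F g) :
    ¬ ∃ B C, D.IsDisjointPair B C := fun hsol => by
  obtain ⟨g, hg⟩ := D.exists_guess hF hFmin hr hk hsol
  obtain ⟨Mk, h1, h2⟩ := hfail g
  exact h2 (hg Mk h1)

theorem solve_spec {k : ℕ} {s : State} (h : Rep D (load.run s)) (h4 : s.var 4 = 3 * k)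
    (h6 : s.arr 6 n = 0) (h25 : s.var 25 = 0) {r : Fin n} (hr : r ∈ D.transversalVertices)
    (hk : D.transversalVertices.ncard ≤ k) (hB : ∃ B, D.IsDicycle B) :
    ∃ ans : Answer n m, D.IsCorrectAnswer ans ∧
      output ((solve (3 * k)).run s) = encodeAnswer ans := by
  set s₁ := load.run s with hs₁
  set s₂ := transversalStage.run s₁ with hs₂
  set s₃ := goodStage.run s₂ with hs₃
  set s₄ := vertexStage.run s₃ with hs₄
  set s₅ := (tryAll (3 * k)).run s₄ with hs₅
  have hrun : (solve (3 * k)).run s =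
    (Cmd.ite (.var 25) .skip (.seq (.set 0 (.const 0)) (emit (.const 0)))).run s₅ := rfl
  have h₂ : Rep D s₂ := h.frame (Cmd.frame_run _ s₁) (by decide) (by decide)
  have h₃ : Rep D s₃ := h₂.frame (Cmd.frame_run _ s₂) (by decide) (by decide)
  have h₄ : Rep D s₄ := h₃.frame (Cmd.frame_run _ s₃) (by decide) (by decide)
  obtain ⟨ht, h7⟩ := h.transversalStage_spec (by rw [hs₁, Cmd.run_arr _ (by decide), h6])
  obtain ⟨hF, hFmin⟩ := h₂.goodStage_spec ht (by rw [h7]; exact D.isGood_univ hB)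
  rw [← hs₃] at hF hFmin
  set F := s₃.arcs m 7 with hFdef
  have hbase : Base D F (3 * k) s₄ := by
    refine ⟨h₄, ?_, h₃.vertexStage_spec, ?_⟩
    · simp only [hFdef, State.arcs, hs₄, Cmd.run_arr s₃ (show 7 ∉ vertexStage.wa by decide)]
    · rw [hs₄, Cmd.run_var _ (by decide), hs₃, Cmd.run_var _ (by decide), hs₂,
        Cmd.run_var _ (by decide), hs₁, Cmd.run_var _ (by decide), h4]
  have h25₄ : s₄.var 25 = 0 := by
    rw [hs₄, Cmd.run_var _ (by decide), hs₃, Cmd.run_var _ (by decide), hs₂,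
      Cmd.run_var _ (by decide), hs₁, Cmd.run_var _ (by decide), h25]
  have hvac : ∀ g : Fin (3 * k) → Fin m × Fin m, Agrees (3 * k) s₄ g :=
    fun _ i hi => absurd i.2 (by omega)
  obtain ⟨B, hB⟩ := hB
  obtain ⟨a, -⟩ := List.exists_mem_of_ne_nil B hB.1
  have key := hbase.tryAll_spec le_rfl h25₄ ⟨fun _ => (a, a), hvac _⟩
  rw [← hs₅] at key
  rcases key with ⟨h1, B', C, h2, h3⟩ | ⟨h1, h2⟩
  · refine ⟨some (B', C), h2, ?_⟩
    rw [hrun, Cmd.run_ite_of_ne (by rw [Exp.eval, h1]; decide), Cmd.run_skip, h3]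
  · refine ⟨none, not_isDisjointPair_of_fails hF hFmin hr hk fun g => h2 g (hvac g), ?_⟩
    rw [hrun, Cmd.run_ite_of_eq (by rw [Exp.eval, h1]), Cmd.run_seq, output_emit]
    simp [output, encodeAnswer]

end RAM

theorem mainTheorem2 (k : ℕ) :
    ∃ (P : RAM.Prog) (p : Polynomial ℕ),
      ∀ (n m : ℕ) (D : Multidigraph (Fin n) (Fin m)),
        D.transversalNumber = 1 → D.transversalVertices.ncard ≤ k →
          ∃ ans : Multidigraph.Answer n m,
            D.IsCorrectAnswer ans ∧
              RAM.OutputsWithin P D.encode (Multidigraph.encodeAnswer ans) (p.eval (n + m)) := by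
  -- All loops run up to one of `n`, `m`, `2 * m`, `3 * k`, `n + 1`.
  refine ⟨.seq (RAM.setup (3 * k)).compile (RAM.solve (3 * k)).compile,
    16 + (RAM.solve (3 * k)).bound.comp (2 * .X + .C (3 * k + 1)), fun n m D hD hk => ?_⟩
  obtain ⟨⟨r, hr⟩, hB⟩ := D.exists_transversal_of_transversalNumber_eq_one hD
  set s := (RAM.setup (3 * k)).run (RAM.init D.encode) with hs
  have h0 : s.arr 0 = fun i => D.encode.getD i 0 := by
    funext i
    simp [hs, RAM.setup, RAM.init]
  have h1 : s.var 1 = n := by simp [hs, RAM.setup, RAM.init, Multidigraph.encode]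
  have h2 : s.var 2 = m := by simp [hs, RAM.setup, RAM.init, Multidigraph.encode]
  have h3 : s.var 3 = 2 * m := by
    simp [hs, RAM.setup, RAM.init, Multidigraph.encode, two_mul]
  have h4 : s.var 4 = 3 * k := by simp [hs, RAM.setup]
  have h5 : s.var 5 = n + 1 := by simp [hs, RAM.setup, RAM.init, Multidigraph.encode]
  obtain ⟨ans, hans, hout⟩ := RAM.solve_spec (RAM.rep_load h0 h1 h2 h3 h5) h4
    (by simp [hs, RAM.setup, RAM.init]) (by simp [hs, RAM.setup, RAM.init]) hr hk hB
  obtain ⟨t, ht, hexec⟩ := RAM.Cmd.exists_exec (N := 2 * (n + m) + (3 * k + 1)) s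
    (RAM.ok_solve (3 * k)) (by
      simp only [List.mem_cons, List.not_mem_nil, or_false, forall_eq_or_imp, forall_eq, h1, h2,
        h3, h4, h5]
      omega)
  refine ⟨ans, hans, _, 16 + t, .seq (RAM.exec_setup _ _) hexec, hout, ?_⟩
  simpa using ht
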